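/- **Setting.** Let $\Omega\subset\mathbb R^2$ be a bounded domain with smooth boundary $\Gamma=\partial\Omega$ (a finite disjoint union of smooth closed curves), outward unit normal $\nu=(\nu_1,\nu_2)^\top$, and let $d/ds$ be the arc-length derivative along $\Gamma$ in the direction $(-\nu_2,\nu_1)^\top$. Let $\lambda,\mu,\nu_p,\nu_u,B,\rho_s,\rho_f,\rho_a,\phi,\kappa,\omega$ be real with $\mu,\lambda+\mu,\rho_f,\phi,\kappa,\omega>0$ and $B,\,1-2\nu_p,\,1+\nu_u,\,1-2\nu_u,\,\nu_u-\nu_p$ nonzero, and put $$\rho=(1-\phi)\rho_s+\phi\rho_f,\quad \alpha=\tfrac{3(\nu_u-\nu_p)}{B(1-2\nu_p)(1+\nu_u)},\quad R=\tfrac{2\phi^2\mu B^2(1-2\nu_p)(1+\nu_u)^2}{9(\nu_u-\nu_p)(1-2\nu_u)},$$ $$\beta=\tfrac{\omega\phi^2\rho_f\kappa}{i\phi^2+\omega\kappa(\rho_a+\phi\rho_f)},\quad q=\tfrac{\omega^2\phi^2\rho_f}{\beta R},\quad \gamma=-\tfrac{i\omega\rho_f(\alpha-\beta)}{\beta},\quad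 \epsilon=\tfrac{i\omega\gamma(\alpha-\beta)}{q(\lambda+2\mu)},$$ $$k_p=\omega\sqrt{\tfrac{\rho-\beta\rho_f}{\lambda+2\mu}},\qquad k_s=\omega\sqrt{\tfrac{\rho-\beta\rho_f}{\mu}}.$$ Let $k_1,k_2\in\mathbb C$ have nonnegative imaginary parts, $k_1^2\neq k_2^2$, $k_1^2+k_2^2=q(1+\epsilon)+k_p^2$ and $k_1^2k_2^2=qk_p^2$. Let $\gamma_k(x,y)=\frac i4H^{(1)}_0(k|x-y|)$, and let $E=\begin{bmatrix}E_{11}&E_{12}\\E_{21}^\top&E_{22}\end{bmatrix}$ be given by $$E_{11}=\tfrac1\mu\gamma_{k_s}I+\tfrac1{(\rho-\beta\rho_f)\omega^2}\nabla_x\nabla_x^\top\Big[\gamma_{k_s}-\tfrac{k_p^2-k_2^2}{k_1^2-k_2^2}\gamma_{k_1}+\tfrac{k_p^2-k_1^2}{k_1^2-k_2^2}\gamma_{k_2}\Big],$$ $$E_{12}=\tfrac{i\omega\gamma}{(\lambda+2\mu)(k_1^2-k_2^2)}\nabla_x[\gamma_{k_1}-\gamma_{k_2}],\qquad E_{21}=-\tfrac{\gamma}{(\lambda+2\mu)(k_1^2-k_2^2)}\nabla_x[\gamma_{k_1}-\gamma_{k_2}],$$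 $$E_{22}=\tfrac{i\rho_f\omega}{\beta(k_1^2-k_2^2)}\big[(k_p^2-k_1^2)\gamma_{k_1}-(k_p^2-k_2^2)\gamma_{k_2}\big].$$ With $T(\partial,\nu)u=2\mu\partial_\nu u+\lambda\nu\nabla\cdot u+\mu(-\nu_2,\nu_1)^\top(\partial_2u_1-\partial_1u_2)$ let $$\widetilde T=\begin{bmatrix}T&-\alpha\nu\\-i\omega\beta\nu^\top&\frac{i\beta}{\omega\rho_f}\partial_\nu\end{bmatrix},\qquad \widetilde T^*=\begin{bmatrix}T&-i\omega\alpha\nu\\-\beta\nu^\top&\frac{i\beta}{\omega\rho_f}\partial_\nu\end{bmatrix}.$$ The hypersingular operator is $$N(\psi)(x)=\int_\Gamma\widetilde T(\partial_x,\nu_x)\big(\widetilde T^*(\partial_y,\nu_y)E(x,y)\big)^\top\psi(y)\,ds_y,\qquad x\in\Gamma,$$ in the sense of the Hadamard finite part (the constant term in the expansion, as $\varepsilon\to0^+$, of the integral over $\{y\in\Gamma:|x-y|>\varepsilon\}$, the divergent terms being multiples of $1/\varepsilon$ and $\log\varepsilon$). Write $N=\begin{bmatrix}N_1&N_2\\N_3&N_4\end{bmatrix}$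 on $\psi=(u^\top,p)^\top$, and let $A=\begin{bmatrix}0&-1\\1&0\end{bmatrix}$. **Lemma.** For every $u\in C^1(\Gamma;\mathbb C^2)$ and every $x\in\Gamma$, the finite part defining $N_3(u)(x)$ exists, $N_3^2(du/ds)$ is differentiable along $\Gamma$ at $x$, and $$N_3(u)=N_3^1(u)+\frac{d}{ds}\,N_3^2\Big(\frac{du}{ds}\Big)+N_3^3\Big(\frac{du}{ds}\Big)\quad\text{at }x,$$ where $N_3^1,N_3^2,N_3^3$ are the following integral operators, whose kernels are weakly singular (continuous for $x\ne y$ and bounded by $C|x-y|^{-\sigma}$ for some $C$ and some $\sigma\in[0,1)$): $$\begin{aligned} N_3^1(u)(x)=&-i\omega\beta\int_\Gamma\nu_x^\top\nabla_x\Big[\gamma_{k_s}-\gamma_{k_1}-\tfrac{k_2^2-q}{k_1^2-k_2^2}(\gamma_{k_1}-\gamma_{k_2})\Big]\nu_y^\top u(y)\,ds_y\\ &-i\omega\beta\int_\Gamma\big[\partial_{\nu_y}\gamma_{k_s}\,\nu_x^\top-i\omega\alpha\,\nu_x^\top E_{21}\nu_y^\top\big]u(y)\,ds_y\\ &-\tfrac{\beta\gamma}{\rho_f(k_1^2-k_2^2)}\int_\Gamma\partial_{\nu_x}\big[k_1^2\gamma_{k_1}-k_2^2\gamma_{k_2}\big]\nu_y^\top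 u(y)\,ds_y\\ &+\tfrac{i\omega\alpha}{k_1^2-k_2^2}\int_\Gamma\partial_{\nu_x}\big[(k_p^2-k_1^2)\gamma_{k_1}-(k_p^2-k_2^2)\gamma_{k_2}\big]\nu_y^\top u(y)\,ds_y,\\ N_3^2(u)(x)=&-\tfrac{2\mu\beta\gamma}{\rho_f(\lambda+2\mu)(k_1^2-k_2^2)}\int_\Gamma\nabla_x^\top[\gamma_{k_1}-\gamma_{k_2}]u(y)\,ds_y,\\ N_3^3(u)(x)=&-i\omega\beta\int_\Gamma\nu_x^\top\big[2\mu E_{11}-\gamma_{k_s}I\big]A\,u(y)\,ds_y\\ &+\tfrac{2\mu\beta\gamma}{\rho_f(\lambda+2\mu)(k_1^2-k_2^2)}\int_\Gamma\big[k_1^2\gamma_{k_1}-k_2^2\gamma_{k_2}\big]\nu_x^\top A\,u(y)\,ds_y. \end{aligned}$$ All kernels are evaluated at $(x,y)$, and the square roots are principal. -/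

import Mathlib

namespace Poro

noncomputable section

/-! ### The plane and its partial derivatives -/

/-- The Euclidean plane. -/
abbrev Plane : Type := EuclideanSpace ℝ (Fin 2)

/-- The partial derivative `∂ᵢ f (x)` of a complex-valued function on the plane. -/
def pd (i : Fin 2) (f : Plane → ℂ) (x : Plane) : ℂ :=
  fderiv ℝ f x (EuclideanSpace.single i (1 : ℝ))

/-- The directional derivative `n · ∇ f (x)`. -/
def dn (n : Fin 2 → ℝ) (f : Plane → ℂ) (x : Plane) : ℂ :=
  ∑ i, (n i : ℂ) * pd i f x

/-- The principal square root of a complex number. -/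
def csqrt (z : ℂ) : ℂ := z ^ (1 / 2 : ℂ)

/-! ### The Hankel function `H₀⁽¹⁾` and the Helmholtz fundamental solution -/

/-- The Bessel function `J₀(z) = ∑ (-1)^m (z²/4)^m / (m!)²`. -/
def besselJ0 (z : ℂ) : ℂ :=
  ∑' m : ℕ, (-1) ^ m * (z ^ 2 / 4) ^ m / ((m.factorial : ℂ) ^ 2)

/-- The Bessel function of the second kind (principal branch),
`Y₀(z) = (2/π) (log (z/2) + γ) J₀(z) - (2/π) ∑ (-1)^m h_m (z²/4)^m / (m!)²`, where `γ` is
the Euler-Mascheroni constant and `h_m = 1 + 1/2 + ⋯ + 1/m` (so that `h_0 = 0`). -/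
def besselY0 (z : ℂ) : ℂ :=
  (2 / (Real.pi : ℂ)) * (Complex.log (z / 2) + (Real.eulerMascheroniConstant : ℂ)) * besselJ0 z
    - (2 / (Real.pi : ℂ)) *
      ∑' m : ℕ, (-1) ^ m * ((harmonic m : ℚ) : ℂ) * (z ^ 2 / 4) ^ m / ((m.factorial : ℂ) ^ 2)

/-- The Hankel function of the first kind `H₀⁽¹⁾ = J₀ + i Y₀`. -/
def hankel0 (z : ℂ) : ℂ := besselJ0 z + Complex.I * besselY0 z

/-- `γ_k(x,y) = (i/4) H₀⁽¹⁾(k |x - y|)`. -/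
def helm (k : ℂ) (x y : Plane) : ℂ :=
  Complex.I / 4 * hankel0 (k * ((dist x y : ℝ) : ℂ))

/-! ### The poroelastic medium -/

/-- The physical parameters of the medium and the frequency `omega`. The inequations say that
the expressions for `α`, `β`, `R`, `q`, `γ` below have nonzero denominators. -/
structure Medium where
  /-- Lamé parameter `λ` -/
  lam : ℝ
  /-- Lamé parameter `μ` -/
  mu : ℝ
  /-- Poisson ratio `ν_p` -/
  nup : ℝ
  /-- undrained Poisson ratio `ν_u` -/
  nuu : ℝ
  /-- Skempton pore pressure coefficient `B` -/
  B : ℝ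
  /-- solid density `ρ_s` -/
  rhos : ℝ
  /-- fluid density `ρ_f` -/
  rhof : ℝ
  /-- apparent mass density `ρ_a` -/
  rhoa : ℝ
  /-- porosity `φ` -/
  phi : ℝ
  /-- permeability coefficient `κ` -/
  kappa : ℝ
  /-- frequency `ω` -/
  omega : ℝ
  mu_pos : 0 < mu
  lam_add_mu_pos : 0 < lam + mu
  rhof_pos : 0 < rhof
  phi_pos : 0 < phi
  kappa_pos : 0 < kappa
  omega_pos : 0 < omega
  B_ne : B ≠ 0
  nup_ne : 1 - 2 * nup ≠ 0
  nuu_ne : 1 + nuu ≠ 0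
  nuu_ne' : 1 - 2 * nuu ≠ 0
  nu_ne : nuu - nup ≠ 0

namespace Medium

variable (M : Medium)

/-- bulk density `ρ` -/
def rho : ℝ := (1 - M.phi) * M.rhos + M.phi * M.rhof

/-- compressibility `α` -/
def alpha : ℝ :=
  3 * (M.nuu - M.nup) / (M.B * (1 - 2 * M.nup) * (1 + M.nuu))

/-- constitutive coefficient `R` -/
def R : ℝ :=
  2 * M.phi ^ 2 * M.mu * M.B ^ 2 * (1 - 2 * M.nup) * (1 + M.nuu) ^ 2 /
    (9 * (M.nuu - M.nup) * (1 - 2 * M.nuu))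

/-- `β = ω φ² ρ_f κ / (i φ² + ω κ (ρ_a + φ ρ_f))` -/
def beta : ℂ :=
  (M.omega * M.phi ^ 2 * M.rhof * M.kappa : ℂ) /
    (Complex.I * M.phi ^ 2 + M.omega * M.kappa * (M.rhoa + M.phi * M.rhof))

/-- `q = ω² φ² ρ_f / (β R)` -/
def q : ℂ := (M.omega ^ 2 * M.phi ^ 2 * M.rhof : ℂ) / (M.beta * M.R)

/-- `γ = - i ω ρ_f (α - β) / β` -/
def gam : ℂ := -(Complex.I * M.omega * M.rhof * (M.alpha - M.beta)) / M.beta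

/-- the compressional wave number `k_p = ω √((ρ - β ρ_f) / (λ + 2 μ))` -/
def kp : ℂ := M.omega * csqrt ((M.rho - M.beta * M.rhof) / (M.lam + 2 * M.mu))

/-- the shear wave number `k_s = ω √((ρ - β ρ_f) / μ)` -/
def ks : ℂ := M.omega * csqrt ((M.rho - M.beta * M.rhof) / M.mu)

/-- `ε = i ω γ (α - β) / (q (λ + 2 μ))` -/
def eps : ℂ :=
  Complex.I * M.omega * M.gam * (M.alpha - M.beta) / (M.q * (M.lam + 2 * M.mu))

/-- `k₁, k₂` are the roots, with nonnegative imaginary parts, of the characteristic system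
`k₁² + k₂² = q (1 + ε) + k_p²`, `k₁² k₂² = q k_p²`. -/
def IsWaveNumberPair (k₁ k₂ : ℂ) : Prop :=
  0 ≤ k₁.im ∧ 0 ≤ k₂.im ∧
    k₁ ^ 2 + k₂ ^ 2 = M.q * (1 + M.eps) + M.kp ^ 2 ∧ k₁ ^ 2 * k₂ ^ 2 = M.q * M.kp ^ 2

/-! ### The fundamental solution of the adjoint system -/

variable (k₁ k₂ : ℂ)

/-- The `2 × 2` block `E₁₁(x,y)`. -/
def E11 (x y : Plane) : Matrix (Fin 2) (Fin 2) ℂ := fun i j =>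
  1 / (M.mu : ℂ) * helm M.ks x y * (1 : Matrix (Fin 2) (Fin 2) ℂ) i j +
    1 / ((M.rho - M.beta * M.rhof) * M.omega ^ 2) *
      pd i (fun x' => pd j (fun x'' =>
        helm M.ks x'' y
          - (M.kp ^ 2 - k₂ ^ 2) / (k₁ ^ 2 - k₂ ^ 2) * helm k₁ x'' y
          + (M.kp ^ 2 - k₁ ^ 2) / (k₁ ^ 2 - k₂ ^ 2) * helm k₂ x'' y) x') x

/-- The column `E₁₂(x,y)`. -/
def E12 (x y : Plane) : Fin 2 → ℂ := fun i =>
  Complex.I * M.omega * M.gam / ((M.lam + 2 * M.mu) * (k₁ ^ 2 - k₂ ^ 2)) *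
    pd i (fun x' => helm k₁ x' y - helm k₂ x' y) x

/-- The column `E₂₁(x,y)` (it enters the fundamental solution transposed). -/
def E21 (x y : Plane) : Fin 2 → ℂ := fun i =>
  -M.gam / ((M.lam + 2 * M.mu) * (k₁ ^ 2 - k₂ ^ 2)) *
    pd i (fun x' => helm k₁ x' y - helm k₂ x' y) x

/-- The scalar `E₂₂(x,y)`. -/
def E22 (x y : Plane) : ℂ :=
  Complex.I * M.rhof * M.omega / (M.beta * (k₁ ^ 2 - k₂ ^ 2)) *
    ((M.kp ^ 2 - k₁ ^ 2) * helm k₁ x y - (M.kp ^ 2 - k₂ ^ 2) * helm k₂ x y)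

/-- The `3 × 3` fundamental solution `E(x,y) = [E₁₁, E₁₂; E₂₁ᵀ, E₂₂]`; the index `inl i` stands
for the displacement components, `inr ()` for the pressure. -/
def E (x y : Plane) : Matrix (Fin 2 ⊕ Unit) (Fin 2 ⊕ Unit) ℂ :=
  Matrix.fromBlocks (M.E11 k₁ k₂ x y) (Matrix.of fun i _ => M.E12 k₁ k₂ x y i)
    (Matrix.of fun _ j => M.E21 k₁ k₂ x y j) (Matrix.of fun _ _ => M.E22 k₁ k₂ x y)

/-! ### Boundary operators -/

/-- The traction operator
`T(∂,ν)u = 2μ ∂_ν u + λ ν ∇·u + μ ν^⊥ (∂₂u₁ - ∂₁u₂)`, `ν^⊥ = (-ν₂, ν₁)`. -/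
def traction (n : Fin 2 → ℝ) (u : Plane → Fin 2 → ℂ) (x : Plane) : Fin 2 → ℂ := fun i =>
  2 * M.mu * dn n (fun z => u z i) x
    + M.lam * n i * (∑ j, pd j (fun z => u z j) x)
    + M.mu * ((![-n 1, n 0] i : ℝ) : ℂ) * (pd 1 (fun z => u z 0) x - pd 0 (fun z => u z 1) x)

/-- The Neumann boundary operator
`T̃(∂,ν) = [T(∂,ν), -αν; -iωβνᵀ, (iβ/(ωρ_f)) ∂_ν]`. -/
def neumann (n : Fin 2 → ℝ) (U : Plane → Fin 2 ⊕ Unit → ℂ) (x : Plane) :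
    Fin 2 ⊕ Unit → ℂ :=
  Sum.elim
    (fun i => M.traction n (fun z l => U z (Sum.inl l)) x i
      - M.alpha * n i * U x (Sum.inr ()))
    (fun _ => -(Complex.I * M.omega * M.beta) * (∑ l, (n l : ℂ) * U x (Sum.inl l))
      + Complex.I * M.beta / (M.omega * M.rhof) * dn n (fun z => U z (Sum.inr ())) x)

/-- The Neumann boundary operator of the adjoint system,
`T̃*(∂,ν) = [T(∂,ν), -iωαν; -βνᵀ, (iβ/(ωρ_f)) ∂_ν]`. -/
def neumannAdj (n : Fin 2 → ℝ) (U : Plane → Fin 2 ⊕ Unit → ℂ) (x : Plane) :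
    Fin 2 ⊕ Unit → ℂ :=
  Sum.elim
    (fun i => M.traction n (fun z l => U z (Sum.inl l)) x i
      - Complex.I * M.omega * M.alpha * n i * U x (Sum.inr ()))
    (fun _ => -M.beta * (∑ l, (n l : ℂ) * U x (Sum.inl l))
      + Complex.I * M.beta / (M.omega * M.rhof) * dn n (fun z => U z (Sum.inr ())) x)

/-- The matrix `T̃*(∂_y,ν_y) E(x,y)` (the operator acts on each column of `E(x,·)`). -/
def adjE (ny : Fin 2 → ℝ) (x y : Plane) : Matrix (Fin 2 ⊕ Unit) (Fin 2 ⊕ Unit) ℂ :=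
  Matrix.of fun i j => M.neumannAdj ny (fun z l => M.E k₁ k₂ x z l j) y i

/-- The kernel `T̃(∂_x,ν_x) (T̃*(∂_y,ν_y) E(x,y))ᵀ` of the hypersingular operator. -/
def hyperKernel (nx ny : Fin 2 → ℝ) (x y : Plane) :
    Matrix (Fin 2 ⊕ Unit) (Fin 2 ⊕ Unit) ℂ :=
  Matrix.of fun i j =>
    M.neumann nx (fun z l => (M.adjE k₁ k₂ ny z y).transpose l j) x i

/-! ### The kernels of the regularized formulation (row vectors) -/

/-- The matrix `A`. -/
def matA : Matrix (Fin 2) (Fin 2) ℂ := !![0, -1; 1, 0]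

/-- The kernel of `N₃¹`. -/
def kernel1 (nx ny : Fin 2 → ℝ) (x y : Plane) : Fin 2 → ℂ := fun j =>
  -(Complex.I * M.omega * M.beta) *
      dn nx (fun z => helm M.ks z y - helm k₁ z y
        - (k₂ ^ 2 - M.q) / (k₁ ^ 2 - k₂ ^ 2) * (helm k₁ z y - helm k₂ z y)) x * ny j
    - Complex.I * M.omega * M.beta *
      (dn ny (fun z => helm M.ks x z) y * nx j
        - Complex.I * M.omega * M.alpha * (∑ i, (nx i : ℂ) * M.E21 k₁ k₂ x y i) * ny j)
    - M.beta * M.gam / (M.rhof * (k₁ ^ 2 - k₂ ^ 2)) *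
      dn nx (fun z => k₁ ^ 2 * helm k₁ z y - k₂ ^ 2 * helm k₂ z y) x * ny j
    + Complex.I * M.omega * M.alpha / (k₁ ^ 2 - k₂ ^ 2) *
      dn nx (fun z => (M.kp ^ 2 - k₁ ^ 2) * helm k₁ z y
        - (M.kp ^ 2 - k₂ ^ 2) * helm k₂ z y) x * ny j

/-- The kernel of `N₃²`. -/
def kernel2 (x y : Plane) : Fin 2 → ℂ := fun j =>
  -(2 * M.mu * M.beta * M.gam / (M.rhof * (M.lam + 2 * M.mu) * (k₁ ^ 2 - k₂ ^ 2))) *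
    pd j (fun z => helm k₁ z y - helm k₂ z y) x

/-- The kernel of `N₃³`. -/
def kernel3 (nx : Fin 2 → ℝ) (x y : Plane) : Fin 2 → ℂ := fun j =>
  -(Complex.I * M.omega * M.beta) *
      Matrix.vecMul (fun i => (nx i : ℂ))
        (((2 * M.mu : ℂ) • M.E11 k₁ k₂ x y
          - helm M.ks x y • (1 : Matrix (Fin 2) (Fin 2) ℂ)) * matA) j
    + 2 * M.mu * M.beta * M.gam / (M.rhof * (M.lam + 2 * M.mu) * (k₁ ^ 2 - k₂ ^ 2)) *
      (k₁ ^ 2 * helm k₁ x y - k₂ ^ 2 * helm k₂ x y) *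
      Matrix.vecMul (fun i => (nx i : ℂ)) matA j

end Medium

/-! ### Smooth boundaries -/

/-- The boundary of `Ω` is smooth: it is the disjoint union of finitely many smooth regular
simple closed curves, given by `2π`-periodic parametrizations, and `Ω` lies locally on one side,
the orientation being such that `(x₂', -x₁')` points out of `Ω`
(counterclockwise for the outer boundary curve). -/
structure SmoothBoundary (Ω : Set Plane) where
  /-- the number of boundary curves -/
  n : ℕ
  /-- the parametrizations -/
  curve : Fin n → ℝ → Plane
  smooth : ∀ j, ContDiff ℝ ((⊤ : ℕ∞) : WithTop ℕ∞) (curve j)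
  periodic : ∀ j, Function.Periodic (curve j) (2 * Real.pi)
  regular : ∀ j t, deriv (curve j) t ≠ 0
  simple : ∀ j, Set.InjOn (curve j) (Set.Ico 0 (2 * Real.pi))
  disjoint : ∀ j l, j ≠ l → Disjoint (Set.range (curve j)) (Set.range (curve l))
  cover : (⋃ j, Set.range (curve j)) = frontier Ω
  outward : ∀ j t, ∀ᶠ δ : ℝ in nhdsWithin 0 (Set.Ioi 0),
    curve j t + δ • !₂[deriv (curve j) t 1, -deriv (curve j) t 0] ∉ closure Ω ∧
    curve j t - δ • !₂[deriv (curve j) t 1, -deriv (curve j) t 0] ∈ Ω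

namespace SmoothBoundary

variable {Ω : Set Plane} (G : SmoothBoundary Ω)

/-- Parameters `(j, t)` of boundary points. Functions on `Γ = ∂Ω` are represented by the
corresponding functions of the parameter. -/
abbrev Param : Type := Fin G.n × ℝ

/-- The boundary point with parameter `p`. -/
def pt (p : G.Param) : Plane := G.curve p.1 p.2

/-- The speed `|x'(t)|`. -/
def speed (p : G.Param) : ℝ := ‖deriv (G.curve p.1) p.2‖

/-- The outward unit normal `ν = (x₂', -x₁') / |x'|`. -/
def normal (p : G.Param) : Fin 2 → ℝ :=
  ![deriv (G.curve p.1) p.2 1 / G.speed p, -deriv (G.curve p.1) p.2 0 / G.speed p]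

/-- The tangential derivative `d/ds`, i.e. the derivative with respect to arc length. -/
def dds {V : Type*} [NormedAddCommGroup V] [NormedSpace ℝ V] (f : G.Param → V) (p : G.Param) : V :=
  (G.speed p)⁻¹ • deriv (fun t => f (p.1, t)) p.2

/-- The function `f` on the boundary is differentiable along the boundary at `p`. -/
def TangDiffAt {V : Type*} [NormedAddCommGroup V] [NormedSpace ℝ V] (f : G.Param → V)
    (p : G.Param) : Prop :=
  DifferentiableAt ℝ (fun t => f (p.1, t)) p.2

/-- The integral `∫_Γ f ds` with respect to arc length. -/
def integral (f : G.Param → ℂ) : ℂ :=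
  ∑ j, ∫ t in Set.Ioc 0 (2 * Real.pi), f (j, t) * (G.speed (j, t) : ℂ)

/-- The parameters in one period of points of the `j`-th curve at distance more than `ε`
from `x`. -/
def outside (ε : ℝ) (x : Plane) (j : Fin G.n) : Set ℝ :=
  {t | t ∈ Set.Ioc 0 (2 * Real.pi) ∧ ε < dist x (G.curve j t)}

/-- `L` is the Hadamard finite part of `∫_Γ f ds` with singular point `x`: the constant term in
the expansion `∫_{Γ, |x-y| > ε} f ds = a / ε + b log ε + L + o(1)` as `ε → 0+`. -/
def HasFinitePart (x : Plane) (f : G.Param → ℂ) (L : ℂ) : Prop :=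
  (∀ ε : ℝ, 0 < ε → ∀ j, MeasureTheory.IntegrableOn
    (fun t => f (j, t) * (G.speed (j, t) : ℂ)) (G.outside ε x j)) ∧
  ∃ a b : ℂ, Filter.Tendsto
    (fun ε : ℝ => (∑ j, ∫ t in G.outside ε x j, f (j, t) * (G.speed (j, t) : ℂ))
      - a / (ε : ℂ) - b * (Real.log ε : ℂ))
    (nhdsWithin 0 (Set.Ioi 0)) (nhds L)

/-- The finite part is unique. -/
theorem HasFinitePart.unique {x : Plane} {f : G.Param → ℂ} {L L' : ℂ}
    (h : G.HasFinitePart x f L) (h' : G.HasFinitePart x f L') : L = L' := by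
  obtain ⟨-, a, b, h⟩ := h
  obtain ⟨-, a', b', h'⟩ := h'
  have hd := h.sub h'
  set l := nhdsWithin (0 : ℝ) (Set.Ioi 0) with hl
  have hpos : ∀ᶠ ε : ℝ in l, 0 < ε := self_mem_nhdsWithin
  have hlog : Filter.Tendsto Real.log l Filter.atBot := Real.tendsto_log_nhdsGT_zero
  have hε : Filter.Tendsto (fun ε : ℝ => (ε : ℂ)) l (nhds 0) := by
    have : Filter.Tendsto (fun ε : ℝ => (ε : ℂ)) (nhds 0) (nhds ((0 : ℝ) : ℂ)) :=
      Complex.continuous_ofReal.tendsto 0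
    simpa using this.mono_left nhdsWithin_le_nhds
  have hεlog : Filter.Tendsto (fun ε : ℝ => (ε : ℂ) * (Real.log ε : ℂ)) l (nhds 0) := by
    have h1 : Filter.Tendsto (fun ε : ℝ => Real.log ε * ε) l (nhds 0) := by
      simpa using tendsto_log_mul_rpow_nhdsGT_zero (r := 1) one_pos
    have h2 := (Complex.continuous_ofReal.tendsto 0).comp h1
    refine (h2.congr fun ε => ?_).trans (by simp)
    simp [mul_comm]
  have e1 : Filter.Tendsto
      (fun ε : ℝ => (a' - a) / (ε : ℂ) + (b' - b) * (Real.log ε : ℂ)) l (nhds (L - L')) :=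
    hd.congr fun ε => by ring
  have ha : a' - a = 0 := by
    have h1 := (hε.mul e1).sub (hεlog.const_mul (b' - b))
    have h2 : Filter.Tendsto (fun _ : ℝ => a' - a) l (nhds 0) := by
      refine (h1.congr' ?_).trans (by simp)
      filter_upwards [hpos] with ε he
      have : (ε : ℂ) ≠ 0 := by exact_mod_cast he.ne'
      field_simp
      ring
    exact tendsto_nhds_unique tendsto_const_nhds h2
  have e2 : Filter.Tendsto (fun ε : ℝ => (b' - b) * (Real.log ε : ℂ)) l (nhds (L - L')) :=
    e1.congr fun ε => by rw [ha]; simp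
  have hinv : Filter.Tendsto (fun ε : ℝ => ((Real.log ε : ℂ))⁻¹) l (nhds 0) := by
    have h2 := (Complex.continuous_ofReal.tendsto 0).comp (tendsto_inv_atBot_zero.comp hlog)
    refine (h2.congr fun ε => ?_).trans (by simp)
    simp
  have hb : b' - b = 0 := by
    have h1 := e2.mul hinv
    have h2 : Filter.Tendsto (fun _ : ℝ => b' - b) l (nhds 0) := by
      refine (h1.congr' ?_).trans (by simp)
      filter_upwards [hlog.eventually_lt_atBot 0] with ε he
      have : (Real.log ε : ℂ) ≠ 0 := by exact_mod_cast he.ne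
      rw [mul_assoc, mul_inv_cancel₀ this, mul_one]
    exact tendsto_nhds_unique tendsto_const_nhds h2
  rw [hb] at e2
  have h3 : Filter.Tendsto (fun _ : ℝ => (0 : ℂ)) l (nhds (L - L')) := by simpa using e2
  exact (sub_eq_zero.1 (tendsto_nhds_unique h3 tendsto_const_nhds))

open Classical in
/-- The Hadamard finite part of `∫_Γ f ds` with singular point `x`. -/
def finitePart (x : Plane) (f : G.Param → ℂ) : ℂ :=
  if h : ∃ L, G.HasFinitePart x f L then h.choose else 0

/-- A kernel on `Γ × Γ` is weakly singular: it is continuous off the diagonal and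
bounded by `C |x - y|^(-σ)` with some `σ < 1` (`Γ` being one-dimensional). In particular it is
integrable in each variable, so that it defines an integral operator by Lebesgue integrals. -/
def WeaklySingular (K : G.Param → G.Param → Fin 2 → ℂ) : Prop :=
  (∀ j l, ContinuousOn (fun z : ℝ × ℝ => K (j, z.1) (l, z.2))
    {z | G.curve j z.1 ≠ G.curve l z.2}) ∧
  ∃ C σ : ℝ, 0 ≤ σ ∧ σ < 1 ∧ ∀ p r, G.pt p ≠ G.pt r →
    ‖K p r‖ ≤ C * dist (G.pt p) (G.pt r) ^ (-σ)

/-- The integral operator `u ↦ ∫_Γ K(·,y) u(y) ds_y` with row-vector kernel `K`. -/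
def intOp (K : G.Param → G.Param → Fin 2 → ℂ) (u : G.Param → Fin 2 → ℂ) (p : G.Param) : ℂ :=
  G.integral fun r => ∑ j, K p r j * u r j

variable (M : Medium) (k₁ k₂ : ℂ)

/-- The integrand of the `i`-th component of the hypersingular operator at `p`, that is of
`∫_Γ T̃(∂_x,ν_x) (T̃*(∂_y,ν_y) E(x,y))ᵀ ψ(y) ds_y`. -/
def hyperIntegrand (ψ : G.Param → Fin 2 ⊕ Unit → ℂ) (p : G.Param) (i : Fin 2 ⊕ Unit)
    (r : G.Param) : ℂ :=
  ∑ j, M.hyperKernel k₁ k₂ (G.normal p) (G.normal r) (G.pt p) (G.pt r) i j * ψ r j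

/-- The hypersingular operator `N`, in the sense of the Hadamard finite part. -/
def hyperN (ψ : G.Param → Fin 2 ⊕ Unit → ℂ) (p : G.Param) : Fin 2 ⊕ Unit → ℂ := fun i =>
  G.finitePart (G.pt p) (G.hyperIntegrand M k₁ k₂ ψ p i)

/-- The pair `(uᵀ, 0)ᵀ`. -/
def withZero (u : G.Param → Fin 2 → ℂ) : G.Param → Fin 2 ⊕ Unit → ℂ := fun r =>
  Sum.elim (u r) (fun _ => 0)

/-- The `(2,1)` block `N₃` of `N = [N₁, N₂; N₃, N₄]`. -/
def N3 (u : G.Param → Fin 2 → ℂ) (p : G.Param) : ℂ :=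
  G.hyperN M k₁ k₂ (G.withZero u) p (Sum.inr ())

/-- The kernel of `N₃¹` on `Γ × Γ`. -/
def ker31 (p r : G.Param) : Fin 2 → ℂ :=
  M.kernel1 k₁ k₂ (G.normal p) (G.normal r) (G.pt p) (G.pt r)

/-- The kernel of `N₃²` on `Γ × Γ`. -/
def ker32 (p r : G.Param) : Fin 2 → ℂ := M.kernel2 k₁ k₂ (G.pt p) (G.pt r)

/-- The kernel of `N₃³` on `Γ × Γ`. -/
def ker33 (p r : G.Param) : Fin 2 → ℂ :=
  M.kernel3 k₁ k₂ (G.normal p) (G.pt p) (G.pt r)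

/-- The operator `N₃¹`. -/
def N31 : (G.Param → Fin 2 → ℂ) → G.Param → ℂ := G.intOp (G.ker31 M k₁ k₂)

/-- The operator `N₃²`. -/
def N32 : (G.Param → Fin 2 → ℂ) → G.Param → ℂ := G.intOp (G.ker32 M k₁ k₂)

/-- The operator `N₃³`. -/
def N33 : (G.Param → Fin 2 → ℂ) → G.Param → ℂ := G.intOp (G.ker33 M k₁ k₂)

end SmoothBoundary

end

end Poro

/-! Put `w = x - y` and `s = |w|²`. Each `γ_k` has the form `log s · a(s) + b(s)` with `a`, `b`
entire and `a(0) = -1/(4π)` for every `k` (`helm_eq_helmJet`), so all kernels are combinations of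
derivatives of radial functions, and their singularities can be read off from `a(0)`. The
combinations entering `E₁₁`, `E₁₂` and `E₂₁` through derivatives have weights summing to zero: there
`a(0) = 0`, the gradient is `O(|w|^(1/2))` and the second derivatives are `O(|w|^(-1/2))`.

The core is the pointwise identity `hyperKernel_eq`. In the plane `ν_i ∂_j - ν_j ∂_i` is a
tangential derivative, so a third derivative `ν_i ∂_i ∂_j ∂_l Φ` is a tangential derivative of
second derivatives of `Φ` plus `ν_j Δ ∂_l Φ`, and the Helmholtz equation lowers the order of the
last term. With the relations among the constants (`k₁² k₂² = q k_p²` and the definitions of `k_p`,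
`k_s`), the kernel of `N₃` becomes the kernel of `N₃¹` minus the tangential `y`-derivative of
`fluxKernel`, which is the kernel of `N₃³` plus the tangential `x`-derivative of the kernel of
`N₃²`.

Integrating by parts outside the disc of radius `ε` moves the derivative onto `u`
(`IsClosedCurve.tendsto_by_parts`). The two endpoints lie at the same distance `ε` from `x` in
nearly opposite directions, and `fluxKernel` is even to leading order (`Mild`), so the boundary
terms tend to zero. The truncated integrals therefore converge, and the finite part is an ordinary
limit. The `x`-derivative inside `fluxKernel` is then taken out of the integral by
`IsClosedCurve.hasDerivAt_integral`.

The three kernels are weakly singular because `N₃¹` contains only normal derivatives, for which `ν ·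
(x - y) = O(|x - y|²)` on a smooth boundary, while `N₃²` and `N₃³` contain only logarithms and the
mild derivatives described above. -/

namespace Poro

noncomputable section

open Filter Topology

/-! ### Entire power series on the real line -/

/-- The coefficients of the derivative of a power series. -/
def shiftCoeff (c : ℕ → ℂ) (m : ℕ) : ℂ := (m + 1) * c (m + 1)

/-- The sum of a power series at a real point. -/
def ser (c : ℕ → ℂ) (s : ℝ) : ℂ := ∑' m, c m * (s : ℂ) ^ m

/-- Coefficients bounded by those of an exponential. -/
def ExpBdd (c : ℕ → ℂ) : Prop :=
  ∃ C r : ℝ, 0 ≤ C ∧ 0 ≤ r ∧ ∀ m, ‖c m‖ ≤ C * (r ^ m / m.factorial)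

theorem ExpBdd.shift {c : ℕ → ℂ} (h : ExpBdd c) : ExpBdd (shiftCoeff c) := by
  obtain ⟨C, r, hC, hr, h⟩ := h
  refine ⟨C * r, r, by positivity, hr, fun m => ?_⟩
  have h1 : ‖((m : ℂ) + 1)‖ = m + 1 := by
    rw [← Nat.cast_succ, Complex.norm_natCast]; push_cast; rfl
  rw [shiftCoeff, norm_mul, h1]
  calc ((m : ℝ) + 1) * ‖c (m + 1)‖
      ≤ (m + 1) * (C * (r ^ (m + 1) / (m + 1).factorial)) := by gcongr; exact h _
    _ = C * r * (r ^ m / m.factorial) := by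
      rw [Nat.factorial_succ]; push_cast; field_simp; ring

theorem ExpBdd.iterate_shift {c : ℕ → ℂ} (h : ExpBdd c) (n : ℕ) :
    ExpBdd (shiftCoeff^[n] c) := by
  induction n with
  | zero => exact h
  | succ n ih => rw [Function.iterate_succ_apply']; exact ih.shift

theorem ExpBdd.summable_bound {c : ℕ → ℂ} (h : ExpBdd c) (ρ : ℝ) :
    ∃ u : ℕ → ℝ, Summable u ∧ ∀ m (z : ℂ), ‖z‖ ≤ ρ → ‖c m * z ^ m‖ ≤ u m := by
  obtain ⟨C, r, hC, hr, h⟩ := h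
  refine ⟨fun m => C * ((r * ρ) ^ m / m.factorial),
    (Real.summable_pow_div_factorial (r * ρ)).mul_left C, fun m z hz => ?_⟩
  rw [norm_mul, norm_pow]
  calc ‖c m‖ * ‖z‖ ^ m ≤ C * (r ^ m / m.factorial) * ρ ^ m := by gcongr; exact h m
    _ = C * ((r * ρ) ^ m / m.factorial) := by rw [mul_pow]; ring

theorem ExpBdd.hasSum {c : ℕ → ℂ} (h : ExpBdd c) (s : ℝ) :
    HasSum (fun m => c m * (s : ℂ) ^ m) (ser c s) := by
  obtain ⟨u, hu, hb⟩ := h.summable_bound ‖(s : ℂ)‖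
  exact (Summable.of_norm_bounded hu fun m => hb m _ le_rfl).hasSum

/-- Termwise differentiation is carried out in the complex variable, where a summable bound on a
ball suffices, and is then restricted to the real line. -/
theorem ExpBdd.hasDerivAt_ser {c : ℕ → ℂ} (h : ExpBdd c) (s : ℝ) :
    HasDerivAt (ser c) (ser (shiftCoeff c) s) s := by
  let z : ℂ := (s : ℂ)
  obtain ⟨u, hu, hb⟩ := h.summable_bound (‖z‖ + 1)
  have hz : z ∈ Metric.ball (0 : ℂ) (‖z‖ + 1) := by simp
  have hd : ∀ m, DifferentiableOn ℂ (fun w : ℂ => c m * w ^ m) (Metric.ball 0 (‖z‖ + 1)) :=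
    fun m => by fun_prop
  have hle : ∀ m (w : ℂ), w ∈ Metric.ball (0 : ℂ) (‖z‖ + 1) → ‖c m * w ^ m‖ ≤ u m :=
    fun m w hw => hb m w (by simpa using (Metric.mem_ball.1 hw).le)
  have h1 := Complex.hasSum_deriv_of_summable_norm hu hd Metric.isOpen_ball hle hz
  have h2 : DifferentiableAt ℂ (fun w : ℂ => ∑' m, c m * w ^ m) z :=
    (Complex.differentiableOn_tsum_of_summable_norm hu hd Metric.isOpen_ball hle).differentiableAt
      (Metric.isOpen_ball.mem_nhds hz)
  have h3 : deriv (fun w : ℂ => ∑' m, c m * w ^ m) z = ser (shiftCoeff c) s := by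
    refine h1.unique ?_
    rw [← hasSum_nat_add_iff' 1]
    simp only [Finset.range_one, Finset.sum_singleton]
    convert! h.shift.hasSum s using 1
    · ext m
      simp [shiftCoeff, z]
      ring
    · simp
  have h4 := h2.hasDerivAt
  rw [h3] at h4
  exact h4.comp_ofReal

/-! ### Jets of smooth and of logarithmic functions -/

/-- `a n` is the `n`-th derivative of `a 0`. -/
def IsJet (a : ℕ → ℝ → ℂ) : Prop := ∀ n s, HasDerivAt (a n) (a (n + 1) s) s

theorem IsJet.add {a b : ℕ → ℝ → ℂ} (ha : IsJet a) (hb : IsJet b) :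
    IsJet fun n s => a n s + b n s := fun n s => (ha n s).add (hb n s)

theorem IsJet.const_mul {a : ℕ → ℝ → ℂ} (c : ℂ) (ha : IsJet a) :
    IsJet fun n s => c * a n s := fun n s => (ha n s).const_mul c

theorem IsJet.continuous {a : ℕ → ℝ → ℂ} (ha : IsJet a) (n : ℕ) : Continuous (a n) :=
  continuous_iff_continuousAt.2 fun s => (ha n s).continuousAt

theorem ExpBdd.isJet {c : ℕ → ℂ} (h : ExpBdd c) : IsJet fun n => ser (shiftCoeff^[n] c) := by
  intro n s
  simp only [Function.iterate_succ_apply']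
  exact (h.iterate_shift n).hasDerivAt_ser s

/-- The first derivatives of `log s * a s + b s`. -/
def logJet (a b : ℕ → ℝ → ℂ) : ℕ → ℝ → ℂ
  | 0, s => Real.log s * a 0 s + b 0 s
  | 1, s => a 0 s / s + Real.log s * a 1 s + b 1 s
  | 2, s => -a 0 s / s ^ 2 + 2 * a 1 s / s + Real.log s * a 2 s + b 2 s
  | 3, s => 2 * a 0 s / s ^ 3 - 3 * a 1 s / s ^ 2 + 3 * a 2 s / s + Real.log s * a 3 s + b 3 s
  | _, _ => 0

/-- `F 1, F 2, F 3` are the derivatives of `F 0` on the positive half-line. -/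
def IsPosJet (F : ℕ → ℝ → ℂ) : Prop :=
  ∀ n < 3, ∀ s, 0 < s → HasDerivAt (F n) (F (n + 1) s) s

theorem hasDerivAt_log_ofReal {s : ℝ} (hs : 0 < s) :
    HasDerivAt (fun s : ℝ => (Real.log s : ℂ)) (1 / (s : ℂ)) s := by
  have := (Real.hasDerivAt_log hs.ne').ofReal_comp
  simpa using this

theorem isPosJet_logJet {a b : ℕ → ℝ → ℂ} (ha : IsJet a) (hb : IsJet b) :
    IsPosJet (logJet a b) := by
  intro n hn s hs
  have hs' : (s : ℂ) ≠ 0 := by exact_mod_cast hs.ne'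
  have hl := hasDerivAt_log_ofReal hs
  have hid : HasDerivAt (fun s : ℝ => (s : ℂ)) 1 s := by
    simpa using (hasDerivAt_id s).ofReal_comp
  interval_cases n
  · refine ((hl.mul (ha 0 s)).add (hb 0 s)).congr_deriv ?_
    simp only [logJet]
    ring
  · refine ((((ha 0 s).div hid hs').add (hl.mul (ha 1 s))).add (hb 1 s)).congr_deriv ?_
    simp only [logJet]
    field_simp
    ring
  · refine ((((((ha 0 s).fun_neg).div (hid.fun_pow 2) (pow_ne_zero 2 hs')).add
      (((ha 1 s).const_mul 2).div hid hs')).add (hl.mul (ha 2 s))).add (hb 2 s)).congr_deriv ?_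
    simp only [logJet]
    field_simp
    ring

theorem logJet_add (a b a' b' : ℕ → ℝ → ℂ) (n : ℕ) (s : ℝ) :
    logJet (fun n s => a n s + a' n s) (fun n s => b n s + b' n s) n s =
      logJet a b n s + logJet a' b' n s := by
  rcases n with _ | _ | _ | _ | n <;> simp only [logJet] <;> ring

theorem logJet_const_mul (c : ℂ) (a b : ℕ → ℝ → ℂ) (n : ℕ) (s : ℝ) :
    logJet (fun n s => c * a n s) (fun n s => c * b n s) n s = c * logJet a b n s := by
  rcases n with _ | _ | _ | _ | n <;> simp only [logJet] <;> ring

/-- `F` is the jet of `log s * a s + b s` with smooth `a`, `b` and `a 0 = κ`. -/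
def IsLogJet (κ : ℂ) (F : ℕ → ℝ → ℂ) : Prop :=
  ∃ a b, IsJet a ∧ IsJet b ∧ a 0 0 = κ ∧ F = logJet a b

theorem IsLogJet.isPosJet {κ : ℂ} {F : ℕ → ℝ → ℂ} (h : IsLogJet κ F) : IsPosJet F := by
  obtain ⟨a, b, ha, hb, -, rfl⟩ := h
  exact isPosJet_logJet ha hb

theorem IsLogJet.add {κ κ' : ℂ} {F F' : ℕ → ℝ → ℂ} (h : IsLogJet κ F) (h' : IsLogJet κ' F') :
    IsLogJet (κ + κ') fun n s => F n s + F' n s := by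
  obtain ⟨a, b, ha, hb, rfl, rfl⟩ := h
  obtain ⟨a', b', ha', hb', rfl, rfl⟩ := h'
  refine ⟨_, _, ha.add ha', hb.add hb', rfl, ?_⟩
  funext n s
  rw [logJet_add]

theorem IsLogJet.const_mul {κ : ℂ} {F : ℕ → ℝ → ℂ} (c : ℂ) (h : IsLogJet κ F) :
    IsLogJet (c * κ) fun n s => c * F n s := by
  obtain ⟨a, b, ha, hb, rfl, rfl⟩ := h
  refine ⟨_, _, ha.const_mul c, hb.const_mul c, rfl, ?_⟩
  funext n s
  rw [logJet_const_mul]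

theorem IsLogJet.mono {κ κ' : ℂ} {F F' : ℕ → ℝ → ℂ} (h : IsLogJet κ F) (hκ : κ = κ')
    (hF : ∀ n s, F n s = F' n s) : IsLogJet κ' F' := by
  have : F = F' := by funext n s; exact hF n s
  rwa [← hκ, ← this]

/-! ### Bounds near zero -/

theorem IsJet.bound {a : ℕ → ℝ → ℂ} (ha : IsJet a) (n : ℕ) (S : ℝ) :
    ∃ C, 0 ≤ C ∧ ∀ s, 0 < s → s ≤ S → ‖a n s‖ ≤ C := by
  obtain ⟨C, hC⟩ := (isCompact_Icc (a := (0 : ℝ)) (b := S)).exists_bound_of_continuousOn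
    (ha.continuous n).continuousOn
  exact ⟨max C 0, le_max_right _ _, fun s h0 h1 => (hC s ⟨h0.le, h1⟩).trans (le_max_left _ _)⟩

theorem IsJet.bound_of_zero {a : ℕ → ℝ → ℂ} (ha : IsJet a) (h0 : a 0 0 = 0) (S : ℝ) :
    ∃ C, 0 ≤ C ∧ ∀ s, 0 < s → s ≤ S → ‖a 0 s‖ ≤ C * s := by
  obtain ⟨C, hC⟩ := (isCompact_Icc (a := (0 : ℝ)) (b := S)).exists_bound_of_continuousOn
    (ha.continuous 1).continuousOn
  refine ⟨max C 0, le_max_right _ _, fun s hs h1 => ?_⟩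
  have := (convex_Icc (0 : ℝ) S).norm_image_sub_le_of_norm_hasDerivWithin_le (f := a 0)
    (f' := a 1) (fun x _ => (ha 0 x).hasDerivWithinAt)
    (fun x hx => (hC x hx).trans (le_max_left _ 0)) (x := 0) (y := s)
    ⟨le_rfl, hs.le.trans h1⟩ ⟨hs.le, h1⟩
  simpa [h0, abs_of_pos hs] using this

/-- Any negative power would dominate the logarithm; `s^(-1/4)` turns into `|w|^(-1/2)` for `s =
|w|²`. The second inequality lets bounded terms be absorbed into the same majorant. -/
theorem abs_log_le_rpow (S : ℝ) :
    ∃ C, 0 ≤ C ∧ ∀ s, 0 < s → s ≤ S → |Real.log s| ≤ C * s ^ (-(1 / 4) : ℝ) ∧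
      1 ≤ C * s ^ (-(1 / 4) : ℝ) := by
  set S' := max S 1
  have hS' : 0 < S' := lt_of_lt_of_le one_pos (le_max_right _ _)
  -- The `4` comes from `log (1/s) ≤ 4 s^(-1/4)`, used for small `s`; the other term dominates `log
  -- s ≤ s - 1` and the constant `1` on `(0, S']`.
  refine ⟨4 + (S' + 1) * S' ^ (1 / 4 : ℝ), by positivity, fun s hs h1 => ?_⟩
  have hsS : s ≤ S' := h1.trans (le_max_left _ _)
  have hp : 0 < s ^ (-(1 / 4) : ℝ) := Real.rpow_pos_of_pos hs _
  have h2 : 1 ≤ S' ^ (1 / 4 : ℝ) * s ^ (-(1 / 4) : ℝ) := by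
    rw [Real.rpow_neg hs.le, ← div_eq_mul_inv, one_le_div (Real.rpow_pos_of_pos hs _)]
    exact Real.rpow_le_rpow hs.le hsS (by norm_num)
  have h3 : (0 : ℝ) ≤ S' ^ (1 / 4 : ℝ) := by positivity
  refine ⟨?_, by nlinarith⟩
  rw [abs_le]
  constructor
  · have := Real.log_le_rpow_div (inv_pos.2 hs).le (show (0 : ℝ) < 1 / 4 by norm_num)
    rw [Real.log_inv, Real.inv_rpow hs.le, ← Real.rpow_neg hs.le] at this
    have h4 : 0 ≤ (S' + 1) * S' ^ (1 / 4 : ℝ) * s ^ (-(1 / 4) : ℝ) := by positivity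
    have h5 : s ^ (-(1 / 4) : ℝ) / (1 / 4) = 4 * s ^ (-(1 / 4) : ℝ) := by ring
    rw [h5] at this
    linarith
  · have := Real.log_le_sub_one_of_pos hs
    nlinarith

theorem IsLogJet.bound_zero {κ : ℂ} {F : ℕ → ℝ → ℂ} (h : IsLogJet κ F) (S : ℝ) :
    ∃ C, 0 ≤ C ∧ ∀ s, 0 < s → s ≤ S → ‖F 0 s‖ ≤ C * s ^ (-(1 / 4) : ℝ) := by
  obtain ⟨a, b, ha, hb, -, rfl⟩ := h
  obtain ⟨L, hL, hlog⟩ := abs_log_le_rpow S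
  obtain ⟨Ca, hCa, hA⟩ := ha.bound 0 S
  obtain ⟨Cb, hCb, hB⟩ := hb.bound 0 S
  refine ⟨L * Ca + Cb * L, by positivity, fun s hs h1 => ?_⟩
  obtain ⟨l1, l2⟩ := hlog s hs h1
  simp only [logJet]
  calc _ ≤ |Real.log s| * ‖a 0 s‖ + ‖b 0 s‖ := by
        refine (norm_add_le _ _).trans ?_
        rw [norm_mul, Complex.norm_real, Real.norm_eq_abs]
    _ ≤ L * s ^ (-(1 / 4) : ℝ) * Ca + Cb * (L * s ^ (-(1 / 4) : ℝ)) := by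
        refine add_le_add (mul_le_mul l1 (hA s hs h1) (norm_nonneg _) (by positivity)) ?_
        exact (hB s hs h1).trans (le_mul_of_one_le_right hCb l2)
    _ = _ := by ring

theorem rpow_neg_quarter_le {s S : ℝ} (hs : 0 < s) (hS : s ≤ S) :
    s ^ (-(1 / 4) : ℝ) ≤ S ^ (3 / 4 : ℝ) / s := by
  rw [le_div_iff₀ hs]
  calc s ^ (-(1 / 4) : ℝ) * s = s ^ (-(1 / 4) + 1 : ℝ) := by rw [Real.rpow_add_one hs.ne']
    _ ≤ S ^ (3 / 4 : ℝ) := by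
      norm_num
      exact Real.rpow_le_rpow hs.le hS (by norm_num)

/-- Differentiating `log s · a + b` gives `a / s` plus the same expression for `a'`, `b'`; the
latter is only logarithmic. The next two bounds use the same splitting. -/
theorem IsLogJet.bound_one {κ : ℂ} {F : ℕ → ℝ → ℂ} (h : IsLogJet κ F) (S : ℝ) :
    ∃ C, 0 ≤ C ∧ ∀ s, 0 < s → s ≤ S → ‖F 1 s‖ ≤ C / s := by
  obtain ⟨a, b, ha, hb, -, rfl⟩ := h
  obtain ⟨C, hC, hR⟩ := IsLogJet.bound_zero (κ := a 1 0) (F := logJet (fun n => a (n + 1))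
    fun n => b (n + 1)) ⟨_, _, fun n s => ha (n + 1) s, fun n s => hb (n + 1) s, rfl, rfl⟩ S
  obtain ⟨Ca, hCa, hA⟩ := ha.bound 0 S
  refine ⟨Ca + C * |S| ^ (3 / 4 : ℝ), by positivity, fun s hs h1 => ?_⟩
  have e : logJet a b 1 s = a 0 s / s + logJet (fun n => a (n + 1)) (fun n => b (n + 1)) 0 s := by
    simp only [logJet]; ring
  rw [e, add_div]
  refine (norm_add_le _ _).trans (add_le_add ?_ ?_)
  · rw [norm_div, Complex.norm_real, Real.norm_of_nonneg hs.le]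
    gcongr
    exact hA s hs h1
  · refine (hR s hs h1).trans ?_
    rw [mul_div_assoc]
    exact mul_le_mul_of_nonneg_left (rpow_neg_quarter_le hs (h1.trans (le_abs_self S))) hC

/-- When `a(0) = 0` the quotient `a(s) / s` stays bounded, so one order of singularity is gained. -/
theorem IsLogJet.bound_one_of_zero {F : ℕ → ℝ → ℂ} (h : IsLogJet 0 F) (S : ℝ) :
    ∃ C, 0 ≤ C ∧ ∀ s, 0 < s → s ≤ S → ‖F 1 s‖ ≤ C * s ^ (-(1 / 4) : ℝ) := by
  obtain ⟨a, b, ha, hb, h0, rfl⟩ := h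
  obtain ⟨C, hC, hR⟩ := IsLogJet.bound_zero (κ := a 1 0) (F := logJet (fun n => a (n + 1))
    fun n => b (n + 1)) ⟨_, _, fun n s => ha (n + 1) s, fun n s => hb (n + 1) s, rfl, rfl⟩ S
  obtain ⟨Ca, hCa, hA⟩ := ha.bound_of_zero h0 S
  obtain ⟨L, hL, hlog⟩ := abs_log_le_rpow S
  refine ⟨Ca * L + C, by positivity, fun s hs h1 => ?_⟩
  have e : logJet a b 1 s = a 0 s / s + logJet (fun n => a (n + 1)) (fun n => b (n + 1)) 0 s := by
    simp only [logJet]; ring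
  rw [e, add_mul]
  refine (norm_add_le _ _).trans (add_le_add ?_ (hR s hs h1))
  rw [norm_div, Complex.norm_real, Real.norm_of_nonneg hs.le]
  calc ‖a 0 s‖ / s ≤ Ca := by rw [div_le_iff₀ hs]; exact hA s hs h1
    _ ≤ Ca * L * s ^ (-(1 / 4) : ℝ) := by
      rw [mul_assoc]; exact le_mul_of_one_le_right hCa (hlog s hs h1).2

theorem IsLogJet.bound_two_of_zero {F : ℕ → ℝ → ℂ} (h : IsLogJet 0 F) (S : ℝ) :
    ∃ C, 0 ≤ C ∧ ∀ s, 0 < s → s ≤ S → ‖F 2 s‖ ≤ C / s := by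
  obtain ⟨a, b, ha, hb, h0, rfl⟩ := h
  obtain ⟨C, hC, hR⟩ := IsLogJet.bound_one (κ := a 1 0) (F := logJet (fun n => a (n + 1))
    fun n => b (n + 1)) ⟨_, _, fun n s => ha (n + 1) s, fun n s => hb (n + 1) s, rfl, rfl⟩ S
  obtain ⟨Ca, hCa, hA⟩ := ha.bound_of_zero h0 S
  obtain ⟨Cb, hCb, hB⟩ := ha.bound 1 S
  refine ⟨Ca + Cb + C, by positivity, fun s hs h1 => ?_⟩
  have e : logJet a b 2 s = -(a 0 s / s) / s + a 1 s / s +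
      logJet (fun n => a (n + 1)) (fun n => b (n + 1)) 1 s := by
    have hs' : (s : ℂ) ≠ 0 := by exact_mod_cast hs.ne'
    simp only [logJet]; field_simp; ring
  rw [e, add_div, add_div]
  refine (norm_add_le _ _).trans (add_le_add ((norm_add_le _ _).trans (add_le_add ?_ ?_))
    (hR s hs h1))
  · rw [norm_div, norm_neg, norm_div, Complex.norm_real, Real.norm_of_nonneg hs.le]
    gcongr
    rw [div_le_iff₀ hs]; exact hA s hs h1
  · rw [norm_div, Complex.norm_real, Real.norm_of_nonneg hs.le]
    gcongr
    exact hB s hs h1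

/-! ### The Helmholtz fundamental solution as a function of the squared distance -/

/-- Coefficients of `J₀` in terms of the squared distance. -/
def coeffJ (k : ℂ) (m : ℕ) : ℂ := (-(k ^ 2) / 4) ^ m / (m.factorial : ℂ) ^ 2

/-- Coefficients of the regular part of `Y₀` in terms of the squared distance. -/
def coeffH (k : ℂ) (m : ℕ) : ℂ := ((harmonic m : ℚ) : ℂ) * coeffJ k m

theorem norm_coeffJ_le (k : ℂ) (m : ℕ) :
    ‖coeffJ k m‖ ≤ ‖-(k ^ 2) / 4‖ ^ m / m.factorial * (1 / m.factorial) := by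
  rw [coeffJ, norm_div, norm_pow, norm_pow, Complex.norm_natCast]
  apply le_of_eq
  field_simp

theorem expBdd_coeffJ (k : ℂ) : ExpBdd (coeffJ k) := by
  refine ⟨1, ‖-(k ^ 2) / 4‖, by norm_num, norm_nonneg _, fun m => ?_⟩
  rw [one_mul]
  refine (norm_coeffJ_le k m).trans (mul_le_of_le_one_right (by positivity) ?_)
  rw [div_le_one (by positivity)]
  exact_mod_cast m.factorial_pos

theorem harmonic_nonneg_le (m : ℕ) : 0 ≤ harmonic m ∧ harmonic m ≤ m := by
  induction m with
  | zero => simp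
  | succ n ih =>
    rw [harmonic_succ]
    have h1 : (0 : ℚ) ≤ ((n + 1 : ℕ) : ℚ)⁻¹ := by positivity
    have h2 : ((n + 1 : ℕ) : ℚ)⁻¹ ≤ 1 := inv_le_one_of_one_le₀ (by push_cast; linarith [n.cast_nonneg (α := ℚ)])
    push_cast at *
    constructor <;> linarith [ih.1, ih.2]

/-- The second factorial in the denominator pays for the harmonic numbers, since `h_m ≤ m ≤ m!`. -/
theorem expBdd_coeffH (k : ℂ) : ExpBdd (coeffH k) := by
  refine ⟨1, ‖-(k ^ 2) / 4‖, by norm_num, norm_nonneg _, fun m => ?_⟩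
  obtain ⟨h0, h1⟩ := harmonic_nonneg_le m
  have h2 : ‖((harmonic m : ℚ) : ℂ)‖ ≤ m := by
    have : ((harmonic m : ℚ) : ℂ) = (((harmonic m : ℚ) : ℝ) : ℂ) := by push_cast; rfl
    rw [this, Complex.norm_real, Real.norm_of_nonneg (by exact_mod_cast h0)]
    exact_mod_cast h1
  rw [coeffH, norm_mul, one_mul]
  calc _ ≤ (m : ℝ) * (‖-(k ^ 2) / 4‖ ^ m / m.factorial * (1 / m.factorial)) := by
        gcongr
        exact norm_coeffJ_le k m
    _ = ‖-(k ^ 2) / 4‖ ^ m / m.factorial * (m / m.factorial) := by ring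
    _ ≤ _ := by
        refine mul_le_of_le_one_right (by positivity) ?_
        rw [div_le_one (by positivity)]
        exact_mod_cast m.self_le_factorial

theorem coeffJ_succ (k : ℂ) (m : ℕ) :
    4 * ((m : ℂ) + 1) ^ 2 * coeffJ k (m + 1) = -k ^ 2 * coeffJ k m := by
  have h1 : (m.factorial : ℂ) ≠ 0 := by exact_mod_cast m.factorial_ne_zero
  have h2 : (m : ℂ) + 1 ≠ 0 := by exact_mod_cast m.succ_ne_zero
  rw [coeffJ, coeffJ, Nat.factorial_succ, pow_succ]
  push_cast
  field_simp
  ring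

/-- The recursion of `J₀` acquires an inhomogeneous term because `h_{m+1} - h_m = 1/(m+1)`. That
term cancels the contribution of the differentiated logarithm in `helmJet_laplace`. -/
theorem coeffH_succ (k : ℂ) (m : ℕ) :
    4 * ((m : ℂ) + 1) ^ 2 * coeffH k (m + 1) + k ^ 2 * coeffH k m =
      4 * ((m : ℂ) + 1) * coeffJ k (m + 1) := by
  have h2 : (m : ℂ) + 1 ≠ 0 := by exact_mod_cast m.succ_ne_zero
  have h3 := coeffJ_succ k m
  have h4 : ((m : ℂ) + 1) * ((m : ℂ) + 1)⁻¹ = 1 := mul_inv_cancel₀ h2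
  rw [coeffH, coeffH, harmonic_succ]
  push_cast
  linear_combination (((harmonic m : ℚ) : ℂ)) * h3 + 4 * ((m : ℂ) + 1) * coeffJ k (m + 1) * h4

/-- In the squared distance the plane Laplacian of a radial function is `4 (s f'' + f')`; on
coefficients this rests on `m (m + 1) + (m + 1) = (m + 1)²`. -/
theorem ExpBdd.hasSum_laplace {c : ℕ → ℂ} (h : ExpBdd c) (s : ℝ) :
    HasSum (fun m : ℕ => ((m : ℂ) + 1) ^ 2 * c (m + 1) * (s : ℂ) ^ m)
      (s * ser (shiftCoeff^[2] c) s + ser (shiftCoeff^[1] c) s) := by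
  have h1 : HasSum (fun m : ℕ => (m : ℂ) * (m + 1) * c (m + 1) * (s : ℂ) ^ m)
      (s * ser (shiftCoeff^[2] c) s) := by
    rw [← hasSum_nat_add_iff' 1]
    simp only [Finset.range_one, Finset.sum_singleton]
    convert! ((h.iterate_shift 2).hasSum s).mul_left (s : ℂ) using 1
    · ext m
      simp only [Function.iterate_succ, Function.iterate_zero, Function.comp_apply, id, shiftCoeff]
      push_cast
      ring
    · simp
  convert h1.add ((h.iterate_shift 1).hasSum s) using 1
  ext m
  simp [shiftCoeff]
  ring

/-- The jet multiplying the logarithm in `γ_k`. -/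
def logPart (k : ℂ) (n : ℕ) (s : ℝ) : ℂ :=
  -(1 / (4 * (Real.pi : ℂ))) * ser (shiftCoeff^[n] (coeffJ k)) s

/-- The jet of the smooth remainder of `γ_k`. -/
def smoothPart (k : ℂ) (n : ℕ) (s : ℝ) : ℂ :=
  (Complex.I / 4 - 1 / (2 * (Real.pi : ℂ)) *
    (Complex.log (k / 2) + (Real.eulerMascheroniConstant : ℂ))) *
      ser (shiftCoeff^[n] (coeffJ k)) s +
    1 / (2 * (Real.pi : ℂ)) * ser (shiftCoeff^[n] (coeffH k)) s

/-- The jet of `γ_k` as a function of the squared distance. -/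
def helmJet (k : ℂ) : ℕ → ℝ → ℂ := logJet (logPart k) (smoothPart k)

theorem isJet_logPart (k : ℂ) : IsJet (logPart k) := (expBdd_coeffJ k).isJet.const_mul _

theorem isJet_smoothPart (k : ℂ) : IsJet (smoothPart k) :=
  ((expBdd_coeffJ k).isJet.const_mul _).add ((expBdd_coeffH k).isJet.const_mul _)

theorem ser_zero (c : ℕ → ℂ) : ser c 0 = c 0 := by
  rw [ser, tsum_eq_single 0 fun m hm => by simp [hm]]
  simp

theorem isLogJet_helmJet (k : ℂ) : IsLogJet (-(1 / (4 * (Real.pi : ℂ)))) (helmJet k) :=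
  ⟨_, _, isJet_logPart k, isJet_smoothPart k, by simp [logPart, ser_zero, coeffJ], rfl⟩

theorem laplace_coeffJ (k : ℂ) (s : ℝ) :
    4 * (s * ser (shiftCoeff^[2] (coeffJ k)) s + ser (shiftCoeff^[1] (coeffJ k)) s)
      + k ^ 2 * ser (coeffJ k) s = 0 := by
  have h := (((expBdd_coeffJ k).hasSum_laplace s).mul_left 4).add
    (((expBdd_coeffJ k).hasSum s).mul_left (k ^ 2))
  refine h.unique ?_
  convert hasSum_zero using 1
  ext m
  linear_combination (s : ℂ) ^ m * coeffJ_succ k m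

theorem laplace_coeffH (k : ℂ) (s : ℝ) :
    4 * (s * ser (shiftCoeff^[2] (coeffH k)) s + ser (shiftCoeff^[1] (coeffH k)) s)
      + k ^ 2 * ser (coeffH k) s = 4 * ser (shiftCoeff^[1] (coeffJ k)) s := by
  have h := (((expBdd_coeffH k).hasSum_laplace s).mul_left 4).add
    (((expBdd_coeffH k).hasSum s).mul_left (k ^ 2))
  refine h.unique ?_
  convert ((((expBdd_coeffJ k).iterate_shift 1).hasSum s).mul_left 4) using 1
  ext m
  simp only [Function.iterate_one, shiftCoeff]
  linear_combination (s : ℂ) ^ m * coeffH_succ k m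

/-- The Helmholtz equation for `γ_k`. -/
theorem helmJet_laplace (k : ℂ) {s : ℝ} (hs : 0 < s) :
    4 * (s * helmJet k 2 s + helmJet k 1 s) + k ^ 2 * helmJet k 0 s = 0 := by
  have hs' : (s : ℂ) ≠ 0 := by exact_mod_cast hs.ne'
  have hπ : (Real.pi : ℂ) ≠ 0 := by exact_mod_cast Real.pi_ne_zero
  have hJ := laplace_coeffJ k s
  have hH := laplace_coeffH k s
  simp only [helmJet, logJet, logPart, smoothPart, Function.iterate_zero, id]
  set j0 := ser (coeffJ k) s
  set j1 := ser (shiftCoeff^[1] (coeffJ k)) s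
  set j2 := ser (shiftCoeff^[2] (coeffJ k)) s
  set m0 := ser (coeffH k) s
  set m1 := ser (shiftCoeff^[1] (coeffH k)) s
  set m2 := ser (shiftCoeff^[2] (coeffH k)) s
  set X := Complex.I / 4 - 1 / (2 * (Real.pi : ℂ)) *
    (Complex.log (k / 2) + (Real.eulerMascheroniConstant : ℂ))
  -- In `s F'' + F'` the two terms `a / s` cancel, and the logarithm leaves only `2 a'`, which the
  -- right-hand side of `hH` compensates.
  have e1 : (s : ℂ) * (-(-(1 / (4 * (Real.pi : ℂ))) * j0) / (s : ℂ) ^ 2) =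
      1 / (4 * (Real.pi : ℂ)) * (j0 / s) := by field_simp
  have e2 : (s : ℂ) * (2 * (-(1 / (4 * (Real.pi : ℂ))) * j1) / s) =
      2 * (-(1 / (4 * (Real.pi : ℂ))) * j1) := by field_simp
  linear_combination (-(1 / (4 * (Real.pi : ℂ))) * Real.log s + X) * hJ
    + 1 / (2 * (Real.pi : ℂ)) * hH + 4 * e1 + 4 * e2

/-- The differentiated Helmholtz equation. -/
theorem helmJet_laplace' (k : ℂ) {s : ℝ} (hs : 0 < s) :
    4 * (s * helmJet k 3 s + 2 * helmJet k 2 s) + k ^ 2 * helmJet k 1 s = 0 := by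
  have hF := (isLogJet_helmJet k).isPosJet
  have hid : HasDerivAt (fun s : ℝ => (s : ℂ)) 1 s := by
    simpa using (hasDerivAt_id s).ofReal_comp
  have h1 := (((hid.mul (hF 2 (by norm_num) s hs)).add (hF 1 (by norm_num) s hs)).const_mul
    (4 : ℂ)).add ((hF 0 (by norm_num) s hs).const_mul (k ^ 2))
  have h2 : (fun s : ℝ => 4 * ((s : ℂ) * helmJet k 2 s + helmJet k 1 s)
      + k ^ 2 * helmJet k 0 s) =ᶠ[𝓝 s] fun _ => 0 := by
    filter_upwards [lt_mem_nhds hs] with t ht using helmJet_laplace k ht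
  have h3 := (h1.congr_of_eventuallyEq h2.symm).unique (hasDerivAt_const s (0 : ℂ))
  linear_combination h3

/-- The squared Euclidean norm. -/
def nsq (w : Plane) : ℝ := w 0 ^ 2 + w 1 ^ 2

theorem nsq_eq_norm_sq (w : Plane) : nsq w = ‖w‖ ^ 2 := by
  simp [nsq, EuclideanSpace.norm_sq_eq, Fin.sum_univ_two]

theorem nsq_pos {w : Plane} (hw : w ≠ 0) : 0 < nsq w := by
  rw [nsq_eq_norm_sq]; exact pow_pos (norm_pos_iff.2 hw) 2

theorem helm_eq_helmJet {k : ℂ} (hk : k ≠ 0) {x y : Plane} (h : x ≠ y) :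
    helm k x y = helmJet k 0 (nsq (x - y)) := by
  have hr : 0 < dist x y := dist_pos.2 h
  have hn : nsq (x - y) = dist x y ^ 2 := by rw [nsq_eq_norm_sq, dist_eq_norm]
  have hπ : (Real.pi : ℂ) ≠ 0 := by exact_mod_cast Real.pi_ne_zero
  rw [hn]
  set r := dist x y
  -- No branch correction occurs, because the factor `r` is a positive real; `k ≠ 0` is needed for
  -- the splitting.
  have hlog : Complex.log (k * r / 2) = Real.log r + Complex.log (k / 2) := by
    rw [mul_div_right_comm, Complex.log_mul_ofReal r hr _ (by simpa using hk)]
  have hlog2 : Real.log (r ^ 2) = 2 * Real.log r := by rw [Real.log_pow]; norm_num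
  have hJ : besselJ0 (k * r) = ser (coeffJ k) (r ^ 2) := by
    rw [besselJ0, ser]
    congr 1; ext m
    rw [coeffJ, ← mul_pow]
    push_cast
    rw [div_mul_eq_mul_div, ← mul_pow]
    congr 2
    ring
  have hH : ∑' m : ℕ, (-1) ^ m * ((harmonic m : ℚ) : ℂ) * ((k * r) ^ 2 / 4) ^ m /
      ((m.factorial : ℂ) ^ 2) = ser (coeffH k) (r ^ 2) := by
    rw [ser]
    congr 1; ext m
    rw [coeffH, coeffJ]
    push_cast
    have : (-1 : ℂ) ^ m * ((k * r) ^ 2 / 4) ^ m = (-(k ^ 2) / 4) ^ m * (r ^ 2 : ℂ) ^ m := by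
      rw [← mul_pow, ← mul_pow]; congr 1; ring
    linear_combination ((harmonic m : ℚ) : ℂ) / (m.factorial : ℂ) ^ 2 * this
  rw [helm, hankel0, besselY0, hJ, hH, hlog]
  simp only [helmJet, logJet, logPart, smoothPart, Function.iterate_zero, id, hlog2]
  push_cast
  linear_combination (1 / (2 * (Real.pi : ℂ)) * ((Real.log r + Complex.log (k / 2)
    + (Real.eulerMascheroniConstant : ℂ)) * ser (coeffJ k) (r ^ 2) - ser (coeffH k) (r ^ 2)))
    * Complex.I_sq

end

end Poro

namespace Poro

noncomputable section

open Filter Topology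

/-! ### Gradients of radial functions on the plane -/

/-- The real-linear functional with gradient `g`. -/
def gradL (g : Fin 2 → ℂ) : Plane →L[ℝ] ℂ :=
  ∑ i, (EuclideanSpace.proj i : Plane →L[ℝ] ℝ).smulRight (g i)

theorem gradL_apply (g : Fin 2 → ℂ) (v : Plane) : gradL g v = ∑ i, (v i : ℂ) * g i := by
  simp [gradL]

/-- `f` is differentiable at `w` with gradient `g`. -/
def HasGrad (f : Plane → ℂ) (g : Fin 2 → ℂ) (w : Plane) : Prop := HasFDerivAt f (gradL g) w

theorem HasGrad.of_hasFDerivAt {f : Plane → ℂ} {L : Plane →L[ℝ] ℂ} {g : Fin 2 → ℂ} {w : Plane}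
    (h : HasFDerivAt f L w) (hg : ∀ v : Plane, L v = ∑ i, (v i : ℂ) * g i) : HasGrad f g w :=
  h.congr_fderiv (by ext v; rw [hg, gradL_apply])

theorem HasGrad.congr {f f' : Plane → ℂ} {g g' : Fin 2 → ℂ} {w : Plane} (h : HasGrad f g w)
    (hf : ∀ z, f z = f' z) (hg : ∀ i, g i = g' i) : HasGrad f' g' w := by
  rw [← show f = f' from funext hf, ← show g = g' from funext hg]
  exact h

theorem HasGrad.add {f f' : Plane → ℂ} {g g' : Fin 2 → ℂ} {w : Plane} (h : HasGrad f g w)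
    (h' : HasGrad f' g' w) : HasGrad (fun z => f z + f' z) (fun i => g i + g' i) w :=
  .of_hasFDerivAt (HasFDerivAt.add h h') fun v => by
    simp only [add_apply, gradL_apply, Fin.sum_univ_two]; ring

theorem HasGrad.const_mul {f : Plane → ℂ} {g : Fin 2 → ℂ} {w : Plane} (c : ℂ)
    (h : HasGrad f g w) : HasGrad (fun z => c * f z) (fun i => c * g i) w :=
  .of_hasFDerivAt (HasFDerivAt.const_mul h c) fun v => by
    simp only [smul_apply, gradL_apply, Fin.sum_univ_two, smul_eq_mul]; ring

theorem HasGrad.mul {f f' : Plane → ℂ} {g g' : Fin 2 → ℂ} {w : Plane} (h : HasGrad f g w)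
    (h' : HasGrad f' g' w) :
    HasGrad (fun z => f z * f' z) (fun i => f w * g' i + g i * f' w) w :=
  .of_hasFDerivAt (HasFDerivAt.mul h h') fun v => by
    simp only [add_apply, smul_apply, gradL_apply,
      Fin.sum_univ_two, smul_eq_mul]
    ring

theorem hasFDerivAt_coord (j : Fin 2) (w : Plane) :
    HasFDerivAt (fun z : Plane => z j) (EuclideanSpace.proj j : Plane →L[ℝ] ℝ) w :=
  (EuclideanSpace.proj j : Plane →L[ℝ] ℝ).hasFDerivAt

/-- The Kronecker symbol. -/
abbrev kron (i j : Fin 2) : ℂ := if i = j then 1 else 0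

theorem hasGrad_coord (j : Fin 2) (w : Plane) :
    HasGrad (fun z => (z j : ℂ)) (fun i => kron j i) w :=
  .of_hasFDerivAt (Complex.ofRealCLM.hasFDerivAt.comp w (hasFDerivAt_coord j w)) fun v => by
    fin_cases j <;> simp

theorem hasGrad_radial {H : ℝ → ℂ} {H' : ℂ} {w : Plane} (h : HasDerivAt H H' (nsq w)) :
    HasGrad (fun z => H (nsq z)) (fun i => 2 * w i * H') w := by
  have h1 := ((hasFDerivAt_coord 0 w).pow 2).add ((hasFDerivAt_coord 1 w).pow 2)
  refine .of_hasFDerivAt (h.hasFDerivAt.comp w h1) fun v => ?_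
  simp
  ring

theorem HasGrad.pd {f : Plane → ℂ} {g : Fin 2 → ℂ} {w : Plane} (h : HasGrad f g w) (i : Fin 2) :
    pd i f w = g i := by
  rw [Poro.pd, HasFDerivAt.fderiv h, gradL_apply]
  fin_cases i <;> simp

theorem HasGrad.pd_sub_right {f : Plane → ℂ} {g : Fin 2 → ℂ} {x y : Plane}
    (h : HasGrad f g (x - y)) (i : Fin 2) : Poro.pd i (fun z => f (z - y)) x = g i := by
  rw [Poro.pd, fderiv_comp_sub]
  exact h.pd i

theorem HasGrad.pd_sub_left {f : Plane → ℂ} {g : Fin 2 → ℂ} {x y : Plane}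
    (h : HasGrad f g (x - y)) (i : Fin 2) : Poro.pd i (fun z => f (x - z)) y = -g i := by
  have h1 : HasFDerivAt (fun z : Plane => x - z) (-ContinuousLinearMap.id ℝ Plane) y :=
    (hasFDerivAt_id y).const_sub x
  have h2 := HasFDerivAt.comp y h h1
  rw [Poro.pd]
  change fderiv ℝ (f ∘ fun z => x - z) y _ = _
  rw [h2.fderiv]
  simp only [ContinuousLinearMap.comp_apply, neg_apply,
    ContinuousLinearMap.id_apply, gradL_apply]
  fin_cases i <;> simp

theorem pd_congr {f g : Plane → ℂ} {x : Plane} (h : f =ᶠ[𝓝 x] g) (i : Fin 2) :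
    pd i f x = pd i g x := by
  rw [pd, pd, h.fderiv_eq]

/-- A radial function of `w`. -/
def R0 (F : ℕ → ℝ → ℂ) (w : Plane) : ℂ := F 0 (nsq w)

/-- The first partial derivatives of `R0 F`. -/
def R1 (F : ℕ → ℝ → ℂ) (i : Fin 2) (w : Plane) : ℂ := 2 * w i * F 1 (nsq w)

/-- The second partial derivatives of `R0 F`. -/
def R2 (F : ℕ → ℝ → ℂ) (i j : Fin 2) (w : Plane) : ℂ :=
  2 * kron i j * F 1 (nsq w) + 4 * (w i * w j) * F 2 (nsq w)

/-- The third partial derivatives of `R0 F`. -/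
def R3 (F : ℕ → ℝ → ℂ) (i j l : Fin 2) (w : Plane) : ℂ :=
  4 * (kron i j * w l + kron i l * w j + kron j l * w i) * F 2 (nsq w)
    + 8 * (w i * w j * w l) * F 3 (nsq w)

theorem hasGrad_R0 {F : ℕ → ℝ → ℂ} (hF : IsPosJet F) {w : Plane} (hw : w ≠ 0) :
    HasGrad (R0 F) (fun i => R1 F i w) w :=
  hasGrad_radial (hF 0 (by norm_num) _ (nsq_pos hw))

theorem hasGrad_R1 {F : ℕ → ℝ → ℂ} (hF : IsPosJet F) {w : Plane} (hw : w ≠ 0) (i : Fin 2) :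
    HasGrad (R1 F i) (fun j => R2 F i j w) w := by
  refine (((hasGrad_coord i w).const_mul 2).mul
    (hasGrad_radial (hF 1 (by norm_num) _ (nsq_pos hw)))).congr (fun z => by rw [R1]) fun j => ?_
  rw [R2]; ring

theorem hasGrad_R2 {F : ℕ → ℝ → ℂ} (hF : IsPosJet F) {w : Plane} (hw : w ≠ 0) (i j : Fin 2) :
    HasGrad (R2 F i j) (fun l => R3 F i j l w) w := by
  refine (((hasGrad_radial (hF 1 (by norm_num) _ (nsq_pos hw))).const_mul (2 * kron i j)).add
    ((((hasGrad_coord i w).mul (hasGrad_coord j w)).const_mul 4).mul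
    (hasGrad_radial (hF 2 (by norm_num) _ (nsq_pos hw))))).congr (fun z => by rw [R2])
    fun l => ?_
  rw [R3]; ring

/-- This is the gradient of `Δ γ_k = -k² γ_k`, and the only place where the Helmholtz equation
enters the kernel identity. -/
theorem R3_helmJet_trace (k : ℂ) {w : Plane} (hw : w ≠ 0) (i : Fin 2) :
    R3 (helmJet k) 0 0 i w + R3 (helmJet k) 1 1 i w = -k ^ 2 * R1 (helmJet k) i w := by
  have h := helmJet_laplace' k (nsq_pos hw)
  have e : ((nsq w : ℝ) : ℂ) = (w 0 : ℂ) ^ 2 + (w 1 : ℂ) ^ 2 := by rw [nsq]; push_cast; rfl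
  fin_cases i <;> simp [R3, R1]
  · linear_combination 2 * (w 0 : ℂ) * h - 8 * w 0 * helmJet k 3 (nsq w) * e
  · linear_combination 2 * (w 1 : ℂ) * h - 8 * w 1 * helmJet k 3 (nsq w) * e

theorem R2_symm (F : ℕ → ℝ → ℂ) (i j : Fin 2) (w : Plane) : R2 F i j w = R2 F j i w := by
  rw [R2, R2, kron, kron]
  simp only [eq_comm (a := i) (b := j)]
  ring

/-- The four symmetries bring every mixed third derivative to the form `R3 F 0 0 l` or `R3 F 1 1 l`;
the trace formula then eliminates `R3 F 1 1 l`, leaving two independent third derivatives for each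
wave number. -/
theorem R3_symm₁ (F : ℕ → ℝ → ℂ) (w : Plane) : R3 F 0 1 0 w = R3 F 0 0 1 w := by
  simp [R3, -mul_eq_mul_right_iff]; ring

theorem R3_symm₂ (F : ℕ → ℝ → ℂ) (w : Plane) : R3 F 1 0 0 w = R3 F 0 0 1 w := by
  simp [R3, -mul_eq_mul_right_iff]; ring

theorem R3_symm₃ (F : ℕ → ℝ → ℂ) (w : Plane) : R3 F 0 1 1 w = R3 F 1 1 0 w := by
  simp [R3, -mul_eq_mul_right_iff]; ring

theorem R3_symm₄ (F : ℕ → ℝ → ℂ) (w : Plane) : R3 F 1 0 1 w = R3 F 1 1 0 w := by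
  simp [R3, -mul_eq_mul_right_iff]; ring

/-! ### Parameters of the medium -/

/-- The tangent vector `(-n₂, n₁)`. -/
def tang (n : Fin 2 → ℝ) : Fin 2 → ℝ := ![-n 1, n 0]

namespace Medium

variable (M : Medium)

theorem lam_add_two_mu_pos : 0 < M.lam + 2 * M.mu := by
  linarith [M.mu_pos, M.lam_add_mu_pos]

theorem beta_den_ne :
    (Complex.I * M.phi ^ 2 + M.omega * M.kappa * (M.rhoa + M.phi * M.rhof) : ℂ) ≠ 0 := by
  intro h
  have := congrArg Complex.im h
  simp [← Complex.ofReal_pow] at this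
  exact M.phi_pos.ne' this

theorem beta_num_ne : (M.omega * M.phi ^ 2 * M.rhof * M.kappa : ℂ) ≠ 0 := by
  have := mul_pos (mul_pos (mul_pos M.omega_pos (pow_pos M.phi_pos 2)) M.rhof_pos) M.kappa_pos
  exact_mod_cast this.ne'

theorem beta_ne : M.beta ≠ 0 := div_ne_zero M.beta_num_ne M.beta_den_ne

/-- `β` is a nonzero real divided by a number with imaginary part `φ² ≠ 0`. -/
theorem beta_im_ne : M.beta.im ≠ 0 := by
  intro h
  have h1 : (M.beta.re : ℂ) = M.beta := Complex.ext (by simp) (by simp [h])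
  have h2 : M.beta * (Complex.I * M.phi ^ 2 + M.omega * M.kappa * (M.rhoa + M.phi * M.rhof)) =
      M.omega * M.phi ^ 2 * M.rhof * M.kappa := div_mul_cancel₀ _ M.beta_den_ne
  rw [← h1] at h2
  have h3 := congrArg Complex.im h2
  simp [← Complex.ofReal_pow] at h3
  rcases h3 with h3 | h3
  · exact M.beta_ne (by rw [← h1, h3]; simp)
  · exact M.phi_pos.ne' h3

/-- The effective density is not even real, as `β` is not and `ρ_f ≠ 0`. Hence `k_s` and `k_p` do
not vanish, and no sign condition on `ρ` is needed. -/
theorem density_ne : (M.rho - M.beta * M.rhof : ℂ) ≠ 0 := by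
  intro h
  have := congrArg Complex.im h
  simp at this
  rcases this with h | h
  · exact M.beta_im_ne h
  · exact M.rhof_pos.ne' h

theorem csqrt_sq (z : ℂ) : csqrt z ^ 2 = z := by
  rw [csqrt, one_div]
  exact_mod_cast Complex.cpow_nat_inv_pow z two_ne_zero

theorem ks_sq : M.ks ^ 2 * M.mu = (M.rho - M.beta * M.rhof) * M.omega ^ 2 := by
  have : (M.mu : ℂ) ≠ 0 := by exact_mod_cast M.mu_pos.ne'
  rw [ks, mul_pow, csqrt_sq]
  field_simp

theorem lam_ne : (M.lam + 2 * M.mu : ℂ) ≠ 0 := by exact_mod_cast M.lam_add_two_mu_pos.ne'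

theorem kp_sq : M.kp ^ 2 * (M.lam + 2 * M.mu) = (M.rho - M.beta * M.rhof) * M.omega ^ 2 := by
  have := M.lam_ne
  rw [kp, mul_pow, csqrt_sq]
  field_simp

theorem stiffness_ne : ((M.rho - M.beta * M.rhof) * M.omega ^ 2 : ℂ) ≠ 0 :=
  mul_ne_zero M.density_ne (pow_ne_zero 2 (by exact_mod_cast M.omega_pos.ne'))

theorem ks_ne : M.ks ≠ 0 := by
  intro h
  have := M.ks_sq
  rw [h] at this
  exact M.stiffness_ne (by rw [← this]; simp)

theorem kp_ne : M.kp ≠ 0 := by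
  intro h
  have := M.kp_sq
  rw [h] at this
  exact M.stiffness_ne (by rw [← this]; simp)

theorem R_ne : M.R ≠ 0 := by
  rw [R]
  have := M.mu_pos.ne'
  have := M.phi_pos.ne'
  have := M.B_ne
  have := M.nup_ne
  have := M.nuu_ne
  have := M.nuu_ne'
  have := M.nu_ne
  positivity

theorem q_ne : M.q ≠ 0 := by
  have h1 : (M.omega : ℂ) ≠ 0 := by exact_mod_cast M.omega_pos.ne'
  have h2 : (M.phi : ℂ) ≠ 0 := by exact_mod_cast M.phi_pos.ne'
  have h3 : (M.rhof : ℂ) ≠ 0 := by exact_mod_cast M.rhof_pos.ne'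
  have h4 : (M.R : ℂ) ≠ 0 := by exact_mod_cast M.R_ne
  have h5 := M.beta_ne
  rw [q]
  positivity

/-- The product `k₁² k₂² = q k_p²` is nonzero; this makes `helm_eq_helmJet` available for both wave
numbers. -/
theorem IsWaveNumberPair.ne_zero {M : Medium} {k₁ k₂ : ℂ} (h : M.IsWaveNumberPair k₁ k₂) :
    k₁ ≠ 0 ∧ k₂ ≠ 0 := by
  obtain ⟨-, -, -, h⟩ := h
  have h1 : k₁ ^ 2 * k₂ ^ 2 ≠ 0 := by
    rw [h]; exact mul_ne_zero M.q_ne (pow_ne_zero 2 M.kp_ne)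
  constructor <;> rintro rfl <;> simp at h1

/-! ### The kernels in terms of radial functions -/

variable (k₁ k₂ : ℂ)

/-- The jet of `γ_{k₁} - γ_{k₂}`. -/
def dJet (n : ℕ) (s : ℝ) : ℂ := helmJet k₁ n s - helmJet k₂ n s

/-- The jet of the potential in `E₁₁`. -/
def pJet (n : ℕ) (s : ℝ) : ℂ :=
  helmJet M.ks n s - (M.kp ^ 2 - k₂ ^ 2) / (k₁ ^ 2 - k₂ ^ 2) * helmJet k₁ n s
    + (M.kp ^ 2 - k₁ ^ 2) / (k₁ ^ 2 - k₂ ^ 2) * helmJet k₂ n s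

/-- The jet of the potential in `E₂₂`. -/
def gJet (n : ℕ) (s : ℝ) : ℂ :=
  (M.kp ^ 2 - k₁ ^ 2) * helmJet k₁ n s - (M.kp ^ 2 - k₂ ^ 2) * helmJet k₂ n s

/-- The jet of the potential in the first term of `N₃¹`. -/
def qJet (n : ℕ) (s : ℝ) : ℂ :=
  helmJet M.ks n s - helmJet k₁ n s
    - (k₂ ^ 2 - M.q) / (k₁ ^ 2 - k₂ ^ 2) * (helmJet k₁ n s - helmJet k₂ n s)

/-- The jet of `k₁² γ_{k₁} - k₂² γ_{k₂}`. -/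
def kJet (n : ℕ) (s : ℝ) : ℂ := k₁ ^ 2 * helmJet k₁ n s - k₂ ^ 2 * helmJet k₂ n s

/-- All `γ_k` share the same leading logarithm, so weights with sum zero cancel it. The same holds
for `pJet` and `qJet`, whereas `gJet` and `kJet` keep a logarithm in general. -/
theorem isLogJet_dJet : IsLogJet 0 (dJet k₁ k₂) :=
  ((isLogJet_helmJet k₁).add ((isLogJet_helmJet k₂).const_mul (-1))).mono (by ring)
    fun n s => by rw [dJet]; ring

theorem isLogJet_pJet (hk : k₁ ^ 2 ≠ k₂ ^ 2) : IsLogJet 0 (M.pJet k₁ k₂) := by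
  have h : k₁ ^ 2 - k₂ ^ 2 ≠ 0 := sub_ne_zero.2 hk
  refine (((isLogJet_helmJet M.ks).add ((isLogJet_helmJet k₁).const_mul
    (-((M.kp ^ 2 - k₂ ^ 2) / (k₁ ^ 2 - k₂ ^ 2))))).add ((isLogJet_helmJet k₂).const_mul
    ((M.kp ^ 2 - k₁ ^ 2) / (k₁ ^ 2 - k₂ ^ 2)))).mono ?_ fun n s => by rw [pJet]; ring
  field_simp
  ring

theorem isLogJet_gJet : ∃ κ, IsLogJet κ (M.gJet k₁ k₂) :=
  ⟨_, (((isLogJet_helmJet k₁).const_mul (M.kp ^ 2 - k₁ ^ 2)).add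
    ((isLogJet_helmJet k₂).const_mul (-(M.kp ^ 2 - k₂ ^ 2)))).mono rfl
    fun n s => by rw [gJet]; ring⟩

theorem isLogJet_kJet : ∃ κ, IsLogJet κ (kJet k₁ k₂) :=
  ⟨_, (((isLogJet_helmJet k₁).const_mul (k₁ ^ 2)).add
    ((isLogJet_helmJet k₂).const_mul (-(k₂ ^ 2)))).mono rfl
    fun n s => by rw [kJet]; ring⟩

theorem isLogJet_qJet : IsLogJet 0 (M.qJet k₁ k₂) :=
  (((isLogJet_helmJet M.ks).add ((isLogJet_helmJet k₁).const_mul (-1))).add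
    (((isLogJet_helmJet k₁).add ((isLogJet_helmJet k₂).const_mul (-1))).const_mul
      (-((k₂ ^ 2 - M.q) / (k₁ ^ 2 - k₂ ^ 2))))).mono (by ring) fun n s => by rw [qJet]; ring

end Medium

end

end Poro

/-! ### The fundamental solution, its traces and the regularized kernels as functions of `x - y` -/

namespace Poro

noncomputable section

open Filter Topology

namespace Medium

variable (M : Medium) (k₁ k₂ : ℂ)

/-- The coefficient of the potential part of `E₁₁`. -/
def coeffE : ℂ := 1 / ((M.rho - M.beta * M.rhof) * M.omega ^ 2)

/-- The coefficient of `E₁₂`. -/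
def coeff12 : ℂ := Complex.I * M.omega * M.gam / ((M.lam + 2 * M.mu) * (k₁ ^ 2 - k₂ ^ 2))

/-- The coefficient of `E₂₁`. -/
def coeff21 : ℂ := -M.gam / ((M.lam + 2 * M.mu) * (k₁ ^ 2 - k₂ ^ 2))

/-- The coefficient of `E₂₂`. -/
def coeff22 : ℂ := Complex.I * M.rhof * M.omega / (M.beta * (k₁ ^ 2 - k₂ ^ 2))

/-- The coefficient of the kernel of `N₃²`. -/
def coeffN : ℂ :=
  -(2 * M.mu * M.beta * M.gam / (M.rhof * (M.lam + 2 * M.mu) * (k₁ ^ 2 - k₂ ^ 2)))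

theorem isPosJet_dJet : IsPosJet (dJet k₁ k₂) := (isLogJet_dJet k₁ k₂).isPosJet

theorem isPosJet_pJet (hk : k₁ ^ 2 ≠ k₂ ^ 2) : IsPosJet (M.pJet k₁ k₂) :=
  (M.isLogJet_pJet k₁ k₂ hk).isPosJet

theorem isPosJet_gJet : IsPosJet (M.gJet k₁ k₂) := (M.isLogJet_gJet k₁ k₂).choose_spec.isPosJet

theorem isPosJet_kJet : IsPosJet (kJet k₁ k₂) := (isLogJet_kJet k₁ k₂).choose_spec.isPosJet

theorem isPosJet_qJet : IsPosJet (M.qJet k₁ k₂) := (M.isLogJet_qJet k₁ k₂).isPosJet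

theorem isPosJet_helmJet (k : ℂ) : IsPosJet (helmJet k) := (isLogJet_helmJet k).isPosJet

/-! #### The fundamental solution -/

theorem pd_left_of_eq_R0 {f : Plane → ℂ} {F : ℕ → ℝ → ℂ} (hF : IsPosJet F) {x y : Plane}
    (h : ∀ z, z ≠ y → f z = R0 F (z - y)) (hxy : x ≠ y) (i : Fin 2) :
    pd i f x = R1 F i (x - y) := by
  rw [pd_congr (g := fun z => R0 F (z - y))
    (by filter_upwards [eventually_ne_nhds hxy] with z hz using h z hz) i]
  exact (hasGrad_R0 hF (sub_ne_zero.2 hxy)).pd_sub_right i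

theorem E11_eq (hk : k₁ ^ 2 ≠ k₂ ^ 2) (h₁ : k₁ ≠ 0) (h₂ : k₂ ≠ 0) {x y : Plane} (hxy : x ≠ y)
    (i j : Fin 2) :
    M.E11 k₁ k₂ x y i j =
      1 / (M.mu : ℂ) * kron i j * R0 (helmJet M.ks) (x - y) +
        M.coeffE * R2 (M.pJet k₁ k₂) j i (x - y) := by
  have hP := M.isPosJet_pJet k₁ k₂ hk
  have e : ∀ x', x' ≠ y → pd j (fun x'' =>
        helm M.ks x'' y
          - (M.kp ^ 2 - k₂ ^ 2) / (k₁ ^ 2 - k₂ ^ 2) * helm k₁ x'' y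
          + (M.kp ^ 2 - k₁ ^ 2) / (k₁ ^ 2 - k₂ ^ 2) * helm k₂ x'' y) x' =
      R1 (M.pJet k₁ k₂) j (x' - y) := fun x' hx' =>
    pd_left_of_eq_R0 hP (fun z hz => by
      rw [helm_eq_helmJet M.ks_ne hz, helm_eq_helmJet h₁ hz, helm_eq_helmJet h₂ hz, R0, pJet])
      hx' j
  rw [E11, pd_congr (g := fun z => R1 (M.pJet k₁ k₂) j (z - y))
    (by filter_upwards [eventually_ne_nhds hxy] with z hz using e z hz) i,
    (hasGrad_R1 hP (sub_ne_zero.2 hxy) j).pd_sub_right i, helm_eq_helmJet M.ks_ne hxy,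
    Matrix.one_apply, R0, coeffE]
  ring

theorem pd_helm_sub (h₁ : k₁ ≠ 0) (h₂ : k₂ ≠ 0) {x y : Plane} (hxy : x ≠ y) (i : Fin 2) :
    pd i (fun x' => helm k₁ x' y - helm k₂ x' y) x = R1 (dJet k₁ k₂) i (x - y) :=
  pd_left_of_eq_R0 (isPosJet_dJet k₁ k₂) (fun z hz => by
    rw [helm_eq_helmJet h₁ hz, helm_eq_helmJet h₂ hz, R0, dJet]) hxy i

theorem E12_eq (h₁ : k₁ ≠ 0) (h₂ : k₂ ≠ 0) {x y : Plane} (hxy : x ≠ y) (i : Fin 2) :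
    M.E12 k₁ k₂ x y i = M.coeff12 k₁ k₂ * R1 (dJet k₁ k₂) i (x - y) := by
  rw [E12, pd_helm_sub k₁ k₂ h₁ h₂ hxy, coeff12]

theorem E21_eq (h₁ : k₁ ≠ 0) (h₂ : k₂ ≠ 0) {x y : Plane} (hxy : x ≠ y) (i : Fin 2) :
    M.E21 k₁ k₂ x y i = M.coeff21 k₁ k₂ * R1 (dJet k₁ k₂) i (x - y) := by
  rw [E21, pd_helm_sub k₁ k₂ h₁ h₂ hxy, coeff21]

theorem E22_eq (h₁ : k₁ ≠ 0) (h₂ : k₂ ≠ 0) {x y : Plane} (hxy : x ≠ y) :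
    M.E22 k₁ k₂ x y = M.coeff22 k₁ k₂ * R0 (M.gJet k₁ k₂) (x - y) := by
  rw [E22, helm_eq_helmJet h₁ hxy, helm_eq_helmJet h₂ hxy, coeff22, R0, gJet]

/-! #### The traces of the fundamental solution -/

theorem pd_E11_right (hk : k₁ ^ 2 ≠ k₂ ^ 2) (h₁ : k₁ ≠ 0) (h₂ : k₂ ≠ 0) {x y : Plane}
    (hxy : x ≠ y) (i j l : Fin 2) :
    pd l (fun z => M.E11 k₁ k₂ x z i j) y =
      -(1 / (M.mu : ℂ) * kron i j * R1 (helmJet M.ks) l (x - y) +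
        M.coeffE * R3 (M.pJet k₁ k₂) j i l (x - y)) := by
  have hw := sub_ne_zero.2 hxy
  rw [pd_congr (g := fun z => (fun w => 1 / (M.mu : ℂ) * kron i j * R0 (helmJet M.ks) w +
        M.coeffE * R2 (M.pJet k₁ k₂) j i w) (x - z))
    (by filter_upwards [eventually_ne_nhds hxy.symm] with z hz using
      M.E11_eq k₁ k₂ hk h₁ h₂ hz.symm i j) l]
  exact (((hasGrad_R0 (isPosJet_helmJet M.ks) hw).const_mul _).add
    ((hasGrad_R2 (M.isPosJet_pJet k₁ k₂ hk) hw j i).const_mul _)).pd_sub_left l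

theorem pd_E12_right (h₁ : k₁ ≠ 0) (h₂ : k₂ ≠ 0) {x y : Plane} (hxy : x ≠ y) (i l : Fin 2) :
    pd l (fun z => M.E12 k₁ k₂ x z i) y =
      -(M.coeff12 k₁ k₂ * R2 (dJet k₁ k₂) i l (x - y)) := by
  have hw := sub_ne_zero.2 hxy
  rw [pd_congr (g := fun z => (fun w => M.coeff12 k₁ k₂ * R1 (dJet k₁ k₂) i w) (x - z))
    (by filter_upwards [eventually_ne_nhds hxy.symm] with z hz using
      M.E12_eq k₁ k₂ h₁ h₂ hz.symm i) l]
  exact ((hasGrad_R1 (isPosJet_dJet k₁ k₂) hw i).const_mul _).pd_sub_left l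

/-- `(T̃*(∂_y, ν_y) E)_{jl}` for displacement indices. -/
theorem adjE_inl_inl (hk : k₁ ^ 2 ≠ k₂ ^ 2) (h₁ : k₁ ≠ 0) (h₂ : k₂ ≠ 0) {x y : Plane}
    (hxy : x ≠ y) (ny : Fin 2 → ℝ) (j l : Fin 2) :
    M.adjE k₁ k₂ ny x y (Sum.inl j) (Sum.inl l) =
      -(2 * M.mu * ∑ i, (ny i : ℂ) * (1 / (M.mu : ℂ) * kron j l * R1 (helmJet M.ks) i (x - y) +
          M.coeffE * R3 (M.pJet k₁ k₂) l j i (x - y))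
        + M.lam * ny j * ∑ i, (1 / (M.mu : ℂ) * kron i l * R1 (helmJet M.ks) i (x - y) +
          M.coeffE * R3 (M.pJet k₁ k₂) l i i (x - y))
        + M.mu * (tang ny j : ℂ) *
          ((1 / (M.mu : ℂ) * kron 0 l * R1 (helmJet M.ks) 1 (x - y) +
            M.coeffE * R3 (M.pJet k₁ k₂) l 0 1 (x - y)) -
          (1 / (M.mu : ℂ) * kron 1 l * R1 (helmJet M.ks) 0 (x - y) +
            M.coeffE * R3 (M.pJet k₁ k₂) l 1 0 (x - y))))
      - Complex.I * M.omega * M.alpha * ny j *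
        (M.coeff21 k₁ k₂ * R1 (dJet k₁ k₂) l (x - y)) := by
  simp only [adjE, neumannAdj, Matrix.of_apply, Sum.elim_inl, traction, dn, E,
    Matrix.fromBlocks_apply₁₁, Matrix.fromBlocks_apply₂₁,
    M.pd_E11_right k₁ k₂ hk h₁ h₂ hxy, M.E21_eq k₁ k₂ h₁ h₂ hxy, Fin.sum_univ_two, tang]
  ring

/-- The function of `x - y` representing `(T̃*(∂_y, ν_y) E)_{j3}`. -/
def presTrace (ny : Fin 2 → ℝ) (j : Fin 2) (w : Plane) : ℂ :=
  -M.coeff12 k₁ k₂ * (2 * M.mu * (ny 0 * R2 (dJet k₁ k₂) j 0 w + ny 1 * R2 (dJet k₁ k₂) j 1 w)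
    + M.lam * ny j * (R2 (dJet k₁ k₂) 0 0 w + R2 (dJet k₁ k₂) 1 1 w))
  + -(Complex.I * M.omega * M.alpha * ny j * M.coeff22 k₁ k₂) * R0 (M.gJet k₁ k₂) w

/-- The column `E12` is a gradient, so the rotational term of the traction drops out by the symmetry
of second derivatives. -/
theorem adjE_inl_inr (h₁ : k₁ ≠ 0) (h₂ : k₂ ≠ 0) {x y : Plane}
    (hxy : x ≠ y) (ny : Fin 2 → ℝ) (j : Fin 2) :
    M.adjE k₁ k₂ ny x y (Sum.inl j) (Sum.inr ()) = M.presTrace k₁ k₂ ny j (x - y) := by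
  simp only [adjE, neumannAdj, Matrix.of_apply, Sum.elim_inl, traction, dn, E,
    Matrix.fromBlocks_apply₁₂, Matrix.fromBlocks_apply₂₂,
    M.pd_E12_right k₁ k₂ h₁ h₂ hxy, M.E22_eq k₁ k₂ h₁ h₂ hxy, Fin.sum_univ_two, presTrace,
    R2_symm _ 1 0]
  ring

theorem hasGrad_presTrace (ny : Fin 2 → ℝ) (j : Fin 2) {w : Plane} (hw : w ≠ 0) :
    HasGrad (M.presTrace k₁ k₂ ny j) (fun l =>
      -M.coeff12 k₁ k₂ *
        (2 * M.mu * (ny 0 * R3 (dJet k₁ k₂) j 0 l w + ny 1 * R3 (dJet k₁ k₂) j 1 l w)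
        + M.lam * ny j * (R3 (dJet k₁ k₂) 0 0 l w + R3 (dJet k₁ k₂) 1 1 l w))
      + -(Complex.I * M.omega * M.alpha * ny j * M.coeff22 k₁ k₂) *
        R1 (M.gJet k₁ k₂) l w) w := by
  have h2 := hasGrad_R2 (isPosJet_dJet k₁ k₂) hw
  exact (((((h2 j 0).const_mul _).add ((h2 j 1).const_mul _)).const_mul _).add
    (((h2 0 0).add (h2 1 1)).const_mul _)).const_mul _ |>.add
    ((hasGrad_R0 (M.isPosJet_gJet k₁ k₂) hw).const_mul _)

/-- In the pressure row only the pressure component of the inner trace is differentiated in `x`, so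
third derivatives of the potentials are the highest that occur. -/
theorem hyperKernel_inr_inl (h₁ : k₁ ≠ 0) (h₂ : k₂ ≠ 0) {x y : Plane}
    (hxy : x ≠ y) (nx ny : Fin 2 → ℝ) (j : Fin 2) :
    M.hyperKernel k₁ k₂ nx ny x y (Sum.inr ()) (Sum.inl j) =
      -(Complex.I * M.omega * M.beta) *
        (∑ l, (nx l : ℂ) * M.adjE k₁ k₂ ny x y (Sum.inl j) (Sum.inl l))
      + Complex.I * M.beta / (M.omega * M.rhof) * ∑ l, (nx l : ℂ) *
        (-M.coeff12 k₁ k₂ * (2 * M.mu * (ny 0 * R3 (dJet k₁ k₂) j 0 l (x - y)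
            + ny 1 * R3 (dJet k₁ k₂) j 1 l (x - y))
          + M.lam * ny j * (R3 (dJet k₁ k₂) 0 0 l (x - y) + R3 (dJet k₁ k₂) 1 1 l (x - y)))
        + -(Complex.I * M.omega * M.alpha * ny j * M.coeff22 k₁ k₂) *
          R1 (M.gJet k₁ k₂) l (x - y)) := by
  have e : ∀ l, pd l (fun z => M.adjE k₁ k₂ ny z y (Sum.inl j) (Sum.inr ())) x = _ := fun l =>
    (pd_congr (g := fun z => M.presTrace k₁ k₂ ny j (z - y))
      (by filter_upwards [eventually_ne_nhds hxy] with z hz using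
        M.adjE_inl_inr k₁ k₂ h₁ h₂ hz ny j) l).trans
      ((M.hasGrad_presTrace k₁ k₂ ny j (sub_ne_zero.2 hxy)).pd_sub_right l)
  simp only [hyperKernel, neumann, Matrix.of_apply, Sum.elim_inr, Matrix.transpose_apply, dn, e]

/-! #### The regularized kernels -/

theorem kernel1_eq (h₁ : k₁ ≠ 0) (h₂ : k₂ ≠ 0) {x y : Plane}
    (hxy : x ≠ y) (nx ny : Fin 2 → ℝ) (j : Fin 2) :
    M.kernel1 k₁ k₂ nx ny x y j =
      -(Complex.I * M.omega * M.beta) * (∑ i, (nx i : ℂ) * R1 (M.qJet k₁ k₂) i (x - y)) * ny j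
      - Complex.I * M.omega * M.beta *
        (-(∑ i, (ny i : ℂ) * R1 (helmJet M.ks) i (x - y)) * nx j
        - Complex.I * M.omega * M.alpha *
          (M.coeff21 k₁ k₂ * ∑ i, (nx i : ℂ) * R1 (dJet k₁ k₂) i (x - y)) * ny j)
      - M.beta * M.gam / (M.rhof * (k₁ ^ 2 - k₂ ^ 2)) *
        (∑ i, (nx i : ℂ) * R1 (kJet k₁ k₂) i (x - y)) * ny j
      + Complex.I * M.omega * M.alpha / (k₁ ^ 2 - k₂ ^ 2) *
        (∑ i, (nx i : ℂ) * R1 (M.gJet k₁ k₂) i (x - y)) * ny j := by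
  have e1 : ∀ i, pd i (fun z => helm M.ks z y - helm k₁ z y
        - (k₂ ^ 2 - M.q) / (k₁ ^ 2 - k₂ ^ 2) * (helm k₁ z y - helm k₂ z y)) x =
      R1 (M.qJet k₁ k₂) i (x - y) := pd_left_of_eq_R0 (M.isPosJet_qJet k₁ k₂) (fun z hz => by
    rw [helm_eq_helmJet M.ks_ne hz, helm_eq_helmJet h₁ hz, helm_eq_helmJet h₂ hz, R0, qJet]) hxy
  have e2 : ∀ i, pd i (fun z => helm M.ks x z) y = -R1 (helmJet M.ks) i (x - y) := fun i =>
    (pd_congr (g := fun z => R0 (helmJet M.ks) (x - z))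
      (by filter_upwards [eventually_ne_nhds hxy.symm] with z hz using
        helm_eq_helmJet M.ks_ne hz.symm) i).trans
      ((hasGrad_R0 (isPosJet_helmJet M.ks) (sub_ne_zero.2 hxy)).pd_sub_left i)
  have e3 : ∀ i, pd i (fun z => k₁ ^ 2 * helm k₁ z y - k₂ ^ 2 * helm k₂ z y) x =
      R1 (kJet k₁ k₂) i (x - y) := pd_left_of_eq_R0 (isPosJet_kJet k₁ k₂) (fun z hz => by
    rw [helm_eq_helmJet h₁ hz, helm_eq_helmJet h₂ hz, R0, kJet]) hxy
  have e4 : ∀ i, pd i (fun z => (M.kp ^ 2 - k₁ ^ 2) * helm k₁ z y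
        - (M.kp ^ 2 - k₂ ^ 2) * helm k₂ z y) x =
      R1 (M.gJet k₁ k₂) i (x - y) := pd_left_of_eq_R0 (M.isPosJet_gJet k₁ k₂) (fun z hz => by
    rw [helm_eq_helmJet h₁ hz, helm_eq_helmJet h₂ hz, R0, gJet]) hxy
  simp only [kernel1, dn, e1, e2, e3, e4, M.E21_eq k₁ k₂ h₁ h₂ hxy, Fin.sum_univ_two]
  ring

/-- The function of `x - y` representing the kernel of `N₃²`. -/
def diffKernel2 (j : Fin 2) (w : Plane) : ℂ := M.coeffN k₁ k₂ * R1 (dJet k₁ k₂) j w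

theorem kernel2_eq (h₁ : k₁ ≠ 0) (h₂ : k₂ ≠ 0) {x y : Plane} (hxy : x ≠ y) (j : Fin 2) :
    M.kernel2 k₁ k₂ x y j = M.diffKernel2 k₁ k₂ j (x - y) := by
  rw [kernel2, pd_helm_sub k₁ k₂ h₁ h₂ hxy, diffKernel2, coeffN]

theorem hasGrad_diffKernel2 (j : Fin 2) {w : Plane} (hw : w ≠ 0) :
    HasGrad (M.diffKernel2 k₁ k₂ j) (fun l => M.coeffN k₁ k₂ * R2 (dJet k₁ k₂) j l w) w :=
  (hasGrad_R1 (isPosJet_dJet k₁ k₂) hw j).const_mul _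

/-- The rotated normal contracted with a matrix. -/
def rot (a : Fin 2 → ℂ) : Fin 2 → ℂ := ![a 1, -a 0]

/-- The function of `x - y` representing the kernel of `N₃³`. -/
def diffKernel3 (nx : Fin 2 → ℝ) (j : Fin 2) (w : Plane) : ℂ :=
  -(Complex.I * M.omega * M.beta) * (rot (fun i => nx i) j * R0 (helmJet M.ks) w
    + 2 * M.mu * M.coeffE * (nx 0 * (rot (fun l => kron l 0) j * R2 (M.pJet k₁ k₂) 0 0 w
        + rot (fun l => kron l 1) j * R2 (M.pJet k₁ k₂) 0 1 w)
      + nx 1 * (rot (fun l => kron l 0) j * R2 (M.pJet k₁ k₂) 1 0 w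
        + rot (fun l => kron l 1) j * R2 (M.pJet k₁ k₂) 1 1 w)))
  + -(M.coeffN k₁ k₂ * rot (fun i => nx i) j) * R0 (kJet k₁ k₂) w

/-- The isotropic part of `2μ E₁₁ - γ_{k_s} I` is `(2 - 1) γ_{k_s} I`; multiplication by `A` on the
right is the rotation `rot`. -/
theorem kernel3_eq (hk : k₁ ^ 2 ≠ k₂ ^ 2) (h₁ : k₁ ≠ 0) (h₂ : k₂ ≠ 0) {x y : Plane}
    (hxy : x ≠ y) (nx : Fin 2 → ℝ) (j : Fin 2) :
    M.kernel3 k₁ k₂ nx x y j = M.diffKernel3 k₁ k₂ nx j (x - y) := by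
  have hμ : (M.mu : ℂ) ≠ 0 := by exact_mod_cast M.mu_pos.ne'
  have hE := M.E11_eq k₁ k₂ hk h₁ h₂ hxy
  have hs := helm_eq_helmJet M.ks_ne hxy
  have hK : k₁ ^ 2 * helm k₁ x y - k₂ ^ 2 * helm k₂ x y = R0 (kJet k₁ k₂) (x - y) := by
    rw [helm_eq_helmJet h₁ hxy, helm_eq_helmJet h₂ hxy, R0, kJet]
  have hs' : helm M.ks x y = R0 (helmJet M.ks) (x - y) := hs
  rw [kernel3, hK]
  fin_cases j <;>
  · simp [Matrix.vecMul, Matrix.mul_apply, dotProduct, Fin.sum_univ_two, matA, hE, hs',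
      diffKernel3, rot, coeffN, R2_symm _ 1 0]
    field_simp
    ring

theorem hasGrad_diffKernel3 (hk : k₁ ^ 2 ≠ k₂ ^ 2) (nx : Fin 2 → ℝ) (j : Fin 2) {w : Plane}
    (hw : w ≠ 0) :
    HasGrad (M.diffKernel3 k₁ k₂ nx j) (fun m =>
      -(Complex.I * M.omega * M.beta) * (rot (fun i => nx i) j * R1 (helmJet M.ks) m w
        + 2 * M.mu * M.coeffE * (nx 0 * (rot (fun l => kron l 0) j * R3 (M.pJet k₁ k₂) 0 0 m w
            + rot (fun l => kron l 1) j * R3 (M.pJet k₁ k₂) 0 1 m w)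
          + nx 1 * (rot (fun l => kron l 0) j * R3 (M.pJet k₁ k₂) 1 0 m w
            + rot (fun l => kron l 1) j * R3 (M.pJet k₁ k₂) 1 1 m w)))
      + -(M.coeffN k₁ k₂ * rot (fun i => nx i) j) * R1 (kJet k₁ k₂) m w) w := by
  have h2 := hasGrad_R2 (M.isPosJet_pJet k₁ k₂ hk) hw
  refine HasGrad.add (HasGrad.const_mul _ (HasGrad.add
    ((hasGrad_R0 (isPosJet_helmJet M.ks) hw).const_mul _) (HasGrad.const_mul _ (HasGrad.add
      (HasGrad.const_mul _ (HasGrad.add ((h2 0 0).const_mul _) ((h2 0 1).const_mul _)))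
      (HasGrad.const_mul _ (HasGrad.add ((h2 1 0).const_mul _) ((h2 1 1).const_mul _)))))))
    ((hasGrad_R0 (isPosJet_kJet k₁ k₂) hw).const_mul _)

/-- The kernel of `N₃³` together with the tangential derivative of the kernel of `N₃²`. -/
def fluxKernel (nx : Fin 2 → ℝ) (j : Fin 2) (w : Plane) : ℂ :=
  M.diffKernel3 k₁ k₂ nx j w + M.coeffN k₁ k₂ * (tang nx 0 * R2 (dJet k₁ k₂) j 0 w
    + tang nx 1 * R2 (dJet k₁ k₂) j 1 w)

/-- The gradient of `fluxKernel`. -/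
def fluxGrad (nx : Fin 2 → ℝ) (j : Fin 2) (w : Plane) (m : Fin 2) : ℂ :=
  (-(Complex.I * M.omega * M.beta) * (rot (fun i => nx i) j * R1 (helmJet M.ks) m w
        + 2 * M.mu * M.coeffE * (nx 0 * (rot (fun l => kron l 0) j * R3 (M.pJet k₁ k₂) 0 0 m w
            + rot (fun l => kron l 1) j * R3 (M.pJet k₁ k₂) 0 1 m w)
          + nx 1 * (rot (fun l => kron l 0) j * R3 (M.pJet k₁ k₂) 1 0 m w
            + rot (fun l => kron l 1) j * R3 (M.pJet k₁ k₂) 1 1 m w)))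
      + -(M.coeffN k₁ k₂ * rot (fun i => nx i) j) * R1 (kJet k₁ k₂) m w)
    + M.coeffN k₁ k₂ * (tang nx 0 * R3 (dJet k₁ k₂) j 0 m w
      + tang nx 1 * R3 (dJet k₁ k₂) j 1 m w)

theorem hasGrad_fluxKernel (hk : k₁ ^ 2 ≠ k₂ ^ 2) (nx : Fin 2 → ℝ) (j : Fin 2) {w : Plane}
    (hw : w ≠ 0) : HasGrad (M.fluxKernel k₁ k₂ nx j) (M.fluxGrad k₁ k₂ nx j w) w := by
  have h2 := hasGrad_R2 (isPosJet_dJet k₁ k₂) hw j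
  exact (M.hasGrad_diffKernel3 k₁ k₂ hk nx j hw).add
    ((((h2 0).const_mul _).add ((h2 1).const_mul _)).const_mul _)

end Medium

end

end Poro

/-! ### The algebraic identity decomposing the hypersingular kernel -/

namespace Poro

noncomputable section

open Filter Topology

namespace Medium

variable (M : Medium) (k₁ k₂ : ℂ)

theorem R3_pJet (i j l : Fin 2) (w : Plane) : R3 (M.pJet k₁ k₂) i j l w =
    R3 (helmJet M.ks) i j l w
      - (M.kp ^ 2 - k₂ ^ 2) / (k₁ ^ 2 - k₂ ^ 2) * R3 (helmJet k₁) i j l w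
      + (M.kp ^ 2 - k₁ ^ 2) / (k₁ ^ 2 - k₂ ^ 2) * R3 (helmJet k₂) i j l w := by
  simp only [R3, pJet]; ring

theorem R1_dJet (i : Fin 2) (w : Plane) :
    R1 (dJet k₁ k₂) i w = R1 (helmJet k₁) i w - R1 (helmJet k₂) i w := by
  simp only [R1, dJet]; ring

theorem R3_dJet (i j l : Fin 2) (w : Plane) :
    R3 (dJet k₁ k₂) i j l w = R3 (helmJet k₁) i j l w - R3 (helmJet k₂) i j l w := by
  simp only [R3, dJet]; ring

theorem R1_gJet (i : Fin 2) (w : Plane) : R1 (M.gJet k₁ k₂) i w =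
    (M.kp ^ 2 - k₁ ^ 2) * R1 (helmJet k₁) i w - (M.kp ^ 2 - k₂ ^ 2) * R1 (helmJet k₂) i w := by
  simp only [R1, gJet]; ring

theorem R1_qJet (i : Fin 2) (w : Plane) : R1 (M.qJet k₁ k₂) i w =
    R1 (helmJet M.ks) i w - R1 (helmJet k₁) i w - (k₂ ^ 2 - M.q) / (k₁ ^ 2 - k₂ ^ 2) *
      (R1 (helmJet k₁) i w - R1 (helmJet k₂) i w) := by
  simp only [R1, qJet]; ring

theorem R1_kJet (i : Fin 2) (w : Plane) : R1 (kJet k₁ k₂) i w =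
    k₁ ^ 2 * R1 (helmJet k₁) i w - k₂ ^ 2 * R1 (helmJet k₂) i w := by
  simp only [R1, kJet]; ring

theorem rhof_ne : (M.rhof : ℂ) ≠ 0 := by exact_mod_cast M.rhof_pos.ne'

theorem omega_ne : (M.omega : ℂ) ≠ 0 := by exact_mod_cast M.omega_pos.ne'

theorem mu_ne : (M.mu : ℂ) ≠ 0 := by exact_mod_cast M.mu_pos.ne'

theorem coeffE_mul_ks_sq : M.coeffE * M.ks ^ 2 = 1 / M.mu := by
  have h := M.ks_sq
  have h1 := M.mu_ne
  have h2 := M.stiffness_ne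
  rw [coeffE, eq_div_iff h1, one_div, mul_assoc, h, inv_mul_cancel₀ h2]

theorem coeffE_mul_kp_sq : M.coeffE * (M.lam + 2 * M.mu) * M.kp ^ 2 = 1 := by
  have h := M.kp_sq
  have h2 := M.stiffness_ne
  rw [coeffE, mul_assoc, mul_comm _ (M.kp ^ 2), h, one_div, inv_mul_cancel₀ h2]

/-- By `k₁² k₂² = q k_p²` one has `(k_p² - k₂²) k₁² = k_p² (k₁² - q)`, and `k_p²` cancels against
the stiffness constants. This produces the factor containing `q` in the kernel of `N₃¹`. -/
theorem coeffE_mul_left {k₁ k₂ : ℂ} (hk : M.IsWaveNumberPair k₁ k₂) :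
    M.coeffE * (M.lam + 2 * M.mu) * ((M.kp ^ 2 - k₂ ^ 2) / (k₁ ^ 2 - k₂ ^ 2)) * k₁ ^ 2 =
      (k₁ ^ 2 - M.q) / (k₁ ^ 2 - k₂ ^ 2) := by
  have h := M.coeffE_mul_kp_sq
  linear_combination (k₁ ^ 2 - M.q) / (k₁ ^ 2 - k₂ ^ 2) * h
    - M.coeffE * (M.lam + 2 * M.mu) / (k₁ ^ 2 - k₂ ^ 2) * hk.2.2.2

theorem coeffE_mul_right {k₁ k₂ : ℂ} (hk : M.IsWaveNumberPair k₁ k₂) :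
    M.coeffE * (M.lam + 2 * M.mu) * ((M.kp ^ 2 - k₁ ^ 2) / (k₁ ^ 2 - k₂ ^ 2)) * k₂ ^ 2 =
      (k₂ ^ 2 - M.q) / (k₁ ^ 2 - k₂ ^ 2) := by
  have h := M.coeffE_mul_kp_sq
  linear_combination (k₂ ^ 2 - M.q) / (k₁ ^ 2 - k₂ ^ 2) * h
    - M.coeffE * (M.lam + 2 * M.mu) / (k₁ ^ 2 - k₂ ^ 2) * hk.2.2.2

/-- The kernel identity behind the regularization: the hypersingular kernel is a weakly singular
one plus a tangential derivative. -/
theorem hyperKernel_eq (hk : M.IsWaveNumberPair k₁ k₂) (hk_ne : k₁ ^ 2 ≠ k₂ ^ 2) {x y : Plane}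
    (hxy : x ≠ y) (nx ny : Fin 2 → ℝ) (j : Fin 2) :
    M.hyperKernel k₁ k₂ nx ny x y (Sum.inr ()) (Sum.inl j) =
      M.kernel1 k₁ k₂ nx ny x y j
        + ∑ m, (tang ny m : ℂ) * M.fluxGrad k₁ k₂ nx j (x - y) m := by
  obtain ⟨h₁, h₂⟩ := hk.ne_zero
  have hw := sub_ne_zero.2 hxy
  have hd : k₁ ^ 2 - k₂ ^ 2 ≠ 0 := sub_ne_zero.2 hk_ne
  have hβ := M.beta_ne
  have hρ := M.rhof_ne
  have hω := M.omega_ne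
  have hΛ := M.lam_ne
  have hμ := M.mu_ne
  rw [M.hyperKernel_inr_inl k₁ k₂ h₁ h₂ hxy, M.kernel1_eq k₁ k₂ h₁ h₂ hxy]
  -- The constants created by the differentiated pressure trace are matched with those of the
  -- regularized kernels; each match uses `i² = -1`.
  have r1 : Complex.I * M.beta / (M.omega * M.rhof) * M.coeff12 k₁ k₂ * (2 * M.mu) =
      M.coeffN k₁ k₂ := by
    rw [coeff12, coeffN]
    field_simp
    rw [Complex.I_sq]
    ring
  have r2 : Complex.I * M.beta / (M.omega * M.rhof) * M.coeff12 k₁ k₂ * (M.lam + 2 * M.mu) =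
      -(M.beta * M.gam / (M.rhof * (k₁ ^ 2 - k₂ ^ 2))) := by
    rw [coeff12]
    field_simp
    rw [Complex.I_sq]
    ring
  have r3 : Complex.I * M.beta / (M.omega * M.rhof) * M.coeff22 k₁ k₂ =
      -(1 / (k₁ ^ 2 - k₂ ^ 2)) := by
    rw [coeff22]
    field_simp
    rw [Complex.I_sq]
  have r4 := M.coeffE_mul_left hk
  have r5 := M.coeffE_mul_right hk
  have r6 := M.coeffE_mul_ks_sq
  have r0 : (M.mu : ℂ) * (1 / M.mu) = 1 := mul_one_div_cancel hμ
  simp only [M.adjE_inl_inl k₁ k₂ hk_ne h₁ h₂ hxy, fluxGrad, Fin.sum_univ_two]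
  set w := x - y
  simp only [R3_pJet, R3_dJet, R1_dJet, R1_gJet, R1_qJet, R1_kJet]
  have t : ∀ k i, R3 (helmJet k) 1 1 i w = -k ^ 2 * R1 (helmJet k) i w - R3 (helmJet k) 0 0 i w :=
    fun k i => by linear_combination R3_helmJet_trace k hw i
  -- With the constants opaque, the identity becomes polynomial in them and in the derivatives of
  -- the `γ_k`, subject only to the relations just recorded.
  generalize M.coeff12 k₁ k₂ = c12 at *
  generalize M.coeff22 k₁ k₂ = c22 at *
  generalize M.coeff21 k₁ k₂ = c21 at *
  generalize M.coeffN k₁ k₂ = cN at *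
  generalize M.coeffE = cE at *
  generalize Complex.I * M.beta / (M.omega * M.rhof) = A at *
  generalize M.beta * M.gam / (M.rhof * (k₁ ^ 2 - k₂ ^ 2)) = C at *
  have r3' : Complex.I * M.omega * M.alpha / (k₁ ^ 2 - k₂ ^ 2) =
    -(Complex.I * M.omega * M.alpha * (A * c22)) := by rw [r3]; ring
  -- This reconciles the asymmetric weights of `γ_{k₁}` and `γ_{k₂}` in the first term of `N₃¹` with
  -- the symmetric ones coming from `E₁₁`.
  have r4' : (k₂ ^ 2 - M.q) / (k₁ ^ 2 - k₂ ^ 2) = (k₁ ^ 2 - M.q) / (k₁ ^ 2 - k₂ ^ 2) - 1 := by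
    field_simp; ring
  rw [r3', ← r1, show C = -(A * c12 * (M.lam + 2 * M.mu)) by rw [r2]; ring]
  set a := (M.kp ^ 2 - k₂ ^ 2) / (k₁ ^ 2 - k₂ ^ 2)
  set b := (M.kp ^ 2 - k₁ ^ 2) / (k₁ ^ 2 - k₂ ^ 2)
  rw [← r5] at r4' ⊢
  rw [← r4] at r4'
  generalize (1 / M.mu : ℂ) = m at *
  set Q := R1 (helmJet M.ks)
  set Q1 := R1 (helmJet k₁)
  set Q2 := R1 (helmJet k₂)
  set iwb := Complex.I * M.omega * M.beta
  -- Once `t` is applied the third derivatives cancel identically. Among the first derivatives,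
  -- those of `γ_{k₁}` need `r4'` and those of `γ_{k_s}` need `r6` and `r0`.
  fin_cases j
  · simp [tang, rot, kron]
    simp only [R3_symm₁, R3_symm₂, R3_symm₃, R3_symm₄, t]
    linear_combination (iwb * ny 0 * (nx 0 * Q1 0 w + nx 1 * Q1 1 w)) * (-r4')
      - iwb * (M.lam + 2 * M.mu) * ny 0 * (nx 0 * Q 0 w + nx 1 * Q 1 w) * r6
      + iwb * (2 * nx 0 * (ny 0 * Q 0 w + ny 1 * Q 1 w) - ny 1 * (nx 0 * Q 1 w - nx 1 * Q 0 w)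
        - 2 * ny 0 * (nx 0 * Q 0 w + nx 1 * Q 1 w)) * r0
  · simp [tang, rot, kron]
    simp only [R3_symm₁, R3_symm₂, R3_symm₃, R3_symm₄, t]
    linear_combination (iwb * ny 1 * (nx 0 * Q1 0 w + nx 1 * Q1 1 w)) * (-r4')
      - iwb * (M.lam + 2 * M.mu) * ny 1 * (nx 0 * Q 0 w + nx 1 * Q 1 w) * r6
      + iwb * (2 * nx 1 * (ny 0 * Q 0 w + ny 1 * Q 1 w) + ny 0 * (nx 0 * Q 1 w - nx 1 * Q 0 w)
        - 2 * ny 1 * (nx 0 * Q 0 w + nx 1 * Q 1 w)) * r0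

end Medium

end

end Poro

namespace Poro

noncomputable section

open Filter Topology Set

/-! ### Smooth simple closed curves -/

/-- A regular simple closed curve, parametrized over a period `2π`. -/
structure IsClosedCurve (γ : ℝ → Plane) : Prop where
  smooth : ContDiff ℝ 2 γ
  periodic : Function.Periodic γ (2 * Real.pi)
  regular : ∀ t, deriv γ t ≠ 0
  simple : Set.InjOn γ (Set.Ico 0 (2 * Real.pi))

theorem periodic_deriv {V : Type*} [NormedAddCommGroup V] [NormedSpace ℝ V] {f : ℝ → V} {T : ℝ}
    (h : Function.Periodic f T) : Function.Periodic (deriv f) T := by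
  intro t
  have : (fun s => f (s + T)) = f := funext h
  rw [← deriv_comp_add_const, this]

theorem periodic_norm_bound {V : Type*} [NormedAddCommGroup V] {f : ℝ → V}
    (h : Function.Periodic f (2 * Real.pi)) (hf : Continuous f) : ∃ C, 0 ≤ C ∧ ∀ t, ‖f t‖ ≤ C := by
  obtain ⟨C, hC⟩ := (h.isBounded_of_continuous Real.two_pi_pos.ne' hf).exists_norm_le
  exact ⟨max C 0, le_max_right _ _, fun t => (hC _ ⟨t, rfl⟩).trans (le_max_left _ _)⟩

namespace IsClosedCurve

variable {γ : ℝ → Plane}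

theorem hasDerivAt (h : IsClosedCurve γ) (t : ℝ) : HasDerivAt γ (deriv γ t) t :=
  (h.smooth.differentiable two_ne_zero t).hasDerivAt

theorem continuous (h : IsClosedCurve γ) : Continuous γ := h.smooth.continuous

theorem contDiff_deriv (h : IsClosedCurve γ) : ContDiff ℝ 1 (deriv γ) :=
  ((contDiff_succ_iff_deriv (n := 1)).1 h.smooth).2.2

theorem continuous_deriv (h : IsClosedCurve γ) : Continuous (deriv γ) :=
  h.contDiff_deriv.continuous

theorem exists_speed_bounds (h : IsClosedCurve γ) :
    ∃ m L : ℝ, 0 < m ∧ 0 ≤ L ∧ ∀ t, m ≤ ‖deriv γ t‖ ∧ ‖deriv γ t‖ ≤ L := by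
  obtain ⟨L, hL, hb⟩ := periodic_norm_bound (periodic_deriv h.periodic) h.continuous_deriv
  obtain ⟨m, hm, hmb⟩ := (isCompact_Icc (a := (0 : ℝ)) (b := 2 * Real.pi)).exists_forall_le'
    (f := fun t => ‖deriv γ t‖) h.continuous_deriv.norm.continuousOn (a := 0)
    fun t _ => norm_pos_iff.2 (h.regular t)
  refine ⟨m, L, hm, hL, fun t => ⟨?_, hb t⟩⟩
  obtain ⟨s, hs, e⟩ := (periodic_deriv h.periodic).exists_mem_Ico₀ Real.two_pi_pos t
  rw [e]
  exact hmb s ⟨hs.1, hs.2.le⟩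

theorem exists_taylor (h : IsClosedCurve γ) :
    ∃ K, 0 ≤ K ∧ ∀ t s, ‖γ s - γ t - (s - t) • deriv γ t‖ ≤ K * (s - t) ^ 2 := by
  obtain ⟨K, hK, hb⟩ := periodic_norm_bound (periodic_deriv (periodic_deriv h.periodic))
    (h.contDiff_deriv.continuous_deriv le_rfl)
  have hlip : ∀ t s, ‖deriv γ s - deriv γ t‖ ≤ K * ‖s - t‖ := fun t s =>
    convex_univ.norm_image_sub_le_of_norm_deriv_le
      (fun x _ => h.contDiff_deriv.differentiable one_ne_zero x) (fun x _ => hb x)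
      (mem_univ t) (mem_univ s)
  refine ⟨K, hK, fun t s => ?_⟩
  have h1 := (convex_uIcc t s).norm_image_sub_le_of_norm_hasDerivWithin_le
    (f := fun r => γ r - (r - t) • deriv γ t) (f' := fun r => deriv γ r - deriv γ t)
    (C := K * ‖s - t‖)
    (fun r _ => by
      have := (h.hasDerivAt r).sub (((hasDerivAt_id r).sub_const t).smul_const (deriv γ t))
      exact (this.congr_deriv (by simp)).hasDerivWithinAt)
    (fun r hr => (hlip t r).trans (by
      gcongr
      simpa [Real.norm_eq_abs] using abs_sub_left_of_mem_uIcc hr))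
    left_mem_uIcc right_mem_uIcc
  have e : γ s - (s - t) • deriv γ t - (γ t - (t - t) • deriv γ t) =
      γ s - γ t - (s - t) • deriv γ t := by simp; abel
  rw [← e]
  refine h1.trans (le_of_eq ?_)
  rw [Real.norm_eq_abs, mul_assoc, ← abs_mul, ← sq, abs_of_nonneg (sq_nonneg _)]

theorem eq_add_of_eq (h : IsClosedCurve γ) {t s : ℝ} (e : γ t = γ s) :
    ∃ n : ℤ, t = s + n * (2 * Real.pi) := by
  have hp := Real.two_pi_pos
  have key : ∀ r, γ (toIcoMod hp 0 r) = γ r := fun r => by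
    rw [toIcoMod, h.periodic.sub_zsmul_eq]
  have hmem : ∀ r, toIcoMod hp 0 r ∈ Ico 0 (2 * Real.pi) := fun r => by
    simpa using toIcoMod_mem_Ico hp 0 r
  have h1 := h.simple (hmem t) (hmem s) (by rw [key, key, e])
  refine ⟨toIcoDiv hp 0 t - toIcoDiv hp 0 s, ?_⟩
  rw [toIcoMod, toIcoMod] at h1
  push_cast
  simp only [zsmul_eq_mul] at h1
  linarith

theorem eq_of_eq (h : IsClosedCurve γ) {t s : ℝ} (e : γ t = γ s) (hts : |t - s| < 2 * Real.pi) :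
    t = s := by
  obtain ⟨n, hn⟩ := h.eq_add_of_eq e
  have hp := Real.two_pi_pos
  have h1 : |(n : ℝ)| * (2 * Real.pi) < 1 * (2 * Real.pi) := by
    rw [← abs_of_pos hp, ← abs_mul, abs_of_pos hp, one_mul]
    rwa [hn, add_sub_cancel_left] at hts
  have h2 : |(n : ℝ)| < 1 := lt_of_mul_lt_mul_right h1 hp.le
  have h3 : n = 0 := by
    have : |n| < 1 := by exact_mod_cast h2
    simpa using this
  simpa [h3] using hn

theorem exists_near (h : IsClosedCurve γ) (t s : ℝ) :
    ∃ s', |s' - t| ≤ Real.pi ∧ γ s = γ s' := by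
  obtain ⟨y, hy, e⟩ := h.periodic.exists_mem_Ico Real.two_pi_pos s (t - Real.pi)
  exact ⟨y, abs_le.2 ⟨by linarith [hy.1], by linarith [hy.2]⟩, e⟩

/-- Near the diagonal the linear Taylor term dominates; away from it, injectivity modulo the period
and compactness give a positive lower bound. Parameter distances up to half a period are the most
that can be allowed uniformly. -/
theorem exists_chord_arc (h : IsClosedCurve γ) :
    ∃ m, 0 < m ∧ ∀ t s, |s - t| ≤ Real.pi → m * |s - t| ≤ ‖γ s - γ t‖ := by
  obtain ⟨m, L, hm, -, hmL⟩ := h.exists_speed_bounds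
  obtain ⟨K, hK, hT⟩ := h.exists_taylor
  -- Chosen so that `K δ ≤ m / 2`, half the minimal speed; the `+ 1` covers `K = 0`.
  set δ := m / (2 * (K + 1))
  have hδ : 0 < δ := by positivity
  have hcompact : IsCompact {z : ℝ × ℝ | z.1 ∈ Icc 0 (2 * Real.pi) ∧
      z.2 ∈ Icc (-Real.pi) Real.pi ∧ δ ≤ |z.2|} := by
    refine ((isCompact_Icc (a := (0 : ℝ)) (b := 2 * Real.pi)).prod
      (isCompact_Icc (a := -Real.pi) (b := Real.pi))).of_isClosed_subset ?_
      fun z hz => ⟨hz.1, hz.2.1⟩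
    refine (isClosed_Icc.preimage continuous_fst).inter ((isClosed_Icc.preimage
      continuous_snd).inter (isClosed_le continuous_const (continuous_abs.comp continuous_snd)))
  obtain ⟨e, he, hb⟩ := hcompact.exists_forall_le' (f := fun z => ‖γ (z.1 + z.2) - γ z.1‖)
    (Continuous.continuousOn (by
      have := h.continuous
      fun_prop)) (a := 0) (by
    rintro ⟨t, r⟩ ⟨-, hr, hr'⟩
    refine norm_pos_iff.2 (sub_ne_zero.2 fun e => ?_)
    have := h.eq_of_eq e (by
      simp only [add_sub_cancel_left]
      exact (abs_le.2 hr).trans_lt (by linarith [Real.pi_pos]))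
    simp only [add_eq_left] at this
    rw [this, abs_zero] at hr'
    exact hδ.not_ge hr')
  refine ⟨min (m / 2) (e / Real.pi), by positivity, fun t s hts => ?_⟩
  rcases le_or_gt δ |s - t| with hd | hd
  -- Both parameters are shifted by the same multiple of the period, which preserves their
  -- difference and brings the pair into the compact set.
  · obtain ⟨t', ht', ett⟩ := h.periodic.exists_mem_Ico₀ Real.two_pi_pos t
    obtain ⟨n, hn⟩ := h.eq_add_of_eq ett
    have ess : γ s = γ (t' + (s - t)) := calc
      γ s = γ (t' + (s - t) + n • (2 * Real.pi)) := by
        congr 1; rw [zsmul_eq_mul]; linarith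
      _ = _ := h.periodic.zsmul n _
    rw [ett, ess]
    have := hb (t', s - t) ⟨⟨ht'.1, ht'.2.le⟩, abs_le.1 hts, hd⟩
    refine le_trans ?_ this
    calc min (m / 2) (e / Real.pi) * |s - t| ≤ e / Real.pi * Real.pi := by
          gcongr
          exact min_le_right _ _
      _ = e := div_mul_cancel₀ _ Real.pi_ne_zero
  · have h1 := hT t s
    have h2 : ‖(s - t) • deriv γ t‖ ≤ ‖γ s - γ t‖ + ‖γ s - γ t - (s - t) • deriv γ t‖ := by
      have := norm_sub_le (γ s - γ t) (γ s - γ t - (s - t) • deriv γ t)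
      simpa using this
    rw [norm_smul, Real.norm_eq_abs] at h2
    have h3 : |s - t| * m ≤ |s - t| * ‖deriv γ t‖ := by gcongr; exact (hmL t).1
    have h4 : K * (s - t) ^ 2 ≤ m / 2 * |s - t| := by
      rw [← sq_abs, sq, ← mul_assoc]
      gcongr
      calc K * |s - t| ≤ (K + 1) * δ := by gcongr; linarith
        _ = m / 2 := by simp only [δ]; field_simp
    calc min (m / 2) (e / Real.pi) * |s - t| ≤ m / 2 * |s - t| := by
          gcongr; exact min_le_left _ _
      _ ≤ _ := by linarith

/-- The distance to a base point increases along the curve near that point. -/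
theorem exists_strictMonoOn {γ : ℝ → Plane} (h : ContDiff ℝ 1 γ) (t₀ : ℝ)
    (hreg : deriv γ t₀ ≠ 0) :
    ∃ δ, 0 < δ ∧ StrictMonoOn (fun r => ‖γ (t₀ + r) - γ t₀‖) (Icc 0 δ) := by
  have hd : ∀ t, HasDerivAt γ (deriv γ t) t := fun t =>
    (h.differentiable one_ne_zero t).hasDerivAt
  have hdc : ∀ i t, HasDerivAt (fun s => γ s i) (deriv γ t i) t := fun i t =>
    (hasFDerivAt_coord i (γ t)).comp_hasDerivAt t (hd t)
  have hcont : Continuous (deriv γ) := h.continuous_deriv le_rfl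
  set f : ℝ → ℝ := fun r => nsq (γ (t₀ + r) - γ t₀)
  set f' : ℝ → ℝ := fun r => ∑ i, 2 * (γ (t₀ + r) i - γ t₀ i) * deriv γ (t₀ + r) i
  have hf : ∀ r, HasDerivAt f (f' r) r := by
    intro r
    have hc : ∀ i, HasDerivAt (fun r => γ (t₀ + r) i - γ t₀ i) (deriv γ (t₀ + r) i) r := fun i =>
      ((hdc i (t₀ + r)).comp_const_add t₀ r).sub_const _
    have := ((hc 0).pow 2).add ((hc 1).pow 2)
    simp only [f, f', nsq, Fin.sum_univ_two]
    convert! this using 1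
    simp
  -- The derivative of the squared distance, divided by `r`, tends to `2 |γ'(t₀)|² > 0`, so it is
  -- positive for small `r > 0`.
  have hlim : Tendsto (fun r => ∑ i, 2 * (r⁻¹ * (γ (t₀ + r) i - γ t₀ i)) * deriv γ (t₀ + r) i)
      (𝓝[>] 0) (𝓝 (∑ i, 2 * deriv γ t₀ i * deriv γ t₀ i)) := by
    refine tendsto_finsetSum _ fun i _ => ?_
    have h1 : Tendsto (fun r => r⁻¹ * (γ (t₀ + r) i - γ t₀ i)) (𝓝[>] 0) (𝓝 (deriv γ t₀ i)) := by
      have := (hasDerivAt_iff_tendsto_slope_zero.1 (hdc i t₀)).mono_left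
        (nhdsGT_le_nhdsNE 0)
      simpa using this
    have h2 : Tendsto (fun r => deriv γ (t₀ + r) i) (𝓝[>] 0) (𝓝 (deriv γ t₀ i)) := by
      have : Continuous fun r => deriv γ (t₀ + r) i := by fun_prop
      have := this.tendsto 0
      rw [add_zero] at this
      exact this.mono_left nhdsWithin_le_nhds
    exact (h1.const_mul 2).mul h2
  have hpos : 0 < ∑ i, 2 * deriv γ t₀ i * deriv γ t₀ i := by
    have := nsq_pos hreg
    rw [nsq] at this
    rw [Fin.sum_univ_two]
    nlinarith
  obtain ⟨δ, hδ, hδ'⟩ := mem_nhdsGT_iff_exists_Ioo_subset.1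
    (hlim.eventually (lt_mem_nhds hpos))
  have hδ0 : (0 : ℝ) < δ := hδ
  refine ⟨δ / 2, by positivity, ?_⟩
  have hmono : StrictMonoOn f (Icc 0 (δ / 2)) := by
    refine strictMonoOn_of_deriv_pos (convex_Icc _ _)
      (fun r _ => (hf r).continuousAt.continuousWithinAt) fun r hr => ?_
    rw [interior_Icc] at hr
    have h1 := hδ' ⟨hr.1, by linarith [hr.2]⟩
    simp only [mem_ofPred_eq] at h1
    rw [(hf r).deriv]
    have : f' r = r * ∑ i, 2 * (r⁻¹ * (γ (t₀ + r) i - γ t₀ i)) * deriv γ (t₀ + r) i := by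
      have := hr.1.ne'
      simp only [f', Fin.sum_univ_two]
      field_simp
    rw [this]
    exact mul_pos hr.1 h1
  intro a ha b hb hab
  have := hmono ha hb hab
  simp only [f, nsq_eq_norm_sq] at this
  exact lt_of_pow_lt_pow_left₀ 2 (norm_nonneg _) this

end IsClosedCurve

end

end Poro

namespace Poro

noncomputable section

open Filter Topology Set MeasureTheory

/-! ### Weakly singular integrals over a closed curve -/

theorem intervalIntegrable_abs_sub_rpow (t₀ a : ℝ) (ha : 0 ≤ a) :
    IntervalIntegrable (fun s => |s - t₀| ^ (-(1 / 2) : ℝ)) volume (t₀ - a) (t₀ + a) := by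
  have h0 : IntervalIntegrable (fun s : ℝ => s ^ (-(1 / 2) : ℝ)) volume 0 a :=
    intervalIntegral.intervalIntegrable_rpow' (by norm_num)
  have h1 := h0.comp_sub_right t₀
  have h2 := (h0.comp_sub_left t₀).symm
  rw [zero_add, add_comm] at h1
  rw [sub_zero] at h2
  refine IntervalIntegrable.trans (b := t₀) (h2.congr fun s hs => ?_) (h1.congr fun s hs => ?_)
  · rw [uIoc_of_le (by linarith)] at hs
    rw [abs_of_nonpos (by linarith [hs.2]), neg_sub]
  · rw [uIoc_of_le (by linarith)] at hs
    rw [abs_of_nonneg (by linarith [hs.1])]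

/-- The parameters of the points of a curve at distance more than `ε` from `x`. -/
def outsideCurve (γ : ℝ → Plane) (x : Plane) (ε : ℝ) : Set ℝ := {t | ε < dist x (γ t)}

theorem tendsto_setIntegral_outsideCurve {γ : ℝ → Plane} (hγ : Continuous γ) (x : Plane)
    (hne : ∀ᵐ s, γ s ≠ x) {f : ℝ → ℂ} {S : Set ℝ} (hf : IntegrableOn f S) :
    Tendsto (fun ε => ∫ t in S ∩ outsideCurve γ x ε, f t) (𝓝[>] 0) (𝓝 (∫ t in S, f t)) := by
  have hm : ∀ ε, MeasurableSet (outsideCurve γ x ε) := fun ε =>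
    (isOpen_lt continuous_const (continuous_const.dist hγ)).measurableSet
  have e : ∀ ε, ∫ t in S ∩ outsideCurve γ x ε, f t =
      ∫ t in S, (outsideCurve γ x ε).indicator f t := fun ε =>
    (setIntegral_indicator (hm ε)).symm
  simp only [e]
  refine tendsto_integral_filter_of_dominated_convergence (fun t => ‖f t‖)
    (Eventually.of_forall fun ε => hf.aestronglyMeasurable.indicator (hm ε))
    (Eventually.of_forall fun ε => Eventually.of_forall fun t => norm_indicator_le_norm_self _ _)
    hf.norm ?_
  filter_upwards [ae_restrict_of_ae hne] with s hs
  have hd : 0 < dist x (γ s) := dist_pos.2 hs.symm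
  refine tendsto_const_nhds.congr' ?_
  filter_upwards [nhdsWithin_le_nhds (gt_mem_nhds hd)] with ε hε
  exact (indicator_of_mem (show s ∈ outsideCurve γ x ε from hε) f).symm

namespace IsClosedCurve

variable {γ : ℝ → Plane}

theorem ae_ne (h : IsClosedCurve γ) (x : Plane) : ∀ᵐ s, γ s ≠ x := by
  by_cases hx : ∃ t₀, γ t₀ = x
  · obtain ⟨t₀, rfl⟩ := hx
    have hc : (range fun n : ℤ => t₀ + n * (2 * Real.pi)).Countable := countable_range _
    have := measure_eq_zero_iff_ae_notMem.1 (hc.measure_zero volume)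
    filter_upwards [this] with s hs e
    obtain ⟨n, hn⟩ := h.eq_add_of_eq e
    exact hs ⟨n, hn.symm⟩
  · push Not at hx
    exact Eventually.of_forall hx

theorem exists_dist_lower (h : IsClosedCurve γ) {x : Plane} (hx : ∀ t, γ t ≠ x) :
    ∃ d, 0 < d ∧ ∀ t, d ≤ ‖x - γ t‖ := by
  obtain ⟨d, hd, hb⟩ := (isCompact_Icc (a := (0 : ℝ)) (b := 2 * Real.pi)).exists_forall_le'
    (f := fun t => ‖x - γ t‖) (continuous_const.sub h.continuous).norm.continuousOn (a := 0)
    fun t _ => norm_pos_iff.2 (sub_ne_zero.2 (hx t).symm)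
  refine ⟨d, hd, fun t => ?_⟩
  obtain ⟨s, hs, e⟩ := h.periodic.exists_mem_Ico₀ Real.two_pi_pos t
  rw [e]
  exact hb s ⟨hs.1, hs.2.le⟩

/-- If `x` lies on the curve, the chord-arc bound compares the integrand with `|s - t₀|^(-1/2)` on
the period centred at `t₀`; otherwise the integrand is bounded. -/
theorem integrableOn_rpow (h : IsClosedCurve γ) (x : Plane) :
    IntegrableOn (fun s => ‖x - γ s‖ ^ (-(1 / 2) : ℝ)) (Ioc 0 (2 * Real.pi)) := by
  have hγ := h.continuous
  have hm : Measurable fun s => ‖x - γ s‖ ^ (-(1 / 2) : ℝ) := by fun_prop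
  by_cases hx : ∃ t₀, γ t₀ = x
  · obtain ⟨t₀, rfl⟩ := hx
    obtain ⟨m, hm0, hmb⟩ := h.exists_chord_arc
    have hper : Function.Periodic (fun s => ‖γ t₀ - γ s‖ ^ (-(1 / 2) : ℝ)) (2 * Real.pi) :=
      fun s => by simp only [h.periodic s]
    have h1 : IntervalIntegrable (fun s => ‖γ t₀ - γ s‖ ^ (-(1 / 2) : ℝ)) volume
        (t₀ - Real.pi) (t₀ - Real.pi + 2 * Real.pi) := by
      rw [show t₀ - Real.pi + 2 * Real.pi = t₀ + Real.pi by ring]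
      refine ((intervalIntegrable_abs_sub_rpow t₀ Real.pi Real.pi_pos.le).const_mul
        (m ^ (-(1 / 2) : ℝ))).mono_fun' hm.aestronglyMeasurable ?_
      refine (ae_restrict_iff' measurableSet_uIoc).2 ?_
      filter_upwards [h.ae_ne (γ t₀)] with s hs hs'
      rw [uIoc_of_le (by linarith [Real.pi_pos])] at hs'
      have h2 := hmb t₀ s (abs_le.2 ⟨by linarith [hs'.1], by linarith [hs'.2]⟩)
      have h3 : 0 < |s - t₀| := abs_pos.2 (sub_ne_zero.2 fun e => hs (by rw [e]))
      rw [Real.norm_of_nonneg (by positivity), ← Real.mul_rpow hm0.le h3.le, norm_sub_rev]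
      exact Real.rpow_le_rpow_of_nonpos (by positivity) h2 (by norm_num)
    exact (intervalIntegrable_iff_integrableOn_Ioc_of_le Real.two_pi_pos.le).1
      (hper.intervalIntegrable Real.two_pi_pos.ne' h1 0 (2 * Real.pi))
  · push Not at hx
    obtain ⟨d, hd, hb⟩ := h.exists_dist_lower hx
    refine Measure.integrableOn_of_bounded (M := d ^ (-(1 / 2) : ℝ)) measure_Ioc_lt_top.ne
      hm.aestronglyMeasurable (Eventually.of_forall fun s => ?_)
    rw [Real.norm_of_nonneg (by positivity)]
    exact Real.rpow_le_rpow_of_nonpos hd (hb s) (by norm_num)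

theorem aestronglyMeasurable (h : IsClosedCurve γ) (x : Plane) {f : ℝ → ℂ}
    (hf : ContinuousOn f {s | γ s ≠ x}) : AEStronglyMeasurable f volume := by
  have ho : IsOpen {s | γ s ≠ x} := isOpen_ne_fun h.continuous continuous_const
  have := hf.aestronglyMeasurable (μ := volume) ho.measurableSet
  rwa [Measure.restrict_eq_self_of_ae_mem (s := {s | γ s ≠ x}) (h.ae_ne x)] at this

theorem integrableOn_of_bound (h : IsClosedCurve γ) (x : Plane) {f : ℝ → ℂ}
    (hf : ContinuousOn f {s | γ s ≠ x}) {C : ℝ}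
    (hb : ∀ s, γ s ≠ x → ‖f s‖ ≤ C * ‖x - γ s‖ ^ (-(1 / 2) : ℝ)) :
    IntegrableOn f (Ioc 0 (2 * Real.pi)) := by
  refine Integrable.mono' ((h.integrableOn_rpow x).const_mul C)
    (h.aestronglyMeasurable x hf).restrict ?_
  filter_upwards [ae_restrict_of_ae (h.ae_ne x)] with s hs using hb s hs

/-! ### The arc outside a small disc -/

/-- The distance to `γ t₀` increases strictly on either side of `t₀` and stays above a positive `e`
on the remaining arc. For `ε < e` each side thus crosses the circle of radius `ε` exactly once, and
the outside set is a single arc. -/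
theorem exists_outside_arc (h : IsClosedCurve γ) (t₀ : ℝ) :
    ∃ e, 0 < e ∧ ∀ ε, 0 < ε → ε < e → ∃ r r', 0 < r ∧ r ≤ Real.pi ∧ 0 < r' ∧ r' ≤ Real.pi ∧
      r ≤ 2 * Real.pi - r' ∧
      ‖γ (t₀ + r) - γ t₀‖ = ε ∧ ‖γ (t₀ - r') - γ t₀‖ = ε ∧
      Ioc t₀ (t₀ + 2 * Real.pi) ∩ outsideCurve γ (γ t₀) ε =
        Ioo (t₀ + r) (t₀ + (2 * Real.pi - r')) := by
  have hπ := Real.pi_pos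
  obtain ⟨δ₁, hδ₁, hm₁⟩ := exists_strictMonoOn (h.smooth.of_le one_le_two) t₀ (h.regular t₀)
  -- The left side of `t₀` is the right side for the reversed curve.
  obtain ⟨δ₂, hδ₂, hm₂⟩ := exists_strictMonoOn (γ := fun s => γ (-s))
    ((h.smooth.of_le one_le_two).comp contDiff_neg) (-t₀) (by
      rw [deriv_comp_neg, neg_neg]
      exact neg_ne_zero.2 (h.regular t₀))
  set δ := min (min δ₁ δ₂) (Real.pi / 2)
  have hδ : 0 < δ := by positivity
  have hδπ : δ ≤ Real.pi / 2 := min_le_right _ _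
  have hδ1 : δ ≤ δ₁ := (min_le_left _ _).trans (min_le_left _ _)
  have hδ2 : δ ≤ δ₂ := (min_le_left _ _).trans (min_le_right _ _)
  have hm1 : StrictMonoOn (fun r => ‖γ (t₀ + r) - γ t₀‖) (Icc 0 δ) :=
    hm₁.mono (Icc_subset_Icc le_rfl hδ1)
  have hm2 : StrictMonoOn (fun r => ‖γ (t₀ - r) - γ t₀‖) (Icc 0 δ) := by
    refine (hm₂.mono (Icc_subset_Icc le_rfl hδ2)).congr fun r _ => ?_
    simp only [neg_add, neg_neg, sub_eq_add_neg]
  have hγ := h.continuous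
  obtain ⟨e, he, heb⟩ := (isCompact_Icc (a := t₀ + δ)
    (b := t₀ + (2 * Real.pi - δ))).exists_forall_le' (f := fun s => ‖γ s - γ t₀‖)
    (by fun_prop) (a := 0) (fun s hs => norm_pos_iff.2 (sub_ne_zero.2 fun e => by
      have := h.eq_of_eq e (abs_lt.2 ⟨by linarith [hs.1], by linarith [hs.2]⟩)
      linarith [hs.1]))
  refine ⟨e, he, fun ε hε hεe => ?_⟩
  have hper : ∀ r, γ (t₀ + (2 * Real.pi - r)) = γ (t₀ - r) := fun r => by
    rw [show t₀ + (2 * Real.pi - r) = t₀ - r + 2 * Real.pi by ring, h.periodic]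
  have ivt : ∀ f : ℝ → ℝ, Continuous f → f 0 = 0 → e ≤ f δ → ∃ r ∈ Icc 0 δ, f r = ε := by
    intro f hf h0 hfd
    exact intermediate_value_Icc hδ.le hf.continuousOn
      ⟨by rw [h0]; exact hε.le, hεe.le.trans hfd⟩
  obtain ⟨r, hr, hre⟩ := ivt (fun r => ‖γ (t₀ + r) - γ t₀‖) (by fun_prop) (by simp)
    (heb _ ⟨le_rfl, by linarith⟩)
  obtain ⟨r', hr', hre'⟩ := ivt (fun r => ‖γ (t₀ - r) - γ t₀‖) (by fun_prop) (by simp)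
    (by rw [← hper]; exact heb _ ⟨by linarith, le_rfl⟩)
  have hr0 : 0 < r := lt_of_le_of_ne hr.1 (by rintro rfl; simp at hre; exact hε.ne hre)
  have hr0' : 0 < r' := lt_of_le_of_ne hr'.1 (by rintro rfl; simp at hre'; exact hε.ne hre')
  refine ⟨r, r', hr0, by linarith [hr.2], hr0', by linarith [hr'.2], by linarith [hr.2, hr'.2],
    hre, hre', ?_⟩
  ext s
  simp only [mem_inter_iff, mem_Ioc, mem_Ioo, outsideCurve, mem_ofPred_eq, dist_comm (γ t₀),
    dist_eq_norm]
  rcases le_or_gt s t₀ with hs0 | hs0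
  · exact ⟨fun hs => absurd hs.1.1 hs0.not_gt, fun hs => by linarith [hs.1]⟩
  rcases lt_or_ge (t₀ + 2 * Real.pi) s with hs1 | hs1
  · exact ⟨fun hs => absurd hs.1.2 hs1.not_ge, fun hs => by linarith [hs.2]⟩
  rcases le_or_gt s (t₀ + δ) with hs2 | hs2
  · have := hm1.lt_iff_lt hr (show s - t₀ ∈ Icc 0 δ from ⟨by linarith, by linarith⟩)
    simp only [hre, add_sub_cancel] at this
    rw [this]
    exact ⟨fun hs => ⟨by linarith [hs.2], by linarith [hr'.2]⟩,
      fun hs => ⟨⟨hs0, hs1⟩, by linarith [hs.1]⟩⟩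
  rcases le_or_gt (t₀ + (2 * Real.pi - δ)) s with hs3 | hs3
  · have := hm2.lt_iff_lt hr' (show t₀ + 2 * Real.pi - s ∈ Icc 0 δ from
      ⟨by linarith, by linarith⟩)
    simp only [hre'] at this
    rw [← hper, show t₀ + (2 * Real.pi - (t₀ + 2 * Real.pi - s)) = s by ring] at this
    rw [this]
    exact ⟨fun hs => ⟨by linarith [hr.2], by linarith [hs.2]⟩,
      fun hs => ⟨⟨hs0, hs1⟩, by linarith [hs.2]⟩⟩
  · have := heb s ⟨hs2.le, hs3.le⟩
    exact ⟨fun _ => ⟨by linarith [hr.2], by linarith [hr'.2]⟩,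
      fun _ => ⟨⟨hs0, hs1⟩, by linarith⟩⟩

/-- Integration by parts over the part of a closed curve outside a small disc: the boundary
terms vanish in the limit. -/
theorem tendsto_by_parts (h : IsClosedCurve γ) (x : Plane) {φ φ' V V' : ℝ → ℂ}
    (hφ : ∀ s, γ s ≠ x → HasDerivAt φ (φ' s) s) (hφc : ContinuousOn φ' {s | γ s ≠ x})
    (hφp : Function.Periodic φ (2 * Real.pi)) (hφp' : Function.Periodic φ' (2 * Real.pi))
    (hV : ∀ s, HasDerivAt V (V' s) s) (hVc : Continuous V')
    (hVp : Function.Periodic V (2 * Real.pi)) {C : ℝ} (hC : 0 ≤ C)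
    (hb : ∀ s, γ s ≠ x → ‖φ s‖ ≤ C * ‖x - γ s‖ ^ (-(1 / 2) : ℝ))
    (hsym : ∀ s s', γ s ≠ x → ‖x - γ s‖ = ‖x - γ s'‖ →
      ‖φ s - φ s'‖ ≤ C * (‖(x - γ s) + (x - γ s')‖ / ‖x - γ s‖)) :
    Tendsto (fun ε => ∫ t in Ioc 0 (2 * Real.pi) ∩ outsideCurve γ x ε, φ' t * V t) (𝓝[>] 0)
      (𝓝 (-∫ t in Ioc 0 (2 * Real.pi), φ t * V' t)) := by
  have hπ := Real.pi_pos
  have hVcont : Continuous V := continuous_iff_continuousAt.2 fun s => (hV s).continuousAt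
  have hVp' : Function.Periodic V' (2 * Real.pi) := by
    have : deriv V = V' := funext fun s => (hV s).deriv
    rw [← this]; exact periodic_deriv hVp
  obtain ⟨A, hA, hAb⟩ := periodic_norm_bound hVp hVcont
  obtain ⟨B, hB, hBb⟩ := periodic_norm_bound hVp' hVc
  have hφcont : ContinuousOn φ {s | γ s ≠ x} := fun s hs =>
    (hφ s hs).continuousAt.continuousWithinAt
  have hint : IntegrableOn (fun t => φ t * V' t) (Ioc 0 (2 * Real.pi)) := by
    refine h.integrableOn_of_bound x (hφcont.mul hVc.continuousOn) (C := C * B) fun s hs => ?_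
    rw [norm_mul, mul_right_comm]
    exact mul_le_mul (hb s hs) (hBb s) (norm_nonneg _) (by positivity)
  have hlim := tendsto_setIntegral_outsideCurve h.continuous x (h.ae_ne x) hint
  have hparts : ∀ a b, a ≤ b → (∀ s ∈ Icc a b, γ s ≠ x) →
      ∫ t in a..b, φ' t * V t = φ b * V b - φ a * V a - ∫ t in a..b, φ t * V' t := by
    intro a b hab hne
    have hu : uIcc a b ⊆ {s | γ s ≠ x} := by rw [uIcc_of_le hab]; exact hne
    have := intervalIntegral.integral_mul_deriv_eq_deriv_mul (a := a) (b := b)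
      (u := V) (u' := V') (v := φ) (v' := φ') (fun s _ => hV s) (fun s hs => hφ s (hu hs))
      (hVc.intervalIntegrable _ _) (hφc.mono hu).intervalIntegrable
    simp only [mul_comm (φ' _), mul_comm (φ _)]
    exact this
  -- The sum of the two truncated integrals is exactly the boundary term, and the second integral
  -- converges by dominated convergence.
  suffices hz : Tendsto (fun ε => (∫ t in Ioc 0 (2 * Real.pi) ∩ outsideCurve γ x ε, φ' t * V t) +
      ∫ t in Ioc 0 (2 * Real.pi) ∩ outsideCurve γ x ε, φ t * V' t) (𝓝[>] 0) (𝓝 0) by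
    have := hz.sub hlim
    rw [zero_sub] at this
    exact this.congr fun ε => by ring
  by_cases hx : ∃ t₀, γ t₀ = x
  · obtain ⟨t₀, rfl⟩ := hx
    obtain ⟨e, he, harc⟩ := h.exists_outside_arc t₀
    obtain ⟨m, hm, hchord⟩ := h.exists_chord_arc
    obtain ⟨K, hK, hT⟩ := h.exists_taylor
    -- The majorant of the boundary term: first the jump of `φ` times `V`, then `φ = O(ε^(-1/2))`
    -- times the jump of `V`, which is `O(ε)`.
    have hlimit : Tendsto (fun ε : ℝ => C * (4 * K / m ^ 2 * ε) * A +
        C * ε ^ (1 / 2 : ℝ) * (B * (2 / m))) (𝓝[>] 0) (𝓝 0) := by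
      have h1 : Continuous fun ε : ℝ => C * (4 * K / m ^ 2 * ε) * A +
        C * ε ^ (1 / 2 : ℝ) * (B * (2 / m)) := by
        have : Continuous fun ε : ℝ => ε ^ (1 / 2 : ℝ) :=
          continuous_id.rpow_const fun _ => Or.inr (by norm_num)
        fun_prop
      have := h1.tendsto 0
      simp only [mul_zero, zero_mul, zero_add] at this
      rw [Real.zero_rpow (by norm_num), mul_zero, zero_mul] at this
      exact this.mono_left nhdsWithin_le_nhds
    refine squeeze_zero_norm' ?_ hlimit
    filter_upwards [self_mem_nhdsWithin, nhdsWithin_le_nhds (gt_mem_nhds he)] with ε hε hεe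
    have hε0 : (0 : ℝ) < ε := hε
    obtain ⟨r, r', hr, hrπ, hr', hrπ', hrr, hre, hre', hset⟩ := harc ε hε hεe
    have hmo : MeasurableSet (outsideCurve γ (γ t₀) ε) :=
      (isOpen_lt continuous_const (continuous_const.dist h.continuous)).measurableSet
    have hshift : ∀ f : ℝ → ℂ, Function.Periodic f (2 * Real.pi) →
        ∫ t in Ioc 0 (2 * Real.pi) ∩ outsideCurve γ (γ t₀) ε, f t =
          ∫ t in (t₀ + r)..(t₀ + (2 * Real.pi - r')), f t := by
      intro f hf
      have hgp : Function.Periodic ((outsideCurve γ (γ t₀) ε).indicator f) (2 * Real.pi) := by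
        intro s
        have : s + 2 * Real.pi ∈ outsideCurve γ (γ t₀) ε ↔ s ∈ outsideCurve γ (γ t₀) ε := by
          simp only [outsideCurve, mem_ofPred_eq, h.periodic s]
        by_cases hs : s ∈ outsideCurve γ (γ t₀) ε
        · rw [indicator_of_mem hs, indicator_of_mem (this.2 hs), hf]
        · rw [indicator_of_notMem hs, indicator_of_notMem (mt this.1 hs)]
      rw [← setIntegral_indicator hmo,
        ← intervalIntegral.integral_of_le Real.two_pi_pos.le]
      have := hgp.intervalIntegral_add_eq 0 t₀
      rw [zero_add] at this
      rw [this, intervalIntegral.integral_of_le (by linarith), setIntegral_indicator hmo, hset,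
        ← integral_Ioc_eq_integral_Ioo, intervalIntegral.integral_of_le (by linarith)]
    rw [hshift (fun t => φ' t * V t) (hφp'.mul hVp), hshift (fun t => φ t * V' t) (hφp.mul hVp'),
      hparts _ _ (by linarith)
      (fun s hs e => by
        have := h.eq_of_eq e (abs_lt.2 ⟨by linarith [hs.1], by linarith [hs.2]⟩)
        linarith [hs.1])]
    rw [sub_add_cancel]
    have hb1 : t₀ + (2 * Real.pi - r') = t₀ - r' + 2 * Real.pi := by ring
    rw [hb1, hφp, hVp]
    have hw : ‖γ t₀ - γ (t₀ + r)‖ = ε := by rw [norm_sub_rev, hre]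
    have hw' : ‖γ t₀ - γ (t₀ - r')‖ = ε := by rw [norm_sub_rev, hre']
    have hne : γ (t₀ + r) ≠ γ t₀ := fun e => by rw [e, sub_self, norm_zero] at hw; exact hε0.ne hw
    have hmr : r ≤ ε / m := by
      rw [le_div_iff₀ hm, mul_comm]
      have := hchord t₀ (t₀ + r) (by rw [add_sub_cancel_left, abs_of_pos hr]; exact hrπ)
      rwa [add_sub_cancel_left, abs_of_pos hr, hre] at this
    have hmr' : r' ≤ ε / m := by
      rw [le_div_iff₀ hm, mul_comm]
      have := hchord t₀ (t₀ - r') (by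
        rw [sub_sub_cancel_left, abs_neg, abs_of_pos hr']; exact hrπ')
      rwa [sub_sub_cancel_left, abs_neg, abs_of_pos hr', hre'] at this
    -- Both chords have length `ε`, so Taylor's formula gives `r |v|` and `r' |v|` equal to `ε` up
    -- to second order. Hence `(r - r') v` is of second order, and so is the sum of the chords; each
    -- of the four remainders is at most `K (ε / m)²`.
    have hsum : ‖(γ t₀ - γ (t₀ + r)) + (γ t₀ - γ (t₀ - r'))‖ ≤ 4 * K / m ^ 2 * ε ^ 2 := by
      have t1 := hT t₀ (t₀ + r)
      have t2 := hT t₀ (t₀ - r')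
      rw [add_sub_cancel_left] at t1
      rw [sub_sub_cancel_left, neg_smul, neg_sq, sub_neg_eq_add] at t2
      set p := γ (t₀ + r) - γ t₀
      set p' := γ (t₀ - r') - γ t₀
      set v := deriv γ t₀
      have q1 : |ε - r * ‖v‖| ≤ K * r ^ 2 := by
        have := abs_norm_sub_norm_le p (r • v)
        rw [norm_smul, Real.norm_of_nonneg hr.le, hre] at this
        exact this.trans t1
      have q2 : |ε - r' * ‖v‖| ≤ K * r' ^ 2 := by
        have := abs_norm_sub_norm_le p' (-(r' • v))
        rw [norm_neg, norm_smul, Real.norm_of_nonneg hr'.le, hre', sub_neg_eq_add] at this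
        exact this.trans t2
      have q3 : |r - r'| * ‖v‖ ≤ K * r ^ 2 + K * r' ^ 2 := by
        rw [← abs_of_nonneg (norm_nonneg v), ← abs_mul]
        rw [abs_le] at *
        constructor <;> nlinarith [q1.1, q1.2, q2.1, q2.2]
      have q4 : (γ t₀ - γ (t₀ + r)) + (γ t₀ - γ (t₀ - r')) =
          -((p - r • v) + (p' + r' • v) + (r - r') • v) := by
        simp only [p, p', sub_smul]; abel
      rw [q4, norm_neg]
      have q5 : ‖(r - r') • v‖ = |r - r'| * ‖v‖ := by rw [norm_smul, Real.norm_eq_abs]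
      have q6 := norm_add₃_le (a := p - r • v) (b := p' + r' • v) (c := (r - r') • v)
      have q7 : K * r ^ 2 ≤ K * (ε / m) ^ 2 := by gcongr
      have q8 : K * r' ^ 2 ≤ K * (ε / m) ^ 2 := by gcongr
      have q9 : 4 * K / m ^ 2 * ε ^ 2 = 4 * (K * (ε / m) ^ 2) := by field_simp
      rw [q9]
      linarith
    have hVdiff : ‖V (t₀ - r') - V (t₀ + r)‖ ≤ B * (2 / m) * ε := by
      have := convex_univ.norm_image_sub_le_of_norm_hasDerivWithin_le (f := V) (f' := V')
        (fun s _ => (hV s).hasDerivWithinAt) (fun s _ => hBb s) (mem_univ (t₀ + r))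
        (mem_univ (t₀ - r'))
      refine this.trans ?_
      rw [mul_assoc]
      gcongr
      rw [Real.norm_eq_abs, abs_le]
      have e1 : 2 / m * ε = ε / m + ε / m := by ring
      constructor <;> linarith
    have hs1 := hsym (t₀ + r) (t₀ - r') hne (by rw [hw, hw'])
    have hb2 := hb (t₀ + r) hne
    rw [hw] at hs1 hb2
    have hdec : φ (t₀ - r') * V (t₀ - r') - φ (t₀ + r) * V (t₀ + r) =
        -(φ (t₀ + r) - φ (t₀ - r')) * V (t₀ - r') + φ (t₀ + r) * (V (t₀ - r') - V (t₀ + r)) := by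
      ring
    rw [hdec]
    refine (norm_add_le _ _).trans (add_le_add ?_ ?_)
    · rw [norm_mul, norm_neg]
      refine mul_le_mul (hs1.trans ?_) (hAb _) (norm_nonneg _) (by positivity)
      gcongr
      rw [div_le_iff₀ hε0]
      refine hsum.trans (le_of_eq (by ring))
    · rw [norm_mul]
      refine (mul_le_mul hb2 hVdiff (norm_nonneg _) (by positivity)).trans (le_of_eq ?_)
      have : ε ^ (-(1 / 2) : ℝ) * ε = ε ^ (1 / 2 : ℝ) := by
        rw [← Real.rpow_add_one hε0.ne']; norm_num
      linear_combination C * (B * (2 / m)) * this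
  · push Not at hx
    obtain ⟨d, hd, hdb⟩ := h.exists_dist_lower hx
    -- For `x` off the curve the truncation is eventually void, and the boundary term over a full
    -- period vanishes by periodicity.
    refine tendsto_const_nhds.congr' ?_
    filter_upwards [nhdsWithin_le_nhds (gt_mem_nhds hd)] with ε hε
    have : Ioc 0 (2 * Real.pi) ∩ outsideCurve γ x ε = Ioc 0 (2 * Real.pi) :=
      inter_eq_left.2 fun s _ => by
        simp only [outsideCurve, mem_ofPred_eq, dist_eq_norm]
        exact lt_of_lt_of_le hε (hdb s)
    rw [this, ← intervalIntegral.integral_of_le Real.two_pi_pos.le,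
      ← intervalIntegral.integral_of_le Real.two_pi_pos.le,
      hparts _ _ Real.two_pi_pos.le fun s _ => hx s]
    have e1 := hφp 0
    have e2 := hVp 0
    rw [zero_add] at e1 e2
    rw [e1, e2]
    ring

end IsClosedCurve

end

end Poro

namespace Poro

noncomputable section

open Filter Topology Set MeasureTheory

/-! ### Differentiation of weakly singular integrals -/

theorem norm_gradL_le (g : Fin 2 → ℂ) {C : ℝ} (hg : ∀ i, ‖g i‖ ≤ C) : ‖gradL g‖ ≤ 2 * C := by
  have hC : 0 ≤ C := (norm_nonneg _).trans (hg 0)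
  refine ContinuousLinearMap.opNorm_le_bound _ (by positivity) fun v => ?_
  rw [gradL_apply, Fin.sum_univ_two]
  have h : ∀ i, ‖(v i : ℂ) * g i‖ ≤ ‖v‖ * C := fun i => by
    rw [norm_mul, Complex.norm_real]
    exact mul_le_mul (PiLp.norm_apply_le v i) (hg i) (norm_nonneg _) (norm_nonneg _)
  refine (norm_add_le _ _).trans ((add_le_add (h 0) (h 1)).trans (le_of_eq (by ring)))

/-- If `|w - w'| ≤ |w'| / 2`, the segment keeps away from the origin and the mean value inequality
applies; otherwise both values are themselves small compared with `|w - w'|`. The singular weight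
depends on `w'` alone, so it can dominate difference quotients whose other point moves. -/
theorem norm_sub_le_of_singular_grad {k : Plane → ℂ} {g : Plane → Fin 2 → ℂ} {D C : ℝ}
    (hC : 0 ≤ C) (hk : ∀ w, w ≠ 0 → HasGrad k (g w) w)
    (hb : ∀ w, w ≠ 0 → ‖w‖ ≤ D → ‖k w‖ ≤ C * ‖w‖ ^ (1 / 2 : ℝ))
    (hg : ∀ w, w ≠ 0 → ‖w‖ ≤ D → ∀ i, ‖g w i‖ ≤ C * ‖w‖ ^ (-(1 / 2) : ℝ))
    {w w' : Plane} (hw : w ≠ 0) (hw' : w' ≠ 0) (hD : ‖w‖ ≤ D) (hD' : ‖w'‖ ≤ D) :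
    ‖k w - k w'‖ ≤ 8 * C * ‖w - w'‖ * ‖w'‖ ^ (-(1 / 2) : ℝ) := by
  have hρ : 0 < ‖w'‖ := norm_pos_iff.2 hw'
  have hhalf : (‖w'‖ / 2) ^ (-(1 / 2) : ℝ) ≤ 2 * ‖w'‖ ^ (-(1 / 2) : ℝ) := by
    rw [div_eq_mul_inv, Real.mul_rpow hρ.le (by norm_num), mul_comm]
    gcongr
    rw [Real.inv_rpow (by norm_num), ← Real.rpow_neg (by norm_num), neg_neg]
    calc (2 : ℝ) ^ (1 / 2 : ℝ) ≤ 2 ^ (1 : ℝ) :=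
          Real.rpow_le_rpow_of_exponent_le (by norm_num) (by norm_num)
      _ = 2 := Real.rpow_one 2
  rcases le_or_gt ‖w - w'‖ (‖w'‖ / 2) with hd | hd
  · have hseg : ∀ z ∈ segment ℝ w' w, ‖w'‖ / 2 ≤ ‖z‖ ∧ ‖z‖ ≤ D := by
      intro z hz
      refine ⟨?_, ?_⟩
      · have h1 : ‖z - w'‖ ≤ ‖w - w'‖ := by
          have h0 := (convex_closedBall w' ‖w - w'‖).segment_subset
            (Metric.mem_closedBall_self (norm_nonneg _))
            (by rw [Metric.mem_closedBall, dist_eq_norm]) hz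
          rwa [Metric.mem_closedBall, dist_eq_norm] at h0
        have h2 := norm_sub_norm_le w' z
        rw [norm_sub_rev] at h2
        linarith
      · have h0 := (convex_closedBall (0 : Plane) D).segment_subset
          (by simpa using hD') (by simpa using hD) hz
        simpa using h0
    have hne : ∀ z ∈ segment ℝ w' w, z ≠ 0 := fun z hz => by
      rw [← norm_pos_iff]; linarith [(hseg z hz).1]
    have h1 := (convex_segment w' w).norm_image_sub_le_of_norm_hasFDerivWithin_le
      (f := k) (f' := fun z => gradL (g z)) (C := 2 * (C * (2 * ‖w'‖ ^ (-(1 / 2) : ℝ))))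
      (fun z hz => HasFDerivAt.hasFDerivWithinAt (hk z (hne z hz)))
      (fun z hz => norm_gradL_le _ fun i => (hg z (hne z hz) (hseg z hz).2 i).trans (by
        gcongr
        exact (Real.rpow_le_rpow_of_nonpos (by positivity) (hseg z hz).1 (by norm_num)).trans
          hhalf))
      (left_mem_segment ℝ w' w) (right_mem_segment ℝ w' w)
    refine h1.trans ?_
    have : 0 ≤ C * ‖w'‖ ^ (-(1 / 2) : ℝ) * ‖w - w'‖ := by positivity
    nlinarith
  · set d := ‖w - w'‖
    have hd0 : 0 < d := lt_trans (by positivity) hd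
    -- The factor `3` would suffice; `4` has the square root `2`.
    have hw3 : ‖w‖ ≤ 4 * d := by
      have := norm_add_le (w - w') w'
      rw [sub_add_cancel] at this
      linarith
    have hw2 : ‖w'‖ ≤ 4 * d := by linarith
    have h4 : ∀ z : Plane, ‖z‖ ≤ 4 * d → ‖z‖ ^ (1 / 2 : ℝ) ≤ 2 * d ^ (1 / 2 : ℝ) := by
      intro z hz
      calc ‖z‖ ^ (1 / 2 : ℝ) ≤ (4 * d) ^ (1 / 2 : ℝ) :=
            Real.rpow_le_rpow (norm_nonneg _) hz (by norm_num)
        _ = 2 * d ^ (1 / 2 : ℝ) := by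
          rw [Real.mul_rpow (by norm_num) hd0.le]
          congr 1
          rw [show (4 : ℝ) = 2 ^ (2 : ℝ) by norm_num, ← Real.rpow_mul (by norm_num)]
          norm_num
    have h5 : d ^ (1 / 2 : ℝ) ≤ d * (2 * ‖w'‖ ^ (-(1 / 2) : ℝ)) := by
      calc d ^ (1 / 2 : ℝ) = d * d ^ (-(1 / 2) : ℝ) := by
            rw [mul_comm, ← Real.rpow_add_one hd0.ne']; norm_num
        _ ≤ _ := by
          gcongr
          exact (Real.rpow_le_rpow_of_nonpos (by positivity) hd.le (by norm_num)).trans hhalf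
    calc ‖k w - k w'‖ ≤ ‖k w‖ + ‖k w'‖ := norm_sub_le _ _
      _ ≤ C * (2 * d ^ (1 / 2 : ℝ)) + C * (2 * d ^ (1 / 2 : ℝ)) := by
        refine add_le_add ((hb w hw hD).trans ?_) ((hb w' hw' hD').trans ?_)
        · gcongr; exact h4 w hw3
        · gcongr; exact h4 w' hw2
      _ = 4 * C * d ^ (1 / 2 : ℝ) := by ring
      _ ≤ 4 * C * (d * (2 * ‖w'‖ ^ (-(1 / 2) : ℝ))) := by gcongr
      _ = _ := by ring

/-- The singularity of the integrand moves with `t`, so the `t`-derivative need not have an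
integrable bound uniform near `t₀`. Dominated convergence is applied to the difference quotients
instead, with the weight `|η t₀ - γ s|^(-1/2)` frozen at `t₀`. -/
theorem IsClosedCurve.hasDerivAt_integral {γ η : ℝ → Plane} (h : IsClosedCurve γ)
    (hη : IsClosedCurve η) (t₀ : ℝ) {k : Plane → ℂ} {g : Plane → Fin 2 → ℂ} {D C : ℝ}
    (hC : 0 ≤ C) (hD : ∀ t s, ‖η t - γ s‖ ≤ D)
    (hk : ∀ w, w ≠ 0 → HasGrad k (g w) w)
    (hb : ∀ w, w ≠ 0 → ‖w‖ ≤ D → ‖k w‖ ≤ C * ‖w‖ ^ (1 / 2 : ℝ))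
    (hg : ∀ w, w ≠ 0 → ‖w‖ ≤ D → ∀ i, ‖g w i‖ ≤ C * ‖w‖ ^ (-(1 / 2) : ℝ))
    {v : ℝ → ℂ} (hv : Continuous v) {B : ℝ} (hvB : ∀ s, ‖v s‖ ≤ B) :
    HasDerivAt (fun t => ∫ s in Ioc 0 (2 * Real.pi), k (η t - γ s) * v s)
      (∫ s in Ioc 0 (2 * Real.pi), (∑ i, (deriv η t₀ i : ℂ) * g (η t₀ - γ s) i) * v s) t₀ := by
  obtain ⟨_, L, -, hL, hLb⟩ := hη.exists_speed_bounds
  have hlip : ∀ t, ‖η t - η t₀‖ ≤ L * ‖t - t₀‖ := fun t =>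
    convex_univ.norm_image_sub_le_of_norm_hasDerivWithin_le
      (fun s _ => (hη.hasDerivAt s).hasDerivWithinAt) (fun s _ => (hLb s).2) (mem_univ t₀)
      (mem_univ t)
  have hγ := h.continuous
  have hD0 : 0 ≤ D := (norm_nonneg _).trans (hD 0 0)
  have hcont : ∀ x : Plane, ContinuousOn (fun s => k (x - γ s) * v s) {s | γ s ≠ x} := by
    intro x s hs
    have h1 : ContinuousAt k (x - γ s) :=
      (HasFDerivAt.continuousAt (hk _ (sub_ne_zero.2 (Ne.symm hs))))
    have h2 : ContinuousAt (fun s => x - γ s) s := by fun_prop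
    exact ((ContinuousAt.comp (f := fun s => x - γ s) h1 h2).mul
      hv.continuousAt).continuousWithinAt
  have hint : ∀ t, IntegrableOn (fun s => k (η t - γ s) * v s) (Ioc 0 (2 * Real.pi)) := by
    intro t
    refine h.integrableOn_of_bound (η t) (hcont _) (C := C * D * B) fun s hs => ?_
    have hne : η t - γ s ≠ 0 := sub_ne_zero.2 (Ne.symm hs)
    have hpos := norm_pos_iff.2 hne
    have h1 : ‖η t - γ s‖ ^ (1 / 2 : ℝ) ≤ D * ‖η t - γ s‖ ^ (-(1 / 2) : ℝ) := by
      calc ‖η t - γ s‖ ^ (1 / 2 : ℝ) = ‖η t - γ s‖ * ‖η t - γ s‖ ^ (-(1 / 2) : ℝ) := by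
            rw [mul_comm, ← Real.rpow_add_one hpos.ne']; norm_num
        _ ≤ _ := by gcongr; exact hD t s
    rw [norm_mul]
    calc _ ≤ C * (D * ‖η t - γ s‖ ^ (-(1 / 2) : ℝ)) * B :=
          mul_le_mul ((hb _ hne (hD t s)).trans (by gcongr)) (hvB s) (norm_nonneg _)
            (by positivity)
      _ = _ := by ring
  rw [hasDerivAt_iff_tendsto_slope]
  have e : ∀ t, slope (fun t => ∫ s in Ioc 0 (2 * Real.pi), k (η t - γ s) * v s) t₀ t =
      ∫ s in Ioc 0 (2 * Real.pi), slope (fun t => k (η t - γ s) * v s) t₀ t := by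
    intro t
    simp only [slope, vsub_eq_sub]
    rw [integral_smul, integral_sub (hint t) (hint t₀)]
  refine Tendsto.congr (fun t => (e t).symm) ?_
  refine tendsto_integral_filter_of_dominated_convergence
    (fun s => 8 * C * L * B * ‖η t₀ - γ s‖ ^ (-(1 / 2) : ℝ)) ?_ ?_
    ((h.integrableOn_rpow (η t₀)).const_mul _) ?_
  · refine Eventually.of_forall fun t => ?_
    simp only [slope, vsub_eq_sub]
    exact (((hint t).sub (hint t₀)).smul ((t - t₀)⁻¹)).aestronglyMeasurable
  · filter_upwards [self_mem_nhdsWithin] with t ht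
    have ht0 : 0 < ‖t - t₀‖ := norm_pos_iff.2 (sub_ne_zero.2 ht)
    filter_upwards [ae_restrict_of_ae (h.ae_ne (η t)), ae_restrict_of_ae (h.ae_ne (η t₀))]
      with s hs hs0
    have h1 := norm_sub_le_of_singular_grad hC hk hb hg (sub_ne_zero.2 hs.symm)
      (sub_ne_zero.2 hs0.symm) (hD t s) (hD t₀ s)
    rw [sub_sub_sub_cancel_right] at h1
    simp only [slope, vsub_eq_sub]
    rw [norm_smul, norm_inv, ← sub_mul, norm_mul, inv_mul_le_iff₀ ht0]
    calc _ ≤ 8 * C * (L * ‖t - t₀‖) * ‖η t₀ - γ s‖ ^ (-(1 / 2) : ℝ) * B :=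
          mul_le_mul (h1.trans (by gcongr; exact hlip t)) (hvB s) (norm_nonneg _) (by positivity)
      _ = _ := by ring
  · filter_upwards [ae_restrict_of_ae (h.ae_ne (η t₀))] with s hs
    have h1 := HasFDerivAt.comp_hasDerivAt t₀ (hk _ (sub_ne_zero.2 hs.symm))
      ((hη.hasDerivAt t₀).sub_const (γ s))
    have h2 := h1.mul_const (v s)
    rw [gradL_apply] at h2
    exact hasDerivAt_iff_tendsto_slope.1 h2

end

end Poro

namespace Poro

noncomputable section

open Filter Topology Set MeasureTheory

/-! ### Bounds for the derivatives of radial functions -/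

theorem nsq_rpow (w : Plane) : nsq w ^ (-(1 / 4) : ℝ) = ‖w‖ ^ (-(1 / 2) : ℝ) := by
  rw [nsq_eq_norm_sq, ← Real.rpow_natCast, ← Real.rpow_mul (norm_nonneg _)]
  norm_num

theorem nsq_le {w : Plane} {D : ℝ} (h : ‖w‖ ≤ D) : nsq w ≤ D ^ 2 := by
  rw [nsq_eq_norm_sq]; gcongr

theorem norm_coord_le (w : Plane) (i : Fin 2) : ‖(w i : ℂ)‖ ≤ ‖w‖ := by
  rw [Complex.norm_real]; exact PiLp.norm_apply_le w i

theorem norm_kron_le (i j : Fin 2) : ‖kron i j‖ ≤ 1 := by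
  rw [kron]; split_ifs <;> simp

theorem norm_rpow_neg_half_mul {w : Plane} (hw : w ≠ 0) :
    ‖w‖ * ‖w‖ ^ (-(1 / 2) : ℝ) = ‖w‖ ^ (1 / 2 : ℝ) := by
  rw [mul_comm, ← Real.rpow_add_one (norm_pos_iff.2 hw).ne']; norm_num

theorem one_le_rpow_neg_half {w : Plane} {D : ℝ} (hw : w ≠ 0) (hD : ‖w‖ ≤ D) :
    1 ≤ D ^ (1 / 2 : ℝ) * ‖w‖ ^ (-(1 / 2) : ℝ) := by
  have hpos := norm_pos_iff.2 hw
  rw [Real.rpow_neg hpos.le, ← div_eq_mul_inv, one_le_div (Real.rpow_pos_of_pos hpos _)]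
  exact Real.rpow_le_rpow hpos.le hD (by norm_num)

theorem IsLogJet.R0_bound {κ : ℂ} {F : ℕ → ℝ → ℂ} (h : IsLogJet κ F) (D : ℝ) :
    ∃ C, 0 ≤ C ∧ ∀ w : Plane, w ≠ 0 → ‖w‖ ≤ D → ‖R0 F w‖ ≤ C * ‖w‖ ^ (-(1 / 2) : ℝ) := by
  obtain ⟨C, hC, hb⟩ := h.bound_zero (D ^ 2)
  refine ⟨C, hC, fun w hw hD => ?_⟩
  rw [← nsq_rpow]
  exact hb _ (nsq_pos hw) (nsq_le hD)

theorem IsLogJet.R1_bound {F : ℕ → ℝ → ℂ} (h : IsLogJet 0 F) (D : ℝ) :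
    ∃ C, 0 ≤ C ∧ ∀ i, ∀ w : Plane, w ≠ 0 → ‖w‖ ≤ D → ‖R1 F i w‖ ≤ C * ‖w‖ ^ (1 / 2 : ℝ) := by
  obtain ⟨C, hC, hb⟩ := h.bound_one_of_zero (D ^ 2)
  refine ⟨2 * C, by positivity, fun i w hw hD => ?_⟩
  have h1 := hb _ (nsq_pos hw) (nsq_le hD)
  rw [nsq_rpow] at h1
  rw [R1, norm_mul, norm_mul, Complex.norm_ofNat, ← norm_rpow_neg_half_mul hw]
  calc 2 * ‖(w i : ℂ)‖ * ‖F 1 (nsq w)‖ ≤ 2 * ‖w‖ * (C * ‖w‖ ^ (-(1 / 2) : ℝ)) := by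
        gcongr
        exact norm_coord_le w i
    _ = _ := by ring

theorem IsLogJet.R2_bound {F : ℕ → ℝ → ℂ} (h : IsLogJet 0 F) (D : ℝ) :
    ∃ C, 0 ≤ C ∧ ∀ i j, ∀ w : Plane, w ≠ 0 → ‖w‖ ≤ D →
      ‖R2 F i j w‖ ≤ C * ‖w‖ ^ (-(1 / 2) : ℝ) := by
  obtain ⟨C₁, hC₁, hb₁⟩ := h.bound_one_of_zero (D ^ 2)
  obtain ⟨C₂, hC₂, hb₂⟩ := h.bound_two_of_zero (D ^ 2)
  refine ⟨2 * C₁ + 4 * C₂ * |D| ^ (1 / 2 : ℝ), by positivity, fun i j w hw hD => ?_⟩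
  have h1 := hb₁ _ (nsq_pos hw) (nsq_le hD)
  have h2 := hb₂ _ (nsq_pos hw) (nsq_le hD)
  have hone := one_le_rpow_neg_half hw (hD.trans (le_abs_self D))
  rw [nsq_rpow] at h1
  rw [nsq_eq_norm_sq] at h2
  have hw2 : 0 < ‖w‖ := norm_pos_iff.2 hw
  rw [R2]
  refine (norm_add_le _ _).trans ?_
  simp only [norm_mul, Complex.norm_ofNat]
  rw [nsq_eq_norm_sq] at *
  calc 2 * ‖kron i j‖ * ‖F 1 (‖w‖ ^ 2)‖ + 4 * (‖(w i : ℂ)‖ * ‖(w j : ℂ)‖) * ‖F 2 (‖w‖ ^ 2)‖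
      ≤ 2 * 1 * (C₁ * ‖w‖ ^ (-(1 / 2) : ℝ)) + 4 * (‖w‖ * ‖w‖) * (C₂ / ‖w‖ ^ 2) := by
        gcongr
        · exact norm_kron_le i j
        · exact norm_coord_le w i
        · exact norm_coord_le w j
    _ = 2 * C₁ * ‖w‖ ^ (-(1 / 2) : ℝ) + 4 * C₂ * 1 := by field_simp
    _ ≤ 2 * C₁ * ‖w‖ ^ (-(1 / 2) : ℝ) +
        4 * C₂ * (|D| ^ (1 / 2 : ℝ) * ‖w‖ ^ (-(1 / 2) : ℝ)) := by gcongr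
    _ = _ := by ring

/-- The normal derivative is `2 (n · w) F'(|w|²)` with `F' = O(|w|^(-2))`; a quadratic bound on `n ·
w` cancels the singularity even when the logarithm survives. -/
theorem IsLogJet.R1_normal_bound {κ : ℂ} {F : ℕ → ℝ → ℂ} (h : IsLogJet κ F) (D : ℝ) :
    ∃ C, 0 ≤ C ∧ ∀ (n : Fin 2 → ℝ) (K : ℝ) (w : Plane), w ≠ 0 → ‖w‖ ≤ D →
      |∑ i, n i * w i| ≤ K * ‖w‖ ^ 2 → ‖∑ i, (n i : ℂ) * R1 F i w‖ ≤ C * K := by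
  obtain ⟨C, hC, hb⟩ := h.bound_one (D ^ 2)
  refine ⟨2 * C, by positivity, fun n K w hw hD hn => ?_⟩
  have h1 := hb _ (nsq_pos hw) (nsq_le hD)
  have hw2 : 0 < ‖w‖ := norm_pos_iff.2 hw
  have e : ∑ i, (n i : ℂ) * R1 F i w = 2 * ((∑ i, n i * w i : ℝ) : ℂ) * F 1 (nsq w) := by
    simp only [R1, Fin.sum_univ_two]; push_cast; ring
  rw [e, norm_mul, norm_mul, Complex.norm_ofNat, Complex.norm_real, Real.norm_eq_abs]
  rw [nsq_eq_norm_sq] at *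
  have hK : 0 ≤ K * ‖w‖ ^ 2 := (abs_nonneg _).trans hn
  calc _ ≤ 2 * (K * ‖w‖ ^ 2) * (C / ‖w‖ ^ 2) := by gcongr
    _ = _ := by field_simp

/-- Functions on the plane with a mild singularity at the origin, which do not distinguish
opposite directions at leading order. -/
def Mild (D : ℝ) (f : Plane → ℂ) : Prop :=
  ∃ C, 0 ≤ C ∧ (∀ w : Plane, w ≠ 0 → ‖w‖ ≤ D → ‖f w‖ ≤ C * ‖w‖ ^ (-(1 / 2) : ℝ)) ∧
    ∀ w w' : Plane, w ≠ 0 → ‖w‖ ≤ D → ‖w‖ = ‖w'‖ → ‖f w - f w'‖ ≤ C * (‖w + w'‖ / ‖w‖)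

theorem Mild.add {D : ℝ} {f f' : Plane → ℂ} (h : Mild D f) (h' : Mild D f') :
    Mild D fun w => f w + f' w := by
  obtain ⟨C, hC, h1, h2⟩ := h
  obtain ⟨C', hC', h1', h2'⟩ := h'
  refine ⟨C + C', by positivity, fun w hw hD => ?_, fun w w' hw hD e => ?_⟩
  · rw [add_mul]
    exact (norm_add_le _ _).trans (add_le_add (h1 w hw hD) (h1' w hw hD))
  · rw [add_mul, add_sub_add_comm]
    exact (norm_add_le _ _).trans (add_le_add (h2 w w' hw hD e) (h2' w w' hw hD e))

theorem Mild.const_mul {D : ℝ} {f : Plane → ℂ} (c : ℂ) (h : Mild D f) :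
    Mild D fun w => c * f w := by
  obtain ⟨C, hC, h1, h2⟩ := h
  refine ⟨‖c‖ * C, by positivity, fun w hw hD => ?_, fun w w' hw hD e => ?_⟩
  · rw [norm_mul, mul_assoc]
    gcongr
    exact h1 w hw hD
  · rw [← mul_sub, norm_mul, mul_assoc]
    gcongr
    exact h2 w w' hw hD e

theorem IsLogJet.mild_R0 {κ : ℂ} {F : ℕ → ℝ → ℂ} (h : IsLogJet κ F) (D : ℝ) :
    Mild D (R0 F) := by
  obtain ⟨C, hC, hb⟩ := h.R0_bound D
  refine ⟨C, hC, hb, fun w w' hw hD e => ?_⟩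
  rw [R0, R0, nsq_eq_norm_sq, nsq_eq_norm_sq, e, sub_self, norm_zero]
  positivity

theorem IsLogJet.mild_R2 {F : ℕ → ℝ → ℂ} (h : IsLogJet 0 F) (D : ℝ) (i j : Fin 2) :
    Mild D (R2 F i j) := by
  obtain ⟨C, hC, hb⟩ := h.R2_bound D
  obtain ⟨C₂, hC₂, hb₂⟩ := h.bound_two_of_zero (D ^ 2)
  refine ⟨C + 8 * C₂, by positivity, fun w hw hD => (hb i j w hw hD).trans (by
    gcongr; linarith), fun w w' hw hD e => ?_⟩
  have h2 := hb₂ _ (nsq_pos hw) (nsq_le hD)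
  have hpos : 0 < ‖w‖ := norm_pos_iff.2 hw
  have en : nsq w' = nsq w := by rw [nsq_eq_norm_sq, nsq_eq_norm_sq, e]
  -- The Kronecker term depends on `|w|` only, and `w_i w_j - w'_i w'_j` is rewritten so that each
  -- summand contains a component of `w + w'`.
  have e1 : R2 F i j w - R2 F i j w' =
      4 * ((w i : ℂ) * ((w + w') j : ℂ) - (w' j : ℂ) * ((w + w') i : ℂ)) * F 2 (nsq w) := by
    rw [R2, R2, en]
    simp only [PiLp.add_apply]
    push_cast
    ring
  rw [e1, norm_mul, norm_mul, Complex.norm_ofNat]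
  rw [nsq_eq_norm_sq] at *
  have h3 : ‖(w i : ℂ) * ((w + w') j : ℂ) - (w' j : ℂ) * ((w + w') i : ℂ)‖ ≤
      2 * (‖w‖ * ‖w + w'‖) := by
    refine (norm_sub_le _ _).trans ?_
    rw [norm_mul, norm_mul, two_mul]
    gcongr
    · exact norm_coord_le w i
    · exact norm_coord_le _ j
    · rw [e]; exact norm_coord_le w' j
    · exact norm_coord_le _ i
  calc _ ≤ 4 * (2 * (‖w‖ * ‖w + w'‖)) * (C₂ / ‖w‖ ^ 2) := by gcongr
    _ = 8 * C₂ * (‖w + w'‖ / ‖w‖) := by field_simp; ring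
    _ ≤ _ := by gcongr; linarith

namespace Medium

variable (M : Medium) (k₁ k₂ : ℂ)

theorem mild_fluxKernel (hk : k₁ ^ 2 ≠ k₂ ^ 2) (nx : Fin 2 → ℝ) (j : Fin 2) (D : ℝ) :
    Mild D (M.fluxKernel k₁ k₂ nx j) := by
  have hP := (M.isLogJet_pJet k₁ k₂ hk).mild_R2 D
  have hd := (isLogJet_dJet k₁ k₂).mild_R2 D
  obtain ⟨_, hK⟩ := isLogJet_kJet k₁ k₂
  exact (Mild.add (Mild.const_mul _ (Mild.add
    (((isLogJet_helmJet M.ks).mild_R0 D).const_mul _) (Mild.const_mul _ (Mild.add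
      (Mild.const_mul _ (Mild.add ((hP 0 0).const_mul _) ((hP 0 1).const_mul _)))
      (Mild.const_mul _ (Mild.add ((hP 1 0).const_mul _) ((hP 1 1).const_mul _)))))))
    ((hK.mild_R0 D).const_mul _)).add
    (Mild.const_mul _ (((hd j 0).const_mul _).add ((hd j 1).const_mul _)))

end Medium

/-! ### Weakly singular families -/

/-- A family of numbers bounded by `C |v|^(-1/2)`. -/
def WSBound {ι : Type*} (v : ι → Plane) (f : ι → ℂ) : Prop :=
  ∃ C, 0 ≤ C ∧ ∀ i, v i ≠ 0 → ‖f i‖ ≤ C * ‖v i‖ ^ (-(1 / 2) : ℝ)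

/-- A bounded family of numbers. -/
def BddFam {ι : Type*} (a : ι → ℂ) : Prop := ∃ B, ∀ i, ‖a i‖ ≤ B

theorem BddFam.const {ι : Type*} (c : ℂ) : BddFam fun _ : ι => c := ⟨‖c‖, fun _ => le_rfl⟩

theorem BddFam.mul {ι : Type*} {a b : ι → ℂ} (ha : BddFam a) (hb : BddFam b) :
    BddFam fun i => a i * b i := by
  obtain ⟨A, hA⟩ := ha
  obtain ⟨B, hB⟩ := hb
  refine ⟨A * B, fun i => ?_⟩
  rw [norm_mul]
  exact mul_le_mul (hA i) (hB i) (norm_nonneg _) ((norm_nonneg _).trans (hA i))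

theorem BddFam.neg {ι : Type*} {a : ι → ℂ} (ha : BddFam a) : BddFam fun i => -a i := by
  obtain ⟨A, hA⟩ := ha
  exact ⟨A, fun i => by rw [norm_neg]; exact hA i⟩

namespace WSBound

variable {ι : Type*} {v : ι → Plane} {f f' a : ι → ℂ}

theorem add (h : WSBound v f) (h' : WSBound v f') : WSBound v fun i => f i + f' i := by
  obtain ⟨C, hC, h⟩ := h
  obtain ⟨C', hC', h'⟩ := h'
  refine ⟨C + C', by positivity, fun i hi => ?_⟩
  rw [add_mul]
  exact (norm_add_le _ _).trans (add_le_add (h i hi) (h' i hi))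

theorem bdd_mul (ha : BddFam a) (h : WSBound v f) : WSBound v fun i => a i * f i := by
  obtain ⟨C, hC, h⟩ := h
  obtain ⟨B, hB⟩ := ha
  refine ⟨|B| * C, by positivity, fun i hi => ?_⟩
  rw [norm_mul, mul_assoc]
  exact mul_le_mul ((hB i).trans (le_abs_self B)) (h i hi) (norm_nonneg _) (abs_nonneg _)

theorem congr (h : WSBound v f) (e : ∀ i, v i ≠ 0 → f i = f' i) : WSBound v f' :=
  h.imp fun _ hC => ⟨hC.1, fun i hi => by rw [← e i hi]; exact hC.2 i hi⟩

theorem mul_bdd (h : WSBound v f) (ha : BddFam a) : WSBound v fun i => f i * a i :=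
  (h.bdd_mul ha).congr fun _ _ => mul_comm _ _

theorem sub (h : WSBound v f) (h' : WSBound v f') : WSBound v fun i => f i - f' i := by
  have := h.add (h'.bdd_mul (BddFam.const (-1)))
  simpa [sub_eq_add_neg] using this

theorem of_bounded {D : ℝ} (hD : ∀ i, ‖v i‖ ≤ D) {C : ℝ} (hC : 0 ≤ C)
    (h : ∀ i, v i ≠ 0 → ‖f i‖ ≤ C) : WSBound v f := by
  refine ⟨C * |D| ^ (1 / 2 : ℝ), by positivity, fun i hi => (h i hi).trans ?_⟩
  rw [mul_assoc]
  exact le_mul_of_one_le_right hC (one_le_rpow_neg_half hi ((hD i).trans (le_abs_self D)))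

theorem R0 {D : ℝ} (hD : ∀ i, ‖v i‖ ≤ D) {κ : ℂ} {F : ℕ → ℝ → ℂ} (h : IsLogJet κ F) :
    WSBound v fun i => R0 F (v i) := by
  obtain ⟨C, hC, hb⟩ := h.R0_bound D
  exact ⟨C, hC, fun i hi => hb _ hi (hD i)⟩

theorem R2 {D : ℝ} (hD : ∀ i, ‖v i‖ ≤ D) {F : ℕ → ℝ → ℂ} (h : IsLogJet 0 F) (a b : Fin 2) :
    WSBound v fun i => R2 F a b (v i) := by
  obtain ⟨C, hC, hb⟩ := h.R2_bound D
  exact ⟨C, hC, fun i hi => hb a b _ hi (hD i)⟩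

theorem R1 {D : ℝ} (hD : ∀ i, ‖v i‖ ≤ D) {F : ℕ → ℝ → ℂ} (h : IsLogJet 0 F) (a : Fin 2) :
    WSBound v fun i => R1 F a (v i) := by
  obtain ⟨C, hC, hb⟩ := h.R1_bound D
  refine of_bounded hD (C := C * |D| ^ (1 / 2 : ℝ)) (by positivity) fun i hi =>
    (hb a _ hi (hD i)).trans ?_
  gcongr
  exact (hD i).trans (le_abs_self D)

theorem R1_normal {D : ℝ} (hD : ∀ i, ‖v i‖ ≤ D) {κ : ℂ} {F : ℕ → ℝ → ℂ} (h : IsLogJet κ F)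
    {n : ι → Fin 2 → ℝ} {K : ℝ} (hK : 0 ≤ K)
    (hn : ∀ i, |∑ j, n i j * v i j| ≤ K * ‖v i‖ ^ 2) :
    WSBound v fun i => ∑ j, (n i j : ℂ) * Poro.R1 F j (v i) := by
  obtain ⟨C, hC, hb⟩ := h.R1_normal_bound D
  exact of_bounded hD (C := C * K) (by positivity) fun i hi => hb _ K _ hi (hD i) (hn i)

end WSBound

/-! ### Geometry of the boundary -/

namespace SmoothBoundary

variable {Ω : Set Plane} (G : SmoothBoundary Ω)

theorem isClosedCurve (j : Fin G.n) : IsClosedCurve (G.curve j) where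
  smooth := (G.smooth j).of_le (WithTop.coe_le_coe.2 (le_top : (2 : ℕ∞) ≤ ⊤))
  periodic := G.periodic j
  regular := G.regular j
  simple := G.simple j

theorem speed_pos (p : G.Param) : 0 < G.speed p := norm_pos_iff.2 (G.regular _ _)

theorem exists_diam : ∃ D, ∀ p r : G.Param, ‖G.pt p - G.pt r‖ ≤ D := by
  have h : ∀ j : Fin G.n, ∃ C, 0 ≤ C ∧ ∀ t, ‖G.curve j t‖ ≤ C := fun j =>
    periodic_norm_bound (G.periodic j) (G.isClosedCurve j).continuous
  choose C hC hb using h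
  have hle : ∀ p : G.Param, ‖G.pt p‖ ≤ ∑ j, C j := fun p =>
    (hb p.1 p.2).trans (Finset.single_le_sum (fun j _ => hC j) (Finset.mem_univ p.1))
  exact ⟨∑ j, C j + ∑ j, C j, fun p r => (norm_sub_le _ _).trans (add_le_add (hle p) (hle r))⟩

theorem abs_normal_le (p : G.Param) (i : Fin 2) : |G.normal p i| ≤ 1 := by
  have h : ∀ i, |deriv (G.curve p.1) p.2 i / G.speed p| ≤ 1 := fun i => by
    rw [abs_div, abs_of_pos (G.speed_pos p), div_le_one (G.speed_pos p)]
    exact PiLp.norm_apply_le (deriv (G.curve p.1) p.2) i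
  fin_cases i
  · exact h 1
  · simp only [normal, Fin.mk_one, Matrix.cons_val_one, Matrix.cons_val_fin_one]
    rw [neg_div, abs_neg]
    exact h 0

theorem tang_normal (p : G.Param) (m : Fin 2) :
    tang (G.normal p) m = deriv (G.curve p.1) p.2 m / G.speed p := by
  fin_cases m <;> simp [tang, normal, neg_div]

theorem abs_normal_dot_le (p : G.Param) (w : Plane) : |∑ i, G.normal p i * w i| ≤ 2 * ‖w‖ := by
  rw [Fin.sum_univ_two, two_mul]
  have h : ∀ i, |G.normal p i * w i| ≤ ‖w‖ := fun i => by
    rw [abs_mul]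
    exact (mul_le_of_le_one_left (abs_nonneg _) (G.abs_normal_le p i)).trans
      (PiLp.norm_apply_le w i)
  exact (abs_add_le _ _).trans (add_le_add (h 0) (h 1))

theorem normal_dot_deriv (p : G.Param) :
    ∑ i, G.normal p i * deriv (G.curve p.1) p.2 i = 0 := by
  simp [Fin.sum_univ_two, normal]
  ring

/-- On one curve the normal annihilates the linear Taylor term, and the chord-arc bound converts the
quadratic remainder into the squared distance. Distinct curves have positive distance, so there the
linear bound is enough. -/
theorem exists_normal_bound : ∃ K, 0 ≤ K ∧ ∀ p r : G.Param,
    |∑ i, G.normal p i * (G.pt p - G.pt r) i| ≤ K * ‖G.pt p - G.pt r‖ ^ 2 := by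
  have h : ∀ j l : Fin G.n, ∃ K, 0 ≤ K ∧ ∀ t s,
      |∑ i, G.normal (j, t) i * (G.curve j t - G.curve l s) i| ≤
        K * ‖G.curve j t - G.curve l s‖ ^ 2 := by
    intro j l
    have hj := G.isClosedCurve j
    by_cases hjl : j = l
    · subst hjl
      obtain ⟨m, hm, hchord⟩ := hj.exists_chord_arc
      obtain ⟨K, hK, hT⟩ := hj.exists_taylor
      refine ⟨2 * K / m ^ 2, by positivity, fun t s => ?_⟩
      obtain ⟨s', hs', e⟩ := hj.exists_near t s
      rw [e]
      have e1 : ∑ i, G.normal (j, t) i * (G.curve j t - G.curve j s') i =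
          -∑ i, G.normal (j, t) i *
            (G.curve j s' - G.curve j t - (s' - t) • deriv (G.curve j) t) i := by
        have := G.normal_dot_deriv (j, t)
        simp only [Fin.sum_univ_two, PiLp.sub_apply, PiLp.smul_apply, smul_eq_mul] at *
        linear_combination (-(s' - t)) * this
      rw [e1, abs_neg]
      have h1 := hchord t s' hs'
      have h2 : m ^ 2 * (s' - t) ^ 2 ≤ ‖G.curve j t - G.curve j s'‖ ^ 2 := by
        rw [← sq_abs (s' - t), ← mul_pow, norm_sub_rev]
        gcongr
      calc _ ≤ 2 * (K * (s' - t) ^ 2) :=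
            (G.abs_normal_dot_le (j, t) _).trans (by gcongr; exact hT t s')
        _ = 2 * K / m ^ 2 * (m ^ 2 * (s' - t) ^ 2) := by field_simp
        _ ≤ _ := by gcongr
    · have hl := G.isClosedCurve l
      obtain ⟨d, hd, hb⟩ := ((isCompact_Icc (a := (0 : ℝ)) (b := 2 * Real.pi)).prod
        (isCompact_Icc (a := (0 : ℝ)) (b := 2 * Real.pi))).exists_forall_le'
        (f := fun z => ‖G.curve j z.1 - G.curve l z.2‖)
        (Continuous.continuousOn (by
          have := hj.continuous
          have := hl.continuous
          fun_prop)) (a := 0) (fun z _ => norm_pos_iff.2 (sub_ne_zero.2 fun e =>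
            (Set.disjoint_left.1 (G.disjoint j l hjl)) ⟨z.1, rfl⟩ ⟨z.2, e.symm⟩))
      refine ⟨2 / d, by positivity, fun t s => ?_⟩
      obtain ⟨t', ht', et⟩ := hj.periodic.exists_mem_Ico₀ Real.two_pi_pos t
      obtain ⟨s', hs', es⟩ := hl.periodic.exists_mem_Ico₀ Real.two_pi_pos s
      have h1 : d ≤ ‖G.curve j t - G.curve l s‖ := by
        rw [et, es]
        exact hb (t', s') ⟨⟨ht'.1, ht'.2.le⟩, ⟨hs'.1, hs'.2.le⟩⟩
      refine (G.abs_normal_dot_le (j, t) _).trans ?_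
      rw [div_mul_eq_mul_div, le_div_iff₀ hd, mul_assoc, sq]
      gcongr
  choose K hK hb using h
  refine ⟨∑ j, ∑ l, K j l, Finset.sum_nonneg fun j _ => Finset.sum_nonneg fun l _ => hK j l,
    fun p r => (hb p.1 r.1 p.2 r.2).trans ?_⟩
  have h1 : K p.1 r.1 ≤ ∑ l, K p.1 l :=
    Finset.single_le_sum (f := K p.1) (fun l _ => hK p.1 l) (Finset.mem_univ r.1)
  have h2 : ∑ l, K p.1 l ≤ ∑ j, ∑ l, K j l :=
    Finset.single_le_sum (f := fun j => ∑ l, K j l)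
      (fun j _ => Finset.sum_nonneg fun l _ => hK j l) (Finset.mem_univ p.1)
  exact mul_le_mul_of_nonneg_right (h1.trans h2) (by positivity)

theorem continuous_normal (j : Fin G.n) (i : Fin 2) :
    Continuous fun t => (G.normal (j, t) i : ℂ) := by
  have hc := (G.isClosedCurve j).continuous_deriv
  have h : ∀ i, Continuous fun t => deriv (G.curve j) t i / ‖deriv (G.curve j) t‖ := fun i =>
    Continuous.div (by fun_prop) (by fun_prop) fun t => (norm_pos_iff.2 (G.regular j t)).ne'
  refine Complex.continuous_ofReal.comp ?_
  fin_cases i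
  · exact h 1
  · simp only [normal, speed, Fin.mk_one, Matrix.cons_val_one, Matrix.cons_val_fin_one, neg_div]
    exact (h 0).neg

end SmoothBoundary

end

end Poro

namespace Poro

noncomputable section

open Filter Topology Set MeasureTheory

theorem HasGrad.continuousAt {f : Plane → ℂ} {g : Fin 2 → ℂ} {w : Plane} (h : HasGrad f g w) :
    ContinuousAt f w := HasFDerivAt.continuousAt h

open Medium

namespace SmoothBoundary

variable {Ω : Set Plane} (G : SmoothBoundary Ω)

/-! ### The regularized kernels are weakly singular -/

/-- Kernels which are continuous off the diagonal and bounded by `C |x - y|^(-1/2)`. -/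
def HalfSingular (K : G.Param → G.Param → Fin 2 → ℂ) : Prop :=
  (∀ i j l, ContinuousOn (fun z : ℝ × ℝ => K (j, z.1) (l, z.2) i)
    {z | G.curve j z.1 ≠ G.curve l z.2}) ∧
  ∀ i, WSBound (fun z : G.Param × G.Param => G.pt z.1 - G.pt z.2) fun z => K z.1 z.2 i

variable {G} in
theorem HalfSingular.weaklySingular {K : G.Param → G.Param → Fin 2 → ℂ}
    (hK : G.HalfSingular K) : G.WeaklySingular K := by
  obtain ⟨hc, hb⟩ := hK
  refine ⟨fun j l => continuousOn_pi.2 fun i => hc i j l, ?_⟩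
  choose C hC hb using hb
  -- The kernel takes values in the sup-normed `Fin 2 → ℂ`, so the sum of the two componentwise
  -- constants serves for both.
  refine ⟨C 0 + C 1, 1 / 2, by norm_num, by norm_num, fun p r hpr => ?_⟩
  rw [dist_eq_norm]
  refine (pi_norm_le_iff_of_nonneg (mul_nonneg (add_nonneg (hC 0) (hC 1)) (by positivity))).2
    fun i => ?_
  refine (hb i (p, r) (sub_ne_zero.2 hpr)).trans ?_
  gcongr
  fin_cases i
  · exact le_add_of_nonneg_right (hC 1)
  · exact le_add_of_nonneg_left (hC 0)

theorem continuousOn_diff {f : Plane → ℂ} (hf : ∀ w, w ≠ 0 → ContinuousAt f w) (j l : Fin G.n) :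
    ContinuousOn (fun z : ℝ × ℝ => f (G.curve j z.1 - G.curve l z.2))
      {z | G.curve j z.1 ≠ G.curve l z.2} := by
  intro z hz
  have hj := (G.isClosedCurve j).continuous
  have hl := (G.isClosedCurve l).continuous
  have h : Continuous fun z : ℝ × ℝ => G.curve j z.1 - G.curve l z.2 := by fun_prop
  exact (ContinuousAt.comp (f := fun z : ℝ × ℝ => G.curve j z.1 - G.curve l z.2)
    (hf _ (sub_ne_zero.2 hz)) h.continuousAt).continuousWithinAt

theorem bddFam_normal_left (i : Fin 2) :
    BddFam fun z : G.Param × G.Param => (G.normal z.1 i : ℂ) :=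
  ⟨1, fun z => by rw [Complex.norm_real]; exact G.abs_normal_le z.1 i⟩

theorem bddFam_normal_right (i : Fin 2) :
    BddFam fun z : G.Param × G.Param => (G.normal z.2 i : ℂ) :=
  ⟨1, fun z => by rw [Complex.norm_real]; exact G.abs_normal_le z.2 i⟩

theorem bddFam_rot_normal (j : Fin 2) :
    BddFam fun z : G.Param × G.Param => rot (fun i => (G.normal z.1 i : ℂ)) j := by
  fin_cases j
  · exact G.bddFam_normal_left 1
  · exact (G.bddFam_normal_left 0).neg

variable (M : Medium) {k₁ k₂ : ℂ}

/-- Every term is a normal derivative of a radial function, taken at `x` or at `y`, and is therefore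
bounded by `exists_normal_bound`. -/
theorem halfSingular_ker31 (h₁ : k₁ ≠ 0) (h₂ : k₂ ≠ 0) :
    G.HalfSingular (G.ker31 M k₁ k₂) := by
  obtain ⟨D, hD⟩ := G.exists_diam
  obtain ⟨K, hK, hn⟩ := G.exists_normal_bound
  have hv : ∀ z : G.Param × G.Param, ‖G.pt z.1 - G.pt z.2‖ ≤ D := fun z => hD _ _
  have hn1 : ∀ z : G.Param × G.Param, |∑ i, G.normal z.1 i * (G.pt z.1 - G.pt z.2) i| ≤
      K * ‖G.pt z.1 - G.pt z.2‖ ^ 2 := fun z => hn _ _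
  have hn2 : ∀ z : G.Param × G.Param, |∑ i, G.normal z.2 i * (G.pt z.1 - G.pt z.2) i| ≤
      K * ‖G.pt z.1 - G.pt z.2‖ ^ 2 := fun z => by
    have := hn z.2 z.1
    rw [norm_sub_rev] at this
    convert this using 1
    rw [← abs_neg]
    congr 1
    simp only [Fin.sum_univ_two, PiLp.sub_apply]
    ring
  obtain ⟨_, hKj⟩ := isLogJet_kJet k₁ k₂
  obtain ⟨_, hGj⟩ := M.isLogJet_gJet k₁ k₂
  have hQj := M.isLogJet_qJet k₁ k₂
  have hDj := isLogJet_dJet k₁ k₂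
  have hSj := isLogJet_helmJet M.ks
  refine ⟨fun i j l => ?_, fun i => ?_⟩
  · have hR : ∀ {κ : ℂ} {F : ℕ → ℝ → ℂ}, IsLogJet κ F → ∀ a, ContinuousOn
        (fun z : ℝ × ℝ => R1 F a (G.curve j z.1 - G.curve l z.2))
        {z | G.curve j z.1 ≠ G.curve l z.2} := fun hF a =>
      G.continuousOn_diff (fun w hw => (hasGrad_R1 hF.isPosJet hw a).continuousAt) j l
    have c1 := fun a => hR hKj a
    have c2 := fun a => hR hGj a
    have c3 := fun a => hR hQj a
    have c4 := fun a => hR hDj a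
    have c5 := fun a => hR hSj a
    -- The normals are replaced by opaque functions so that `fun_prop` uses their continuity as a
    -- hypothesis.
    obtain ⟨n, hn⟩ : ∃ n : Fin 2 → ℝ × ℝ → ℂ, ∀ a z, (G.normal (j, z.1) a : ℂ) = n a z :=
      ⟨_, fun _ _ => rfl⟩
    obtain ⟨n', hn'⟩ : ∃ n : Fin 2 → ℝ × ℝ → ℂ, ∀ a z, (G.normal (l, z.2) a : ℂ) = n a z :=
      ⟨_, fun _ _ => rfl⟩
    have n1 : ∀ a, Continuous (n a) := fun a =>
      ((G.continuous_normal j a).comp continuous_fst).congr (hn a)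
    have n2 : ∀ a, Continuous (n' a) := fun a =>
      ((G.continuous_normal l a).comp continuous_snd).congr (hn' a)
    refine ContinuousOn.congr ?_ fun z hz => M.kernel1_eq k₁ k₂ h₁ h₂ hz _ _ i
    simp only [Fin.sum_univ_two, hn, hn']
    fun_prop
  · refine WSBound.congr ?_ fun z hz =>
      (M.kernel1_eq k₁ k₂ h₁ h₂ (sub_ne_zero.1 hz) (G.normal z.1) (G.normal z.2) i).symm
    have q := WSBound.R1_normal hv hQj hK hn1
    have s := WSBound.R1_normal hv hSj hK hn2
    have d := WSBound.R1_normal hv hDj hK hn1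
    have k := WSBound.R1_normal hv hKj hK hn1
    have g := WSBound.R1_normal hv hGj hK hn1
    have b1 := G.bddFam_normal_left i
    have b2 := G.bddFam_normal_right i
    refine (((q.bdd_mul (BddFam.const _)).mul_bdd b2).sub (WSBound.bdd_mul (BddFam.const _)
      (WSBound.sub (WSBound.mul_bdd ?_ b1) ((WSBound.bdd_mul (BddFam.const _)
        (d.bdd_mul (BddFam.const _))).mul_bdd b2)))).sub
      ((k.bdd_mul (BddFam.const _)).mul_bdd b2) |>.add ((g.bdd_mul (BddFam.const _)).mul_bdd b2)
    exact (s.bdd_mul (BddFam.const (-1))).congr fun _ _ => neg_one_mul _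

theorem halfSingular_ker32 (h₁ : k₁ ≠ 0) (h₂ : k₂ ≠ 0) :
    G.HalfSingular (G.ker32 M k₁ k₂) := by
  obtain ⟨D, hD⟩ := G.exists_diam
  have hv : ∀ z : G.Param × G.Param, ‖G.pt z.1 - G.pt z.2‖ ≤ D := fun z => hD _ _
  refine ⟨fun i j l => ?_, fun i => ?_⟩
  · exact (G.continuousOn_diff (fun w hw =>
      (M.hasGrad_diffKernel2 k₁ k₂ i hw).continuousAt) j l).congr
      fun z hz => M.kernel2_eq k₁ k₂ h₁ h₂ hz i
  · exact ((WSBound.R1 hv (isLogJet_dJet k₁ k₂) i).bdd_mul (BddFam.const _)).congr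
      fun z hz => (M.kernel2_eq k₁ k₂ h₁ h₂ (sub_ne_zero.1 hz) i).symm

theorem halfSingular_ker33 (hk : k₁ ^ 2 ≠ k₂ ^ 2) (h₁ : k₁ ≠ 0) (h₂ : k₂ ≠ 0) :
    G.HalfSingular (G.ker33 M k₁ k₂) := by
  obtain ⟨D, hD⟩ := G.exists_diam
  have hv : ∀ z : G.Param × G.Param, ‖G.pt z.1 - G.pt z.2‖ ≤ D := fun z => hD _ _
  obtain ⟨_, hKj⟩ := isLogJet_kJet k₁ k₂
  have hSj := isLogJet_helmJet M.ks
  have hPj := M.isLogJet_pJet k₁ k₂ hk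
  refine ⟨fun i j l => ?_, fun i => ?_⟩
  · have hR : ∀ {κ : ℂ} {F : ℕ → ℝ → ℂ}, IsLogJet κ F → ContinuousOn
        (fun z : ℝ × ℝ => R0 F (G.curve j z.1 - G.curve l z.2))
        {z | G.curve j z.1 ≠ G.curve l z.2} := fun hF =>
      G.continuousOn_diff (fun w hw => (hasGrad_R0 hF.isPosJet hw).continuousAt) j l
    have c1 := hR hKj
    have c2 := hR hSj
    have c3 : ∀ a b, ContinuousOn
        (fun z : ℝ × ℝ => R2 (M.pJet k₁ k₂) a b (G.curve j z.1 - G.curve l z.2))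
        {z | G.curve j z.1 ≠ G.curve l z.2} := fun a b =>
      G.continuousOn_diff (fun w hw => (hasGrad_R2 hPj.isPosJet hw a b).continuousAt) j l
    obtain ⟨n, hn⟩ : ∃ n : Fin 2 → ℝ × ℝ → ℂ, ∀ a z, (G.normal (j, z.1) a : ℂ) = n a z :=
      ⟨_, fun _ _ => rfl⟩
    obtain ⟨n', hn'⟩ : ∃ n' : ℝ × ℝ → ℂ, ∀ z, rot (fun a => n a z) i = n' z :=
      ⟨_, fun _ => rfl⟩
    have n1 : ∀ a, Continuous (n a) := fun a =>
      ((G.continuous_normal j a).comp continuous_fst).congr (hn a)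
    have n2 : Continuous n' := by
      refine Continuous.congr ?_ hn'
      fin_cases i
      · exact n1 1
      · exact (n1 0).neg
    refine ContinuousOn.congr ?_ fun z hz => M.kernel3_eq k₁ k₂ hk h₁ h₂ hz _ i
    simp only [Medium.diffKernel3, hn, hn']
    fun_prop
  · refine WSBound.congr ?_ fun z hz =>
      (M.kernel3_eq k₁ k₂ hk h₁ h₂ (sub_ne_zero.1 hz) (G.normal z.1) i).symm
    have hP := WSBound.R2 hv hPj
    have b := G.bddFam_normal_left
    have br := G.bddFam_rot_normal i
    refine WSBound.add (WSBound.bdd_mul (BddFam.const _) (WSBound.add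
      ((WSBound.R0 hv hSj).bdd_mul br) (WSBound.bdd_mul (BddFam.const _) (WSBound.add
        (WSBound.bdd_mul (b 0) (WSBound.add ((hP 0 0).bdd_mul (BddFam.const _))
          ((hP 0 1).bdd_mul (BddFam.const _))))
        (WSBound.bdd_mul (b 1) (WSBound.add ((hP 1 0).bdd_mul (BddFam.const _))
          ((hP 1 1).bdd_mul (BddFam.const _)))))))) ?_
    exact (WSBound.R0 hv hKj).bdd_mul (((BddFam.const _).mul br).neg)

/-! ### Integrability -/

variable {G} {K : G.Param → G.Param → Fin 2 → ℂ}

theorem HalfSingular.continuousOn (hK : G.HalfSingular K) (p : G.Param) (l : Fin G.n)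
    (i : Fin 2) : ContinuousOn (fun s => K p (l, s) i) {s | G.curve l s ≠ G.pt p} :=
  (hK.1 i p.1 l).comp (f := fun s => (p.2, s)) (by fun_prop) fun _ hs => Ne.symm hs

theorem HalfSingular.integrableOn (hK : G.HalfSingular K) (p : G.Param) (l : Fin G.n)
    (i : Fin 2) {v : ℝ → ℂ} (hv : Continuous v) {B : ℝ} (hB : ∀ s, ‖v s‖ ≤ B) :
    IntegrableOn (fun s => K p (l, s) i * v s) (Ioc 0 (2 * Real.pi)) := by
  obtain ⟨C, hC, hb⟩ := hK.2 i
  refine (G.isClosedCurve l).integrableOn_of_bound (G.pt p)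
    ((hK.continuousOn p l i).mul hv.continuousOn) (C := C * B) fun s hs => ?_
  rw [norm_mul, mul_right_comm]
  exact mul_le_mul (hb (p, (l, s)) (sub_ne_zero.2 (Ne.symm hs))) (hB s) (norm_nonneg _)
    (by positivity)

end SmoothBoundary

end

end Poro

/-! ### Densities, the derivative of `N₃²(du/ds)` and the finite part -/

namespace Poro

noncomputable section

open Filter Topology Set MeasureTheory

/-- The jet stops at order three, so continuity there cannot come from differentiability and is read
off the explicit formula. It makes the derivative of `fluxKernel` continuous, as integration by
parts requires. -/
theorem IsLogJet.continuousAt_three {κ : ℂ} {F : ℕ → ℝ → ℂ} (h : IsLogJet κ F) {s : ℝ}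
    (hs : 0 < s) : ContinuousAt (F 3) s := by
  obtain ⟨a, b, ha, hb, -, rfl⟩ := h
  have hs' : (s : ℂ) ≠ 0 := by exact_mod_cast hs.ne'
  have h0 : ContinuousAt (a 0) s := (ha.continuous 0).continuousAt
  have h1 : ContinuousAt (a 1) s := (ha.continuous 1).continuousAt
  have h2 : ContinuousAt (a 2) s := (ha.continuous 2).continuousAt
  have h3 : ContinuousAt (a 3) s := (ha.continuous 3).continuousAt
  have h4 : ContinuousAt (b 3) s := (hb.continuous 3).continuousAt
  have hl : ContinuousAt (fun s : ℝ => (Real.log s : ℂ)) s := (hasDerivAt_log_ofReal hs).continuousAt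
  have hid : ContinuousAt (fun s : ℝ => (s : ℂ)) s := Complex.continuous_ofReal.continuousAt
  have e : logJet a b 3 = fun s => 2 * a 0 s / s ^ 3 - 3 * a 1 s / s ^ 2 + 3 * a 2 s / s +
      Real.log s * a 3 s + b 3 s := rfl
  rw [e]
  exact ((((((continuousAt_const.mul h0).div (hid.pow 3) (pow_ne_zero 3 hs')).sub
    ((continuousAt_const.mul h1).div (hid.pow 2) (pow_ne_zero 2 hs'))).add
    ((continuousAt_const.mul h2).div hid hs')).add (hl.mul h3)).add h4)

theorem continuous_nsq : Continuous nsq := by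
  unfold nsq; fun_prop

theorem IsLogJet.continuousAt_R3 {κ : ℂ} {F : ℕ → ℝ → ℂ} (h : IsLogJet κ F) {w : Plane}
    (hw : w ≠ 0) (i j l : Fin 2) : ContinuousAt (R3 F i j l) w := by
  have h2 : ContinuousAt (fun w => F 2 (nsq w)) w :=
    ContinuousAt.comp (f := nsq) (h.isPosJet 2 (by norm_num) _ (nsq_pos hw)).continuousAt
      continuous_nsq.continuousAt
  have h3 : ContinuousAt (fun w => F 3 (nsq w)) w :=
    ContinuousAt.comp (f := nsq) (h.continuousAt_three (nsq_pos hw)) continuous_nsq.continuousAt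
  have hc : ∀ i, ContinuousAt (fun w : Plane => (w i : ℂ)) w := fun i =>
    (hasGrad_coord i w).continuousAt
  have e : R3 F i j l = fun w : Plane =>
      4 * (kron i j * w l + kron i l * w j + kron j l * w i) * F 2 (nsq w)
        + 8 * (w i * w j * w l) * F 3 (nsq w) := rfl
  rw [e]
  exact ((continuousAt_const.mul (((continuousAt_const.mul (hc l)).add
    (continuousAt_const.mul (hc j))).add (continuousAt_const.mul (hc i)))).mul h2).add
    ((continuousAt_const.mul (((hc i).mul (hc j)).mul (hc l))).mul h3)

theorem Medium.continuousAt_fluxGrad (M : Medium) (k₁ k₂ : ℂ) (hk : k₁ ^ 2 ≠ k₂ ^ 2)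
    (nx : Fin 2 → ℝ) (j m : Fin 2) {w : Plane} (hw : w ≠ 0) :
    ContinuousAt (fun w => M.fluxGrad k₁ k₂ nx j w m) w := by
  have hP := fun a b => (M.isLogJet_pJet k₁ k₂ hk).continuousAt_R3 hw a b m
  have hd := fun a b => (Medium.isLogJet_dJet k₁ k₂).continuousAt_R3 hw a b m
  obtain ⟨_, hK⟩ := Medium.isLogJet_kJet k₁ k₂
  have h1 := (hasGrad_R1 hK.isPosJet hw m).continuousAt
  have h2 := (hasGrad_R1 (isLogJet_helmJet M.ks).isPosJet hw m).continuousAt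
  have c : ∀ (a : ℂ) {f : Plane → ℂ}, ContinuousAt f w → ContinuousAt (fun w => a * f w) w :=
    fun _ _ hf => continuousAt_const.mul hf
  exact ContinuousAt.add (ContinuousAt.add (c _ (ContinuousAt.add (c _ h2) (c _
    (ContinuousAt.add (c _ (ContinuousAt.add (c _ (hP 0 0)) (c _ (hP 0 1))))
      (c _ (ContinuousAt.add (c _ (hP 1 0)) (c _ (hP 1 1)))))))) (c _ h1))
    (c _ (ContinuousAt.add (c _ (hd j 0)) (c _ (hd j 1))))

namespace SmoothBoundary

variable {Ω : Set Plane} (G : SmoothBoundary Ω)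

/-! ### The densities -/

theorem continuous_speed (l : Fin G.n) : Continuous fun s => (G.speed (l, s) : ℂ) :=
  Complex.continuous_ofReal.comp (G.isClosedCurve l).continuous_deriv.norm

theorem speed_periodic (l : Fin G.n) :
    Function.Periodic (fun s => (G.speed (l, s) : ℂ)) (2 * Real.pi) := fun s => by
  simp only [speed, periodic_deriv (G.periodic l) s]

variable {u : G.Param → Fin 2 → ℂ}

/-- The derivatives of the components of a density with respect to the parameter. -/
def densityDeriv (u : G.Param → Fin 2 → ℂ) (l : Fin G.n) (j : Fin 2) (s : ℝ) : ℂ :=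
  deriv (fun t => u (l, t)) s j

theorem dds_mul_speed (u : G.Param → Fin 2 → ℂ) (l : Fin G.n) (j : Fin 2) (s : ℝ) :
    G.dds u (l, s) j * (G.speed (l, s) : ℂ) = G.densityDeriv u l j s := by
  have h : (G.speed (l, s) : ℂ) ≠ 0 := by exact_mod_cast (G.speed_pos (l, s)).ne'
  simp only [dds, densityDeriv, Pi.smul_apply, Complex.real_smul, Complex.ofReal_inv]
  field_simp

/-- A continuously differentiable density on the boundary. -/
structure IsDensity (u : G.Param → Fin 2 → ℂ) : Prop where
  contDiff : ∀ l, ContDiff ℝ 1 fun t => u (l, t)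
  periodic : ∀ l, Function.Periodic (fun t => u (l, t)) (2 * Real.pi)

namespace IsDensity

variable {G}

theorem hasDerivAt (hu : G.IsDensity u) (l : Fin G.n) (j : Fin 2) (s : ℝ) :
    HasDerivAt (fun t => u (l, t) j) (G.densityDeriv u l j s) s :=
  hasDerivAt_pi.1 ((hu.contDiff l).differentiable one_ne_zero s).hasDerivAt j

theorem continuous (hu : G.IsDensity u) (l : Fin G.n) (j : Fin 2) :
    Continuous fun t => u (l, t) j :=
  continuous_iff_continuousAt.2 fun s => (hu.hasDerivAt l j s).continuousAt

theorem continuous_deriv (hu : G.IsDensity u) (l : Fin G.n) (j : Fin 2) :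
    Continuous (G.densityDeriv u l j) :=
  (continuous_apply j).comp ((hu.contDiff l).continuous_deriv le_rfl)

theorem exists_bound_deriv (hu : G.IsDensity u) (l : Fin G.n) (j : Fin 2) :
    ∃ B, ∀ s, ‖G.densityDeriv u l j s‖ ≤ B := by
  have hp : Function.Periodic (G.densityDeriv u l j) (2 * Real.pi) := fun s =>
    congrFun (periodic_deriv (hu.periodic l) s) j
  obtain ⟨B, -, hB⟩ := periodic_norm_bound hp (hu.continuous_deriv l j)
  exact ⟨B, hB⟩

theorem exists_bound_mul_speed (hu : G.IsDensity u) (l : Fin G.n) (j : Fin 2) :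
    ∃ B, ∀ s, ‖u (l, s) j * (G.speed (l, s) : ℂ)‖ ≤ B := by
  have hp : Function.Periodic (fun s => u (l, s) j * (G.speed (l, s) : ℂ)) (2 * Real.pi) :=
    fun s => congrArg₂ (· * ·) (congrFun (hu.periodic l s) j) (G.speed_periodic l s)
  obtain ⟨B, -, hB⟩ := periodic_norm_bound hp ((hu.continuous l j).mul (G.continuous_speed l))
  exact ⟨B, hB⟩

end IsDensity

/-! ### The integral operators -/

theorem intOp_eq {K : G.Param → G.Param → Fin 2 → ℂ} {p : G.Param} {v : G.Param → Fin 2 → ℂ}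
    (h : ∀ l j, IntegrableOn (fun s => K p (l, s) j * (v (l, s) j * (G.speed (l, s) : ℂ)))
      (Ioc 0 (2 * Real.pi))) :
    G.intOp K v p = ∑ l, ∑ j, ∫ s in Ioc 0 (2 * Real.pi),
      K p (l, s) j * (v (l, s) j * (G.speed (l, s) : ℂ)) := by
  rw [intOp, SmoothBoundary.integral]
  refine Finset.sum_congr rfl fun l _ => ?_
  refine Eq.trans (integral_congr_ae (Eventually.of_forall fun s => ?_))
    (integral_finsetSum Finset.univ fun j _ => h l j)
  simp only [Finset.sum_mul, mul_assoc]

theorem intOp_dds_eq {K : G.Param → G.Param → Fin 2 → ℂ} (hK : G.HalfSingular K)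
    (hu : G.IsDensity u) (p : G.Param) {k : Fin 2 → Plane → ℂ}
    (hk : ∀ r j, G.pt p ≠ G.pt r → K p r j = k j (G.pt p - G.pt r)) :
    G.intOp K (G.dds u) p = ∑ l, ∑ j, ∫ s in Ioc 0 (2 * Real.pi),
      k j (G.pt p - G.curve l s) * G.densityDeriv u l j s := by
  rw [G.intOp_eq fun l j => ?_]
  · refine Finset.sum_congr rfl fun l _ => Finset.sum_congr rfl fun j _ => integral_congr_ae ?_
    filter_upwards [ae_restrict_of_ae ((G.isClosedCurve l).ae_ne (G.pt p))] with s hs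
    rw [dds_mul_speed, hk (l, s) j hs.symm]
    rfl
  · simp only [dds_mul_speed]
    obtain ⟨B, hB⟩ := hu.exists_bound_deriv l j
    exact hK.integrableOn p l j (hu.continuous_deriv l j) hB

theorem HalfSingular.integrableOn_diff {K : G.Param → G.Param → Fin 2 → ℂ}
    (hK : G.HalfSingular K) (hu : G.IsDensity u) (p : G.Param) {k : Fin 2 → Plane → ℂ}
    (hk : ∀ r j, G.pt p ≠ G.pt r → K p r j = k j (G.pt p - G.pt r)) (l : Fin G.n) (j : Fin 2) :
    IntegrableOn (fun s => k j (G.pt p - G.curve l s) * G.densityDeriv u l j s)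
      (Ioc 0 (2 * Real.pi)) := by
  obtain ⟨B, hB⟩ := hu.exists_bound_deriv l j
  refine (hK.integrableOn p l j (hu.continuous_deriv l j) hB).congr ?_
  filter_upwards [ae_restrict_of_ae ((G.isClosedCurve l).ae_ne (G.pt p))] with s hs
  rw [hk (l, s) j hs.symm]
  rfl

variable (M : Medium) {k₁ k₂ : ℂ}

/-- Since the leading logarithms cancel in `γ_{k₁} - γ_{k₂}`, the kernel is `O(|w|^(1/2))` with
gradient `O(|w|^(-1/2))`, just what differentiation under the integral needs. -/
theorem hasDerivAt_N32 (h₁ : k₁ ≠ 0) (h₂ : k₂ ≠ 0) (hu : G.IsDensity u) (p : G.Param) :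
    HasDerivAt (fun t => G.N32 M k₁ k₂ (G.dds u) (p.1, t))
      (∑ l, ∑ j, ∫ s in Ioc 0 (2 * Real.pi), (∑ m, (deriv (G.curve p.1) p.2 m : ℂ) *
        (M.coeffN k₁ k₂ * R2 (Medium.dJet k₁ k₂) j m (G.pt p - G.curve l s))) *
          G.densityDeriv u l j s) p.2 := by
  have e : (fun t => G.N32 M k₁ k₂ (G.dds u) (p.1, t)) = fun t => ∑ l, ∑ j,
      ∫ s in Ioc 0 (2 * Real.pi), M.diffKernel2 k₁ k₂ j (G.curve p.1 t - G.curve l s) *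
        G.densityDeriv u l j s := funext fun t =>
    G.intOp_dds_eq (G.halfSingular_ker32 M h₁ h₂) hu (p.1, t)
      fun r j hr => M.kernel2_eq k₁ k₂ h₁ h₂ hr j
  rw [e]
  obtain ⟨D, hD⟩ := G.exists_diam
  obtain ⟨C₁, hC₁, hb₁⟩ := (Medium.isLogJet_dJet k₁ k₂).R1_bound D
  obtain ⟨C₂, hC₂, hb₂⟩ := (Medium.isLogJet_dJet k₁ k₂).R2_bound D
  refine HasDerivAt.fun_sum fun l _ => HasDerivAt.fun_sum fun j _ => ?_
  obtain ⟨B, hB⟩ := hu.exists_bound_deriv l j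
  refine (G.isClosedCurve l).hasDerivAt_integral (G.isClosedCurve p.1) p.2
    (C := ‖M.coeffN k₁ k₂‖ * (C₁ + C₂)) (by positivity) (fun t s => hD (p.1, t) (l, s))
    (fun w hw => M.hasGrad_diffKernel2 k₁ k₂ j hw) (fun w hw hwD => ?_) (fun w hw hwD i => ?_)
    (hu.continuous_deriv l j) hB
  · rw [Medium.diffKernel2, norm_mul, mul_assoc]
    gcongr
    refine (hb₁ j w hw hwD).trans ?_
    gcongr
    linarith
  · rw [norm_mul, mul_assoc]
    gcongr
    refine (hb₂ j i w hw hwD).trans ?_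
    gcongr
    linarith

/-! ### The finite part -/

/-- The parameter derivative of `fluxKernel` along the boundary. -/
def fluxDeriv (M : Medium) (k₁ k₂ : ℂ) (p : G.Param) (l : Fin G.n) (j : Fin 2) (s : ℝ) : ℂ :=
  -∑ m, (deriv (G.curve l) s m : ℂ) * M.fluxGrad k₁ k₂ (G.normal p) j (G.pt p - G.curve l s) m

theorem hasDerivAt_fluxKernel (hk : k₁ ^ 2 ≠ k₂ ^ 2) (p : G.Param) (l : Fin G.n) (j : Fin 2)
    {s : ℝ} (hs : G.curve l s ≠ G.pt p) :
    HasDerivAt (fun s => M.fluxKernel k₁ k₂ (G.normal p) j (G.pt p - G.curve l s))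
      (G.fluxDeriv M k₁ k₂ p l j s) s := by
  have h1 := M.hasGrad_fluxKernel k₁ k₂ hk (G.normal p) j (sub_ne_zero.2 hs.symm)
  have h2 := ((G.isClosedCurve l).hasDerivAt s).const_sub (G.pt p)
  have h3 := HasFDerivAt.comp_hasDerivAt (f := fun s => G.pt p - G.curve l s) s h1 h2
  refine h3.congr_deriv ?_
  simp only [gradL_apply, fluxDeriv, PiLp.neg_apply, Complex.ofReal_neg, neg_mul,
    Finset.sum_neg_distrib]

theorem continuousOn_fluxDeriv (hk : k₁ ^ 2 ≠ k₂ ^ 2) (p : G.Param) (l : Fin G.n) (j : Fin 2) :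
    ContinuousOn (G.fluxDeriv M k₁ k₂ p l j) {s | G.curve l s ≠ G.pt p} := by
  have hc := (G.isClosedCurve l).continuous
  have hd := (G.isClosedCurve l).continuous_deriv
  intro s hs
  refine ContinuousAt.continuousWithinAt (ContinuousAt.neg (tendsto_finsetSum _ fun m _ => ?_))
  refine ContinuousAt.mul (Continuous.continuousAt (Complex.continuous_ofReal.comp (by fun_prop)))
    ?_
  exact ContinuousAt.comp (f := fun s => G.pt p - G.curve l s)
    (M.continuousAt_fluxGrad k₁ k₂ hk (G.normal p) j m (sub_ne_zero.2 hs.symm))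
    (by fun_prop)

/-- Multiplying the kernel identity by the speed turns the unit tangent into the velocity of the
curve. The minus sign appears because the kernel depends on `x - y` and the derivative falls on `y`.
-/
theorem hyperIntegrand_mul_speed (hk : M.IsWaveNumberPair k₁ k₂) (hk_ne : k₁ ^ 2 ≠ k₂ ^ 2)
    (p : G.Param) (l : Fin G.n) {s : ℝ} (hs : G.curve l s ≠ G.pt p) :
    G.hyperIntegrand M k₁ k₂ (G.withZero u) p (Sum.inr ()) (l, s) * (G.speed (l, s) : ℂ) =
      ∑ j, (G.ker31 M k₁ k₂ p (l, s) j * (u (l, s) j * (G.speed (l, s) : ℂ)) -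
        G.fluxDeriv M k₁ k₂ p l j s * u (l, s) j) := by
  have h : (G.speed (l, s) : ℂ) ≠ 0 := by exact_mod_cast (G.speed_pos (l, s)).ne'
  have e : ∀ j, M.hyperKernel k₁ k₂ (G.normal p) (G.normal (l, s)) (G.pt p) (G.pt (l, s))
      (Sum.inr ()) (Sum.inl j) * (G.speed (l, s) : ℂ) =
      G.ker31 M k₁ k₂ p (l, s) j * (G.speed (l, s) : ℂ) - G.fluxDeriv M k₁ k₂ p l j s := by
    intro j
    rw [M.hyperKernel_eq k₁ k₂ hk hk_ne (y := G.pt (l, s)) (Ne.symm hs) _ _ j]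
    simp only [tang_normal, Fin.sum_univ_two, fluxDeriv, ker31, Complex.ofReal_div]
    field_simp
    simp only [pt]
    ring
  simp only [hyperIntegrand, Fintype.sum_sum_type, withZero, Sum.elim_inl, Sum.elim_inr,
    mul_zero, Finset.sum_const_zero, add_zero, Finset.sum_mul]
  refine Finset.sum_congr rfl fun j _ => ?_
  linear_combination u (l, s) j * e j

theorem measurableSet_outside (ε : ℝ) (x : Plane) (l : Fin G.n) :
    MeasurableSet (G.outside ε x l) :=
  measurableSet_Ioc.inter (isOpen_lt continuous_const
    (continuous_const.dist (G.isClosedCurve l).continuous)).measurableSet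

theorem ne_of_mem_outside {ε : ℝ} (hε : 0 < ε) {x : Plane} {l : Fin G.n} {s : ℝ}
    (hs : s ∈ G.outside ε x l) : G.curve l s ≠ x :=
  (dist_pos.1 (hε.trans hs.2)).symm

theorem integrableOn_outside {f : ℝ → ℂ} {x : Plane} {l : Fin G.n}
    (hf : ContinuousOn f {s | G.curve l s ≠ x}) {ε : ℝ} (hε : 0 < ε) :
    IntegrableOn f (G.outside ε x l) := by
  have hcl : IsClosed {s | ε ≤ dist x (G.curve l s)} :=
    isClosed_le continuous_const (continuous_const.dist (G.isClosedCurve l).continuous)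
  have hK : IsCompact (Icc 0 (2 * Real.pi) ∩ {s | ε ≤ dist x (G.curve l s)}) :=
    isCompact_Icc.inter_right hcl
  refine (ContinuousOn.integrableOn_compact hK (hf.mono fun s hs => ?_)).mono_set fun s hs =>
    ⟨Ioc_subset_Icc_self hs.1, hs.2.le⟩
  exact (dist_pos.1 (hε.trans_le hs.2)).symm

theorem tendsto_fluxDeriv (hk : k₁ ^ 2 ≠ k₂ ^ 2) (hu : G.IsDensity u) (p : G.Param)
    (l : Fin G.n) (j : Fin 2) :
    Tendsto (fun ε => ∫ s in G.outside ε (G.pt p) l, G.fluxDeriv M k₁ k₂ p l j s * u (l, s) j)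
      (𝓝[>] 0) (𝓝 (-∫ s in Ioc 0 (2 * Real.pi),
        M.fluxKernel k₁ k₂ (G.normal p) j (G.pt p - G.curve l s) * G.densityDeriv u l j s)) := by
  obtain ⟨D, hD⟩ := G.exists_diam
  obtain ⟨C, hC, hb, hsym⟩ := M.mild_fluxKernel k₁ k₂ hk (G.normal p) j D
  refine (G.isClosedCurve l).tendsto_by_parts (G.pt p)
    (fun s hs => G.hasDerivAt_fluxKernel M hk p l j hs) (G.continuousOn_fluxDeriv M hk p l j)
    (fun s => ?_) (fun s => ?_) (hu.hasDerivAt l j) (hu.continuous_deriv l j)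
    (fun s => congrFun (hu.periodic l s) j) hC
    (fun s hs => hb _ (sub_ne_zero.2 hs.symm) (hD p (l, s)))
    fun s s' hs e => hsym _ _ (sub_ne_zero.2 hs.symm) (hD p (l, s)) e
  · simp only [G.periodic l s]
  · simp only [fluxDeriv, G.periodic l s, periodic_deriv (G.periodic l) s]

theorem hasFinitePart_hyperIntegrand (hk : M.IsWaveNumberPair k₁ k₂) (hk_ne : k₁ ^ 2 ≠ k₂ ^ 2)
    (hu : G.IsDensity u) (p : G.Param) :
    G.HasFinitePart (G.pt p) (G.hyperIntegrand M k₁ k₂ (G.withZero u) p (Sum.inr ()))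
      (G.N31 M k₁ k₂ u p + ∑ l, ∑ j, ∫ s in Ioc 0 (2 * Real.pi),
        M.fluxKernel k₁ k₂ (G.normal p) j (G.pt p - G.curve l s) * G.densityDeriv u l j s) := by
  have hK := G.halfSingular_ker31 M hk.ne_zero.1 hk.ne_zero.2
  have hint : ∀ l j, IntegrableOn (fun s => G.ker31 M k₁ k₂ p (l, s) j *
      (u (l, s) j * (G.speed (l, s) : ℂ))) (Ioc 0 (2 * Real.pi)) := fun l j => by
    obtain ⟨B, hB⟩ := hu.exists_bound_mul_speed l j
    exact hK.integrableOn p l j ((hu.continuous l j).mul (G.continuous_speed l)) hB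
  have hint1 : ∀ l j ε, 0 < ε → IntegrableOn (fun s => G.ker31 M k₁ k₂ p (l, s) j *
      (u (l, s) j * (G.speed (l, s) : ℂ))) (G.outside ε (G.pt p) l) := fun l j ε _ =>
    (hint l j).mono_set fun _ hs => hs.1
  have hint2 : ∀ l j ε, 0 < ε → IntegrableOn (fun s => G.fluxDeriv M k₁ k₂ p l j s * u (l, s) j)
      (G.outside ε (G.pt p) l) := fun l j ε hε =>
    G.integrableOn_outside ((G.continuousOn_fluxDeriv M hk_ne p l j).mul
      (hu.continuous l j).continuousOn) hε
  have hint3 : ∀ l j ε, 0 < ε → IntegrableOn (fun s => G.ker31 M k₁ k₂ p (l, s) j *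
      (u (l, s) j * (G.speed (l, s) : ℂ)) - G.fluxDeriv M k₁ k₂ p l j s * u (l, s) j)
      (G.outside ε (G.pt p) l) := fun l j ε hε => (hint1 l j ε hε).sub (hint2 l j ε hε)
  have heq : ∀ l ε, 0 < ε → EqOn (fun s => G.hyperIntegrand M k₁ k₂ (G.withZero u) p (Sum.inr ())
      (l, s) * (G.speed (l, s) : ℂ)) (fun s => ∑ j, (G.ker31 M k₁ k₂ p (l, s) j *
        (u (l, s) j * (G.speed (l, s) : ℂ)) - G.fluxDeriv M k₁ k₂ p l j s * u (l, s) j))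
      (G.outside ε (G.pt p) l) := fun l ε hε s hs =>
    G.hyperIntegrand_mul_speed M hk hk_ne p l (G.ne_of_mem_outside hε hs)
  -- Both divergent coefficients are zero: the truncated integrals converge.
  refine ⟨fun ε hε l => ?_, 0, 0, ?_⟩
  · rw [integrableOn_congr_fun (heq l ε hε) (G.measurableSet_outside ε _ l)]
    exact integrable_finsetSum _ fun j _ => hint3 l j ε hε
  · simp only [zero_div, sub_zero, zero_mul]
    rw [N31, G.intOp_eq hint, ← Finset.sum_add_distrib]
    simp only [← Finset.sum_add_distrib]
    refine Tendsto.congr' (f₁ := fun ε => ∑ l, ∑ j,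
      ((∫ s in G.outside ε (G.pt p) l, G.ker31 M k₁ k₂ p (l, s) j *
        (u (l, s) j * (G.speed (l, s) : ℂ))) -
        ∫ s in G.outside ε (G.pt p) l, G.fluxDeriv M k₁ k₂ p l j s * u (l, s) j)) ?_ ?_
    · filter_upwards [self_mem_nhdsWithin] with ε hε
      refine Finset.sum_congr rfl fun l _ => ?_
      rw [setIntegral_congr_fun (G.measurableSet_outside ε _ l) (heq l ε hε),
        integral_finsetSum _ fun j _ => hint3 l j ε hε]
      exact Finset.sum_congr rfl fun j _ =>
        (integral_sub (hint1 l j ε hε) (hint2 l j ε hε)).symm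
    · refine tendsto_finsetSum _ fun l _ => tendsto_finsetSum _ fun j _ => ?_
      have h1 := tendsto_setIntegral_outsideCurve (G.isClosedCurve l).continuous (G.pt p)
        ((G.isClosedCurve l).ae_ne _) (hint l j)
      have h2 := h1.sub (G.tendsto_fluxDeriv M hk_ne hu p l j)
      rwa [sub_neg_eq_add] at h2

theorem N3_eq {p : G.Param} {u : G.Param → Fin 2 → ℂ} {L : ℂ} (h : G.HasFinitePart (G.pt p)
    (G.hyperIntegrand M k₁ k₂ (G.withZero u) p (Sum.inr ())) L) : G.N3 M k₁ k₂ u p = L := by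
  have hex : ∃ L, G.HasFinitePart (G.pt p)
    (G.hyperIntegrand M k₁ k₂ (G.withZero u) p (Sum.inr ())) L := ⟨L, h⟩
  rw [N3, hyperN, finitePart, dif_pos hex]
  exact HasFinitePart.unique G hex.choose_spec h

/-- The two parts of `fluxKernel` are separately integrable against `du/ds`: one gives `N₃³`, and
the other is the derivative computed in `hasDerivAt_N32` divided by the speed at `x`. -/
theorem sum_fluxKernel_eq (hk : k₁ ^ 2 ≠ k₂ ^ 2) (h₁ : k₁ ≠ 0) (h₂ : k₂ ≠ 0)
    (hu : G.IsDensity u) (p : G.Param) :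
    ∑ l, ∑ j, ∫ s in Ioc 0 (2 * Real.pi),
        M.fluxKernel k₁ k₂ (G.normal p) j (G.pt p - G.curve l s) * G.densityDeriv u l j s =
      G.dds (G.N32 M k₁ k₂ (G.dds u)) p + G.N33 M k₁ k₂ (G.dds u) p := by
  have hK := G.halfSingular_ker33 M hk h₁ h₂
  have hd : ∀ r j, G.pt p ≠ G.pt r → G.ker33 M k₁ k₂ p r j =
      M.diffKernel3 k₁ k₂ (G.normal p) j (G.pt p - G.pt r) := fun r j hr =>
    M.kernel3_eq k₁ k₂ hk h₁ h₂ hr (G.normal p) j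
  have h : (G.speed p : ℂ) ≠ 0 := by exact_mod_cast (G.speed_pos p).ne'
  rw [N33, G.intOp_dds_eq hK hu p hd, dds, (G.hasDerivAt_N32 M h₁ h₂ hu p).deriv,
    Complex.real_smul, Finset.mul_sum, ← Finset.sum_add_distrib]
  refine Finset.sum_congr rfl fun l _ => ?_
  rw [Finset.mul_sum, ← Finset.sum_add_distrib]
  refine Finset.sum_congr rfl fun j _ => ?_
  have hi1 := HalfSingular.integrableOn_diff G hK hu p hd l j
  have hi2 : IntegrableOn (fun s => M.fluxKernel k₁ k₂ (G.normal p) j (G.pt p - G.curve l s) *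
      G.densityDeriv u l j s) (Ioc 0 (2 * Real.pi)) := by
    obtain ⟨D, hD⟩ := G.exists_diam
    obtain ⟨C, hC, hb, -⟩ := M.mild_fluxKernel k₁ k₂ hk (G.normal p) j D
    obtain ⟨B, hB⟩ := hu.exists_bound_deriv l j
    refine (G.isClosedCurve l).integrableOn_of_bound (G.pt p) (C := C * B)
      (ContinuousOn.mul (fun s hs => (G.hasDerivAt_fluxKernel M hk p l j
        hs).continuousAt.continuousWithinAt) (hu.continuous_deriv l j).continuousOn)
      fun s hs => ?_
    rw [norm_mul, mul_right_comm]
    exact mul_le_mul (hb _ (sub_ne_zero.2 hs.symm) (hD p (l, s))) (hB s) (norm_nonneg _)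
      (by positivity)
  rw [← sub_eq_iff_eq_add, ← integral_sub hi2 hi1, ← integral_const_mul]
  refine integral_congr_ae (Eventually.of_forall fun s => ?_)
  simp only [Medium.fluxKernel, tang_normal, Fin.sum_univ_two, Complex.ofReal_div,
    Complex.ofReal_inv]
  field_simp
  ring

end SmoothBoundary

end

end Poro

/-! ### The regularized formula for `N₃` -/

theorem mainTheorem5 (M : Poro.Medium) (k₁ k₂ : ℂ) (hk : M.IsWaveNumberPair k₁ k₂)
    (hk_ne : k₁ ^ 2 ≠ k₂ ^ 2)
    (Ω : Set Poro.Plane) (_hΩ_open : IsOpen Ω) (_hΩ_conn : IsConnected Ω)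
    (_hΩ_bdd : Bornology.IsBounded Ω) (G : Poro.SmoothBoundary Ω) :
    G.WeaklySingular (G.ker31 M k₁ k₂) ∧
    G.WeaklySingular (G.ker32 M k₁ k₂) ∧
    G.WeaklySingular (G.ker33 M k₁ k₂) ∧
    ∀ u : Poro.Plane → Fin 2 → ℂ, (∀ j, ContDiff ℝ 1 (fun t => u (G.curve j t))) →
      ∀ p : G.Param,
        (∃ L, G.HasFinitePart (G.pt p)
          (G.hyperIntegrand M k₁ k₂ (G.withZero fun r => u (G.pt r)) p (Sum.inr ())) L) ∧
        G.TangDiffAt (G.N32 M k₁ k₂ (G.dds fun r => u (G.pt r))) p ∧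
        G.N3 M k₁ k₂ (fun r => u (G.pt r)) p =
          G.N31 M k₁ k₂ (fun r => u (G.pt r)) p
            + G.dds (G.N32 M k₁ k₂ (G.dds fun r => u (G.pt r))) p
            + G.N33 M k₁ k₂ (G.dds fun r => u (G.pt r)) p := by
  obtain ⟨h₁, h₂⟩ := hk.ne_zero
  refine ⟨(G.halfSingular_ker31 M h₁ h₂).weaklySingular,
    (G.halfSingular_ker32 M h₁ h₂).weaklySingular,
    (G.halfSingular_ker33 M hk_ne h₁ h₂).weaklySingular, fun u hu p => ?_⟩
  -- A function of the boundary point becomes a periodic density, the periodicity being inherited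
  -- from the parametrizations.
  have hu' : G.IsDensity fun r => u (G.pt r) :=
    ⟨hu, fun l t => congrArg u (G.periodic l t)⟩
  have hfp := G.hasFinitePart_hyperIntegrand M hk hk_ne hu' p
  refine ⟨⟨_, hfp⟩, (G.hasDerivAt_N32 M h₁ h₂ hu' p).differentiableAt, ?_⟩
  rw [G.N3_eq M hfp, G.sum_fluxKernel_eq M hk_ne h₁ h₂ hu' p, add_assoc]
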